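/- **Theorem (Bounds around the $i\omega$-axis).** Let $\Phi=\{\Phi(n)\}_{n\ge 0}$ be a discrete-time Markov chain with transition kernel $P$ on a measurable space $\mathsf X$ with countably generated $\sigma$-field, and write $R=\sum_{n\ge0}(1-e^{-1})e^{-n}P^n$. Assume that: (i) $\Phi$ is $\psi$-irreducible (with $\psi$ a maximal irreducibility measure) and aperiodic: for every measurable $A$ with $\psi(A)>0$ and every $x$, $P^n(x,A)>0$ for all large $n$. There are a measurable $V:\mathsf X\to[1,\infty)$, a measurable $s:\mathsf X\to(0,1]$, a probability measure $\nu$ and constants $\delta>0$, $b<\infty$ with $$PV-V\le-\delta V+bs,\qquad R\ge s\otimes\nu ,$$ and the invariant probability measure $\pi$ satisfies $\pi(V^2)<\infty$. (ii) $F:\mathsf X\to[-1,1]$ is measurable, $\pi(F)=0$, and with $S_n=\sum_{i=0}^{n-1}F(\Phi(i))$ the asymptotic variance $\sigma^2=\lim_n \mathrm{Var}_x(S_n)/n$ is positive. Let $L_\infty^V$ be the space of measurable $g:\mathsf X\to\mathbb C$ with $\|g\|_V=\sup_x|g(x)|/V(x)<\infty$. For $\alpha\in\mathbb C$ let $\widehat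 P_\alpha g(x)=e^{\alpha F(x)}Pg(x)$, and let $\mathcal S_\alpha$ be the set of nonzero $z\in\mathbb C$ for which $zI-\widehat P_\alpha$ has no bounded linear inverse on $L_\infty^V$. Let $I$ be the set of real $a$ with $$|a|\le\bar a:=\Bigl(\frac{e-1}{2b-\delta}\Bigr)\delta\qquad\text{and}\qquad e^{|a|}(1-\delta)\le1 .$$ Then for each $a\in I$ the operator $\widehat P_a$ has a (unique) maximal isolated eigenvalue $\lambda_a\in\mathcal S_a$, that is, $|z|\le|\lambda_a|$ for all $z\in\mathcal S_a$, and $\mathcal S_a\cap\{|z|\ge|\lambda_a|-\delta_0\}=\{\lambda_a\}$ for some $\delta_0>0$. Moreover $\lambda_a>0$, and with $\Lambda(a)=\log\lambda_a$ the following hold. A function $G:\mathsf X\to\mathbb R$ is *lattice with span $h>0$* if $h$ is the largest number for which there is $0\le d<h$ such that $(G(x)-d)/h$ is an integer for all $x$. $F$ is *almost-lattice* if $F=F_0+F_\ell$ with $F_\ell$ lattice and $F_0\in L_\infty^V$ of zero asymptotic variance; its *span* is the largest span of $F_\ell$ over all such decompositions. Otherwise $F$ is *strongly non-lattice*. (NL)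 If $F$ is strongly non-lattice then for any $0<\omega_0<\omega_1<\infty$ there exist $b_0>0$, $B_0<\infty$ such that $$\bigl|\mathsf E_x[\exp(\alpha S_n-n\Lambda(a))]\bigr|\le B_0V(x)e^{-b_0n},\qquad x\in\mathsf X,\ n\ge1,\tag{1}$$ for all $\alpha=a+i\omega$ with $a\in I$ and $\omega_0\le|\omega|\le\omega_1$. (L) If $F$ is almost-lattice with span $h>0$ then for any $\epsilon>0$ there exist $b_0>0$, $B_0<\infty$ such that (1) holds for all $\alpha=a+i\omega$ with $a\in I$ and $\epsilon\le|\omega|\le2\pi/h-\epsilon$. -/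

import Mathlib

open MeasureTheory ProbabilityTheory Filter Topology Set
open scoped ENNReal

noncomputable section

namespace MultErgodic

variable {X : Type*} [MeasurableSpace X]

/-! ### Markov chain with transition kernel `P`: path law, resolvent, ergodicity -/

/-- The transition from the history `Φ(0), …, Φ(n)` to `Φ(n+1)`: it only looks at `Φ(n)`. -/
def stepKernel (P : Kernel X X) (n : ℕ) : Kernel ((i : Finset.Iic n) → X) X :=
  P.comap (fun y => y ⟨n, Finset.mem_Iic.2 le_rfl⟩) (measurable_pi_apply _)

instance (P : Kernel X X) [IsMarkovKernel P] (n : ℕ) : IsMarkovKernel (stepKernel P n) := by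
  unfold stepKernel; infer_instance

/-- `P_x`: the law on trajectories `ℕ → X` of the Markov chain with transition kernel `P`
started at `Φ(0) = x` (Ionescu-Tulcea construction). -/
def pathLaw (P : Kernel X X) [IsMarkovKernel P] (x : X) : Measure (ℕ → X) :=
  Kernel.traj (X := fun _ => X) (stepKernel P) 0 (fun _ => x)

/-- The partial sums `S_n = ∑_{i=0}^{n-1} F(Φ(i))`. -/
def partialSum (F : X → ℝ) (n : ℕ) (φ : ℕ → X) : ℝ := ∑ i ∈ Finset.range n, F (φ i)

/-- The resolvent `R_θ(x, A) = ∑_{n ≥ 0} (1 - e^{-θ}) e^{-θ n} P^n(x, A)`. -/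
def resolvent (P : Kernel X X) (θ : ℝ) (x : X) (A : Set X) : ℝ≥0∞ :=
  ∑' n : ℕ, ENNReal.ofReal ((1 - Real.exp (-θ)) * Real.exp (-θ * n)) * (P ^ n) x A

/-- `ψ` is a maximal irreducibility measure of `P`. -/
structure IsMaximalIrreducibilityMeasure (P : Kernel X X) (ψ : Measure X) : Prop where
  sigmaFinite : SigmaFinite ψ
  irreducible : Kernel.IsIrreducible ψ P
  maximal : ∀ ψ' : Measure X, SigmaFinite ψ' → Kernel.IsIrreducible ψ' P → ψ' ≪ ψ

/-- The drift and minorization condition (V4) with constants `δ`, `b`: for some measurable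
`s : X → (0,1]` and some probability measure `ν`,
`P V - V ≤ -δ V + b s` and `R ≥ s ⊗ ν`, where `R = R_1`. -/
structure DriftV4 (P : Kernel X X) (V : X → ℝ) (δ b : ℝ) (s : X → ℝ) (ν : Measure X) : Prop where
  delta_pos : 0 < δ
  s_meas : Measurable s
  s_pos : ∀ x, 0 < s x
  s_le_one : ∀ x, s x ≤ 1
  nu_prob : IsProbabilityMeasure ν
  integrable : ∀ x, Integrable V (P x)
  drift : ∀ x, (∫ y, V y ∂(P x)) - V x ≤ -δ * V x + b * s x
  minor : ∀ x, ∀ A, MeasurableSet A → ENNReal.ofReal (s x) * ν A ≤ resolvent P 1 x A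

/-- Geometric ergodicity with the finite-valued Lyapunov function `V : X → [1, ∞)`, where `δ`, `b`
are the constants of (V4): `ψ`-irreducible, aperiodic, and (V4) holds. -/
structure GeometricallyErgodic (P : Kernel X X) (V : X → ℝ) (δ b : ℝ) : Prop where
  V_meas : Measurable V
  one_le_V : ∀ x, 1 ≤ V x
  irreducible_aperiodic : ∃ ψ : Measure X, IsMaximalIrreducibilityMeasure P ψ ∧
    ∀ A, MeasurableSet A → 0 < ψ A → ∀ x, ∀ᶠ n : ℕ in atTop, 0 < (P ^ n) x A
  v4 : ∃ (s : X → ℝ) (ν : Measure X), DriftV4 P V δ b s ν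

/-- The asymptotic variance of `G`, `lim_n Var_x(S_n) / n` with `S_n` the partial sums of `G`,
exists for every initial state `x` and equals `v`. -/
def HasAsymptoticVariance (P : Kernel X X) [IsMarkovKernel P] (G : X → ℝ) (v : ℝ) : Prop :=
  ∀ x, (∀ n, MemLp (partialSum G n) 2 (pathLaw P x)) ∧
    Tendsto (fun n : ℕ => Var[partialSum G n; pathLaw P x] / n) atTop (𝓝 v)

/-- The standing assumptions on the chain and on the functional `F : X → [-1,1]`. -/
structure StandingAssumptions (P : Kernel X X) [IsMarkovKernel P] (V F : X → ℝ) (π : Measure X)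
    (δ b : ℝ) : Prop where
  ergodic : GeometricallyErgodic P V δ b
  pi_prob : IsProbabilityMeasure π
  pi_inv : Kernel.Invariant P π
  pi_V_sq : Integrable (fun x => V x ^ 2) π
  F_meas : Measurable F
  F_mem : ∀ x, F x ∈ Icc (-1 : ℝ) 1
  F_mean : ∫ x, F x ∂π = 0
  variance_pos : ∃ v, 0 < v ∧ HasAsymptoticVariance P F v

/-! ### Lattice, almost-lattice and strongly non-lattice functionals -/

/-- `h > 0` is a lattice constant of `G`: `(G(x) - d)/h` is an integer for all `x`, for some
`0 ≤ d < h`. -/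
def IsLatticeConstant (G : X → ℝ) (h : ℝ) : Prop :=
  0 < h ∧ ∃ d, 0 ≤ d ∧ d < h ∧ ∀ x, ∃ k : ℤ, (G x - d) / h = k

/-- `G` is lattice with span `h`: the largest lattice constant. -/
def IsLatticeWithSpan (G : X → ℝ) (h : ℝ) : Prop :=
  IsGreatest {h' | IsLatticeConstant G h'} h

/-- `F = F₀ + F_ℓ` with `F_ℓ` lattice with span `h`, and `F₀ ∈ L_∞^V` of zero asymptotic
variance. -/
def HasAlmostLatticeDecomposition (P : Kernel X X) [IsMarkovKernel P] (V F : X → ℝ) (h : ℝ) :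
    Prop :=
  ∃ F₀ Fl : X → ℝ, (∀ x, F x = F₀ x + Fl x) ∧ IsLatticeWithSpan Fl h ∧
    Measurable F₀ ∧ (∃ C, ∀ x, |F₀ x| ≤ C * V x) ∧ HasAsymptoticVariance P F₀ 0

/-- `F` is almost-lattice with span `h`. The decomposition is not unique; the span of `F` is the
largest span of a lattice part. -/
def IsAlmostLatticeWithSpan (P : Kernel X X) [IsMarkovKernel P] (V F : X → ℝ) (h : ℝ) : Prop :=
  IsGreatest {h' | HasAlmostLatticeDecomposition P V F h'} h

/-- `F` is strongly non-lattice: it has no almost-lattice decomposition. -/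
def StronglyNonLattice (P : Kernel X X) [IsMarkovKernel P] (V F : X → ℝ) : Prop :=
  ¬ ∃ h, HasAlmostLatticeDecomposition P V F h

/-! ### The operators `P̂_α` on `L_∞^V` and their spectrum -/

/-- The space `L_∞^V` of measurable `g : X → ℂ` with `sup_x |g(x)| / V(x) < ∞`. -/
def MemLV (V : X → ℝ) (g : X → ℂ) : Prop :=
  Measurable g ∧ BddAbove (range fun x => ‖g x‖ / V x)

/-- The norm of `L_∞^V`. -/
def normV (V : X → ℝ) (g : X → ℂ) : ℝ := ⨆ x, ‖g x‖ / V x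

/-- The operator `P̂_α g (x) = e^{α F(x)} P g (x)`. -/
def tilted (P : Kernel X X) (F : X → ℝ) (α : ℂ) (g : X → ℂ) (x : X) : ℂ :=
  Complex.exp (α * F x) * ∫ y, g y ∂(P x)

/-- `z I - P̂_α` has an inverse which is a bounded linear operator on `L_∞^V`: the equation
`z g - P̂_α g = h` has exactly one solution `g ∈ L_∞^V` for each `h ∈ L_∞^V`, and
`‖g‖_V ≤ C ‖h‖_V`. -/
def HasBoundedInverse (P : Kernel X X) (V F : X → ℝ) (α z : ℂ) : Prop :=
  ∃ C : ℝ, ∀ h, MemLV V h → ∃ g, (MemLV V g ∧ (∀ x, z * g x - tilted P F α g x = h x)) ∧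
    normV V g ≤ C * normV V h ∧
    ∀ g', MemLV V g' → (∀ x, z * g' x - tilted P F α g' x = h x) → g' = g

/-- The spectrum `𝒮_α` of `P̂_α` on `L_∞^V` (nonzero points only). -/
def spec (P : Kernel X X) (V F : X → ℝ) (α : ℂ) : Set ℂ :=
  {z | z ≠ 0 ∧ ¬ HasBoundedInverse P V F α z}

/-- `lam` is the maximal, isolated eigenvalue of `P̂_α`. By the last two conditions there is at
most one such `lam`. -/
structure IsPrincipalEigenvalue (P : Kernel X X) (V F : X → ℝ) (α lam : ℂ) : Prop where
  eigen : ∃ g, MemLV V g ∧ g ≠ 0 ∧ ∀ x, tilted P F α g x = lam * g x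
  mem : lam ∈ spec P V F α
  maximal : ∀ z ∈ spec P V F α, ‖z‖ ≤ ‖lam‖
  isolated : ∃ δ₀ > 0, spec P V F α ∩ {z | ‖lam‖ - δ₀ ≤ ‖z‖} = {lam}

/-- The range of `a = Re α`: `|a| ≤ ā = (e - 1) δ / (2 b - δ)` and `e^{|a|} (1 - δ) ≤ 1`.
For `δ < 1` the second condition reads `|a| ≤ |log(1 - δ)|`; for `δ ≥ 1` it is void. -/
def InStrip (δ b a : ℝ) : Prop :=
  |a| ≤ (Real.exp 1 - 1) / (2 * b - δ) * δ ∧ Real.exp |a| * (1 - δ) ≤ 1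

/-- `|E_x[exp(α S_n - n Λ(a))]| ≤ B₀ V(x) e^{-b₀ n}` for `α = a + i ω`. -/
def ExpBound (P : Kernel X X) [IsMarkovKernel P] (V F : X → ℝ) (Lam : ℝ → ℝ) (b₀ B₀ a ω : ℝ)
    (x : X) (n : ℕ) : Prop :=
  ‖∫ φ, Complex.exp (((a : ℂ) + ω * Complex.I) * partialSum F n φ - n * Lam a)
      ∂(pathLaw P x)‖ ≤ B₀ * V x * Real.exp (-b₀ * n)

end MultErgodic

end

set_option linter.unusedSectionVars false

noncomputable section

namespace MultErgodic

variable {X : Type*} [MeasurableSpace X]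

/-! ### Measurable functions dominated by a weight -/

/-! By the Markov property `P̂_αⁿ 1 (x) = E_x[exp(α S_n)]`, so (1) says that the powers of `P̂_α /
λ_a` decay geometrically on `L_∞^V`, uniformly over a compact set of parameters. Since `α ↦ P̂_α` is
norm continuous, it is enough to show at each parameter separately that the spectral radius of
`P̂_{a+iω}` is strictly smaller than the spectral radius `λ_a` of `P̂_a` (`exists_expBound`).

Quasi-compactness. Put `η = min(δ, ā)` and `q = max(1 - η, 0)`. Drift and minorization combine into
a function `W`, comparable with `V`, such that `R W - s ν(W) ≤ (e-1)/(e-1+η) W`; the constant `ā` is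
the threshold of this computation. Two estimates follow. A nonnegative `g` with `κ g ≤ e^{aF} P g +
ε V` and `κ > e^{|a|} q` satisfies `g ≤ C (ν(g) + ε) V` (`apriori`), and the integral of `V` under
`Pⁿ` off an absorbing set of full `ν`-measure is `O(qⁿ)` (`pow_V_compl_le`). As the σ-field is
countably generated, `L¹(π)` is separable, and bounded sequences have subsequences that converge
weakly against it. On an absorbing set on which all `P^m(x, ·)` have `π`-densities, weak convergence
of approximate eigenvectors becomes pointwise convergence; the complement is negligible by the
second estimate, and the first one upgrades pointwise to norm convergence. Hence approximate
eigenvectors for `|z| > e^{|Re α|} q` subconverge to eigenvectors (`exists_subseq_tendsto`).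

Perron–Frobenius theory. If `λ_a > e^{|a|} q`, normalised resolvents of `V` at real points
decreasing to `λ_a` yield a positive eigenfunction `f`, and dually an eigenfunctional `ℓ`
(`exists_perron`). The functional `ℓ` is faithful enough that a subsolution of the eigenvalue
equation is a solution on an absorbing set of full `ν`-measure (`exists_absorbing_of_subsolution`).
If `P̂_α g = z g` with `|z| = λ_a`, then `|g|` is a subsolution, whence `|g| = c f` on such a set,
and equality in the triangle inequality shows that the phase `u = g/|g|` satisfies `u(Φ(1)) = ζ
e^{-iωF(Φ(0))} u(Φ(0))` almost surely, `ζ = z/λ_a` (`exists_phase`). For `ω = 0` aperiodicity forces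
`z = λ_a`, and the spectral gap follows (`sr_rest_lt`). For `ω ≠ 0`, taking arguments writes `F` as
a bounded coboundary plus a function with values in a coset of `(2π/|ω|) ℤ`, so `F` is
almost-lattice with span at least `2π/|ω|` (`Perron.exists_decomposition`). This is impossible in
(NL), and in (L) because `|ω| < 2π/h`.

The strip. Jensen's inequality and `π(F) = 0` give `λ_a ≥ 1`, and `e^{|a|} q ≤ 1` on `I`. When the
latter is an equality one needs `λ_a > 1`: if `λ_t = 1` for small `t ≠ 0`, equality in Jensen's
inequality at `t/2` makes `F` a coboundary, against positive variance; the inequality passes from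
`a/2` to `a` (`gap_of_inStrip`). -/

/-- `g` is measurable and `|g| ≤ C V` for some constant `C`. -/
def VBdd {G : Type*} [NormedAddCommGroup G] [MeasurableSpace G] (V : X → ℝ) (g : X → G) : Prop :=
  Measurable g ∧ ∃ C, ∀ x, ‖g x‖ ≤ C * V x

section VBdd

variable {G : Type*} [NormedAddCommGroup G] [NormedSpace ℝ G] [MeasurableSpace G] [BorelSpace G]
  [SecondCountableTopology G] {V : X → ℝ} {g g' : X → G}

lemma VBdd.exists_nonneg (hV : ∀ x, 1 ≤ V x) (hg : VBdd V g) :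
    ∃ C, 0 ≤ C ∧ ∀ x, ‖g x‖ ≤ C * V x := by
  obtain ⟨-, C, hC⟩ := hg
  refine ⟨max C 0, le_max_right _ _, fun x => (hC x).trans ?_⟩
  have := hV x
  gcongr
  exact le_max_left _ _

lemma VBdd.integrable (hg : VBdd V g) {μ : Measure X} (hμ : Integrable V μ) : Integrable g μ := by
  obtain ⟨hm, C, hC⟩ := hg
  refine (hμ.const_mul C).mono' hm.aestronglyMeasurable (ae_of_all _ hC)

lemma VBdd.add (hg : VBdd V g) (hg' : VBdd V g') : VBdd V (fun x => g x + g' x) := by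
  obtain ⟨hm, C, hC⟩ := hg
  obtain ⟨hm', C', hC'⟩ := hg'
  refine ⟨hm.add hm', C + C', fun x => ?_⟩
  rw [add_mul]
  exact (norm_add_le _ _).trans (add_le_add (hC x) (hC' x))

lemma VBdd.neg (hg : VBdd V g) : VBdd V (fun x => - g x) := by
  obtain ⟨hm, C, hC⟩ := hg
  exact ⟨hm.neg, C, fun x => by simpa using hC x⟩

lemma VBdd.sub (hg : VBdd V g) (hg' : VBdd V g') : VBdd V (fun x => g x - g' x) := by
  simpa [sub_eq_add_neg] using hg.add hg'.neg

lemma VBdd.norm (hg : VBdd V g) : VBdd V (fun x => ‖g x‖) := by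
  obtain ⟨hm, C, hC⟩ := hg
  exact ⟨hm.norm, C, fun x => by simpa using hC x⟩

lemma VBdd.mul_bdd {𝕜 : Type*} [RCLike 𝕜] {g : X → 𝕜} (hV : ∀ x, 1 ≤ V x) (hg : VBdd V g)
    {c : X → 𝕜} (hc : Measurable c) {K : ℝ} (hK : ∀ x, ‖c x‖ ≤ K) :
    VBdd V (fun x => c x * g x) := by
  obtain ⟨C, hC0, hC⟩ := hg.exists_nonneg hV
  refine ⟨hc.mul hg.1, K * C, fun x => ?_⟩
  rw [norm_mul, mul_assoc]
  have := (norm_nonneg _).trans (hK x)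
  exact mul_le_mul (hK x) (hC x) (norm_nonneg _) this

lemma VBdd.const_mul {𝕜 : Type*} [RCLike 𝕜] {g : X → 𝕜} (hg : VBdd V g) (c : 𝕜) :
    VBdd V (fun x => c * g x) := by
  obtain ⟨hm, C, hC⟩ := hg
  refine ⟨hm.const_mul c, ‖c‖ * C, fun x => ?_⟩
  rw [norm_mul, mul_assoc]
  exact mul_le_mul_of_nonneg_left (hC x) (norm_nonneg _)

lemma VBdd.indicator (hg : VBdd V g) {A : Set X} (hA : MeasurableSet A) (hV : ∀ x, 1 ≤ V x) :
    VBdd V (A.indicator g) := by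
  obtain ⟨C, hC0, hC⟩ := hg.exists_nonneg hV
  exact ⟨hg.1.indicator hA, C, fun x => (norm_indicator_le_norm_self _ _).trans (hC x)⟩

lemma VBdd.of_le {g : X → ℝ} {g' : X → G} (hg : VBdd V g) (hm : Measurable g')
    (h : ∀ x, ‖g' x‖ ≤ g x) : VBdd V g' := by
  obtain ⟨-, C, hC⟩ := hg
  exact ⟨hm, C, fun x => (h x).trans ((le_abs_self _).trans (hC x))⟩

lemma VBdd.of_bdd (hV : ∀ x, 1 ≤ V x) (hm : Measurable g) {K : ℝ} (h : ∀ x, ‖g x‖ ≤ K) :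
    VBdd V g := by
  refine ⟨hm, K, fun x => (h x).trans ?_⟩
  have := (norm_nonneg _).trans (h x)
  exact le_mul_of_one_le_right this (hV x)

lemma vbdd_self (hV : ∀ x, 1 ≤ V x) (hm : Measurable V) : VBdd V V :=
  ⟨hm, 1, fun x => by rw [one_mul, Real.norm_of_nonneg (zero_le_one.trans (hV x))]⟩

lemma VBdd.kernel {κ : Kernel X X} [IsSFiniteKernel κ] (hκ : ∀ x, Integrable V (κ x)) {C : ℝ}
    (hC : ∀ x, ∫ y, V y ∂(κ x) ≤ C * V x) (hV : ∀ x, 1 ≤ V x) (hg : VBdd V g) :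
    VBdd V (fun x => ∫ y, g y ∂(κ x)) := by
  obtain ⟨D, hD0, hD⟩ := hg.exists_nonneg hV
  refine ⟨(hg.1.stronglyMeasurable.integral_kernel).measurable, D * C, fun x => ?_⟩
  calc ‖∫ y, g y ∂(κ x)‖ ≤ ∫ y, D * V y ∂(κ x) :=
        norm_integral_le_of_norm_le ((hκ x).const_mul D) (ae_of_all _ hD)
    _ = D * ∫ y, V y ∂(κ x) := integral_const_mul _ _
    _ ≤ D * C * V x := by rw [mul_assoc]; exact mul_le_mul_of_nonneg_left (hC x) hD0

end VBdd

/-! ### The resolvent as a Markov kernel -/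

/-- The weights `(1 - e⁻¹) e⁻ⁿ` of the resolvent. -/
def resWeight (n : ℕ) : ℝ := (1 - Real.exp (-1)) * Real.exp (-1 * n)

lemma exp_neg_one_lt_one : Real.exp (-1) < 1 := by
  rw [Real.exp_lt_one_iff]; norm_num

lemma resWeight_pos (n : ℕ) : 0 < resWeight n :=
  mul_pos (sub_pos.2 exp_neg_one_lt_one) (Real.exp_pos _)

lemma resWeight_zero : resWeight 0 = 1 - Real.exp (-1) := by simp [resWeight]

lemma resWeight_succ (n : ℕ) : resWeight (n + 1) = Real.exp (-1) * resWeight n := by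
  unfold resWeight
  rw [mul_left_comm, ← Real.exp_add]
  congr 2
  push_cast; ring

lemma resWeight_eq (n : ℕ) : resWeight n = (1 - Real.exp (-1)) * Real.exp (-1) ^ n := by
  unfold resWeight
  rw [← Real.exp_nat_mul]; ring_nf

lemma hasSum_resWeight : HasSum resWeight 1 := by
  have h := (hasSum_geometric_of_lt_one (Real.exp_pos (-1)).le exp_neg_one_lt_one).mul_left
    (1 - Real.exp (-1))
  rw [mul_inv_cancel₀ (sub_pos.2 exp_neg_one_lt_one).ne'] at h
  simpa only [← resWeight_eq] using h

lemma summable_resWeight_mul : Summable (fun n : ℕ => resWeight n * n) := by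
  have h := summable_pow_mul_geometric_of_norm_lt_one 1 (r := Real.exp (-1))
    (by rw [Real.norm_of_nonneg (Real.exp_pos _).le]; exact exp_neg_one_lt_one)
  refine (h.mul_left (1 - Real.exp (-1))).congr fun n => ?_
  rw [resWeight_eq]; ring

instance isMarkovKernel_pow (P : Kernel X X) [IsMarkovKernel P] (n : ℕ) :
    IsMarkovKernel (P ^ n) := by
  induction n with
  | zero => rw [pow_zero]; exact inferInstanceAs (IsMarkovKernel Kernel.id)
  | succ n ih => rw [Kernel.pow_add]; rw [pow_one]; infer_instance

/-- The resolvent `R = ∑ (1 - e⁻¹) e⁻ⁿ Pⁿ` as a kernel. -/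
def resKernel (P : Kernel X X) : Kernel X X where
  toFun x := Measure.sum fun n : ℕ => ENNReal.ofReal (resWeight n) • (P ^ n) x
  measurable' := by
    refine Measure.measurable_of_measurable_coe _ fun A hA => ?_
    simp only [Measure.sum_apply _ hA, Measure.smul_apply, smul_eq_mul]
    exact Measurable.tsum fun n => ((P ^ n).measurable_coe hA).const_mul _

lemma resKernel_apply (P : Kernel X X) (x : X) :
    resKernel P x = Measure.sum fun n : ℕ => ENNReal.ofReal (resWeight n) • (P ^ n) x := rfl

lemma resKernel_apply' (P : Kernel X X) (x : X) {A : Set X} (hA : MeasurableSet A) :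
    resKernel P x A = ∑' n : ℕ, ENNReal.ofReal (resWeight n) * (P ^ n) x A := by
  rw [resKernel_apply, Measure.sum_apply _ hA]; rfl

lemma resKernel_apply_eq_resolvent (P : Kernel X X) (x : X) {A : Set X} (hA : MeasurableSet A) :
    resKernel P x A = resolvent P 1 x A := by
  rw [resKernel_apply' P x hA]; rfl

instance (P : Kernel X X) [IsMarkovKernel P] : IsMarkovKernel (resKernel P) := by
  refine ⟨fun x => ⟨?_⟩⟩
  rw [resKernel_apply' P x MeasurableSet.univ]
  simp only [measure_univ, mul_one]
  rw [← ENNReal.ofReal_tsum_of_nonneg (fun n => (resWeight_pos n).le) hasSum_resWeight.summable,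
    hasSum_resWeight.tsum_eq, ENNReal.ofReal_one]

/-- The term `n = 0` is split off and the extra step of each remaining power is taken last; in the
primed version it is taken first. The first form can be combined with an inequality on `P g`
integrated against `R`, the second identifies `P (R g)`. -/
lemma resKernel_eq_add_comp (P : Kernel X X) (x : X) :
    resKernel P x = ENNReal.ofReal (1 - Real.exp (-1)) • Measure.dirac x +
      ENNReal.ofReal (Real.exp (-1)) • ((P ∘ₖ resKernel P) x) := by
  ext A hA
  rw [resKernel_apply' P x hA, tsum_eq_zero_add' ENNReal.summable, Measure.add_apply,
    Measure.smul_apply, Measure.smul_apply, Kernel.comp_apply' _ _ _ hA, resKernel_apply,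
    lintegral_sum_measure, smul_eq_mul, smul_eq_mul, ← ENNReal.tsum_mul_left, resWeight_zero,
    pow_zero]
  congr 1
  refine tsum_congr fun n => ?_
  rw [lintegral_smul_measure, Kernel.pow_succ_apply_eq_lintegral _ _ _ hA, resWeight_succ,
      ENNReal.ofReal_mul (Real.exp_pos _).le, smul_eq_mul, mul_assoc]

lemma resKernel_eq_add_comp' (P : Kernel X X) (x : X) :
    resKernel P x = ENNReal.ofReal (1 - Real.exp (-1)) • Measure.dirac x +
      ENNReal.ofReal (Real.exp (-1)) • ((resKernel P ∘ₖ P) x) := by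
  ext A hA
  rw [resKernel_apply' P x hA, tsum_eq_zero_add' ENNReal.summable, Measure.add_apply,
    Measure.smul_apply, Measure.smul_apply, Kernel.comp_apply' _ _ _ hA,
    smul_eq_mul, smul_eq_mul, resWeight_zero, pow_zero]
  simp_rw [resKernel_apply' P _ hA]
  rw [lintegral_tsum fun n => (((P ^ n).measurable_coe hA).const_mul _).aemeasurable,
    ← ENNReal.tsum_mul_left]
  congr 1
  refine tsum_congr fun n => ?_
  rw [lintegral_const_mul _ ((P ^ n).measurable_coe hA), Kernel.pow_add, pow_one,
      Kernel.comp_apply' _ _ _ hA, resWeight_succ,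
      ENNReal.ofReal_mul (Real.exp_pos _).le, mul_assoc]

end MultErgodic

/-! ### Working hypotheses and first consequences of drift and minorization. -/

namespace MultErgodic

variable {X : Type*} [MeasurableSpace X]

/-- The hypotheses of the theorem in the form in which they are used: the drift and minorization
condition with explicit `s` and `ν`, and aperiodicity with respect to `ν`. -/
structure Setup (P : Kernel X X) [IsMarkovKernel P] (V F : X → ℝ) (π : Measure X) (δ b : ℝ)
    (s : X → ℝ) (ν : Measure X) : Prop where
  V_meas : Measurable V
  one_le_V : ∀ x, 1 ≤ V x
  v4 : DriftV4 P V δ b s ν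
  aperiodic : ∀ A, MeasurableSet A → 0 < ν A → ∀ x, ∀ᶠ n : ℕ in atTop, 0 < (P ^ n) x A
  pi_prob : IsProbabilityMeasure π
  pi_inv : Kernel.Invariant P π
  pi_V : Integrable V π
  F_meas : Measurable F
  F_mem : ∀ x, F x ∈ Icc (-1 : ℝ) 1
  F_mean : ∫ x, F x ∂π = 0

/-- Since `s > 0` everywhere, `R ≥ s ⊗ ν` makes `ν` an irreducibility measure, so `ν ≪ ψ` by
maximality and aperiodicity can be stated for `ν`. From here on `ψ` plays no role. -/
lemma StandingAssumptions.exists_setup {P : Kernel X X} [IsMarkovKernel P] {V F : X → ℝ}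
    {π : Measure X} {δ b : ℝ} (hyp : StandingAssumptions P V F π δ b) :
    ∃ s ν, Setup P V F π δ b s ν := by
  obtain ⟨⟨hVm, hV, ⟨ψ, hψ, hap⟩, s, ν, h4⟩, hp, hinv, hV2, hF, hF1, hF0, -⟩ := hyp
  refine ⟨s, ν, hVm, hV, h4, ?_, hp, hinv, ?_, hF, hF1, hF0⟩
  · intro A hA hνA
    refine hap A hA ?_
    have := h4.nu_prob
    have hirr : Kernel.IsIrreducible ν P := by
      refine ⟨fun A hA hνA x => ?_⟩
      by_contra! hcon
      have h1 := h4.minor x A hA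
      have h0 : resolvent P 1 x A = 0 := by
        unfold resolvent
        simp [fun n => le_antisymm (hcon n) bot_le]
      rw [h0, nonpos_iff_eq_zero, mul_eq_zero, ENNReal.ofReal_eq_zero] at h1
      rcases h1 with h1 | h1
      · exact absurd (h4.s_pos x) (not_lt.2 h1)
      · exact hνA.ne' h1
    rw [pos_iff_ne_zero]
    exact fun h => hνA.ne' (hψ.maximal ν inferInstance hirr h)
  · refine hV2.mono' hVm.aestronglyMeasurable (ae_of_all _ fun x => ?_)
    have := hV x
    rw [Real.norm_of_nonneg (by linarith)]
    nlinarith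

lemma integral_bind_kernel {μ : Measure X} {P : Kernel X X} {G : Type*} [NormedAddCommGroup G]
    [NormedSpace ℝ G] {g : X → G} (hg : Integrable g (μ.bind P)) [SFinite μ] [IsSFiniteKernel P] :
    ∫ x, g x ∂(μ.bind P) = ∫ x, ∫ y, g y ∂(P x) ∂μ := by
  have h : (P ∘ₖ Kernel.const Unit μ) () = μ.bind P := by
    rw [Kernel.comp_apply, Kernel.const_apply]
  rw [← h] at hg ⊢
  rw [Kernel.integral_comp hg, Kernel.const_apply]

lemma exp_mul_le_exp_abs {a t : ℝ} (ht : t ∈ Icc (-1 : ℝ) 1) :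
    Real.exp (a * t) ≤ Real.exp |a| := by
  refine Real.exp_le_exp.2 ((le_abs_self _).trans ?_)
  rw [abs_mul]
  exact mul_le_of_le_one_right (abs_nonneg a) (abs_le.2 ht)

lemma exp_neg_abs_le {a t : ℝ} (ht : t ∈ Icc (-1 : ℝ) 1) :
    Real.exp (-|a|) ≤ Real.exp (a * t) := by
  refine Real.exp_le_exp.2 ?_
  have h : |a * t| ≤ |a| := by
    rw [abs_mul]
    exact mul_le_of_le_one_right (abs_nonneg a) (abs_le.2 ht)
  linarith [neg_abs_le (a * t)]

/-- The bound `ā` on the real part of the parameter. -/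
def abar (δ b : ℝ) : ℝ := (Real.exp 1 - 1) / (2 * b - δ) * δ

/-- The decay rate per step on `ν`-null sets is `1 - min δ ā`. -/
def etaRate (δ b : ℝ) : ℝ := min δ (abar δ b)

/-- The contraction rate `max (1 - min δ ā) 0` on `ν`-null sets. -/
def qrate (δ b : ℝ) : ℝ := max (1 - etaRate δ b) 0

lemma InStrip.abs_le {δ b a : ℝ} (h : InStrip δ b a) : |a| ≤ abar δ b := h.1

namespace Setup

variable {P : Kernel X X} [IsMarkovKernel P] {V F : X → ℝ} {π : Measure X} {δ b : ℝ}
    {s : X → ℝ} {ν : Measure X} (S : Setup P V F π δ b s ν)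

include S

lemma V_pos (x : X) : 0 < V x := zero_lt_one.trans_le (S.one_le_V x)

lemma delta_pos : 0 < δ := S.v4.delta_pos

lemma nonempty : Nonempty X := by
  have := S.pi_prob
  exact nonempty_of_isProbabilityMeasure π

lemma integral_V_pi : ∫ x, ∫ y, V y ∂(P x) ∂π = ∫ x, V x ∂π := by
  have := S.pi_prob
  have h := integral_bind_kernel (μ := π) (P := P) (g := V) (by rw [S.pi_inv.def]; exact S.pi_V)
  rw [S.pi_inv.def] at h
  exact h.symm

lemma integrable_PV_pi : Integrable (fun x => ∫ y, V y ∂(P x)) π := by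
  have := S.pi_prob
  have h : (P ∘ₖ Kernel.const Unit π) () = π := by
    rw [Kernel.comp_apply, Kernel.const_apply, S.pi_inv.def]
  have h2 : Integrable V ((P ∘ₖ Kernel.const Unit π) ()) := by rw [h]; exact S.pi_V
  simpa using h2.integral_comp

/-- Integrating the drift inequality against `π` gives `δ π(V) ≤ b π(s)`, with `π(V) ≥ 1` and `π(s)
≤ 1`. Consequently the denominator `2b - δ` of `ā` is positive. -/
lemma delta_le_b : δ ≤ b := by
  have := S.pi_prob
  have hsi : Integrable s π := by
    refine (integrable_const (1 : ℝ)).mono' S.v4.s_meas.aestronglyMeasurable (ae_of_all _ fun x => ?_)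
    rw [Real.norm_of_nonneg (S.v4.s_pos x).le]
    exact S.v4.s_le_one x
  have h1 : ∫ x, ((∫ y, V y ∂(P x)) - V x) ∂π ≤ ∫ x, (-δ * V x + b * s x) ∂π :=
    integral_mono (S.integrable_PV_pi.sub S.pi_V) ((S.pi_V.const_mul _).add (hsi.const_mul _))
      S.v4.drift
  rw [integral_sub S.integrable_PV_pi S.pi_V, S.integral_V_pi,
    integral_add (S.pi_V.const_mul _) (hsi.const_mul _), integral_const_mul,
    integral_const_mul] at h1
  have h2 : 1 ≤ ∫ x, V x ∂π := by
    simpa using integral_mono (integrable_const (1 : ℝ)) S.pi_V S.one_le_V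
  have h3 : ∫ x, s x ∂π ≤ 1 := by
    simpa using integral_mono hsi (integrable_const (1 : ℝ)) S.v4.s_le_one
  have h4 : 0 ≤ ∫ x, s x ∂π := integral_nonneg fun x => (S.v4.s_pos x).le
  have hδ := S.delta_pos
  by_contra! hb
  have h5 : δ * 1 ≤ δ * ∫ x, V x ∂π := mul_le_mul_of_nonneg_left h2 hδ.le
  rcases le_or_gt 0 b with hb0 | hb0
  · have h6 := mul_le_mul_of_nonneg_left h3 hb0
    linarith
  · have h6 := mul_nonpos_of_nonpos_of_nonneg hb0.le h4
    linarith

lemma b_pos : 0 < b := S.delta_pos.trans_le S.delta_le_b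

lemma denom_pos : 0 < 2 * b - δ := by linarith [S.delta_le_b, S.delta_pos]

lemma abar_pos : 0 < abar δ b := by
  unfold abar
  have h1 : (1 : ℝ) < Real.exp 1 := Real.one_lt_exp_iff.2 one_pos
  exact mul_pos (div_pos (by linarith) S.denom_pos) S.delta_pos

lemma etaRate_pos : 0 < etaRate δ b := lt_min S.delta_pos S.abar_pos

omit S in
lemma qrate_nonneg : 0 ≤ qrate δ b := le_max_right _ _

omit S in
lemma one_sub_etaRate_le : 1 - etaRate δ b ≤ qrate δ b := le_max_left _ _

/-! ### Growth of `Pⁿ V` and integrability -/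

lemma PV_le (x : X) : ∫ y, V y ∂(P x) ≤ V x + b := by
  have h := S.v4.drift x
  have h1 := S.v4.s_le_one x
  have h2 := S.V_pos x
  have h3 := S.b_pos
  have h4 := S.delta_pos
  nlinarith [mul_pos h4 h2]

lemma lintegral_PV_le (x : X) :
    ∫⁻ y, ENNReal.ofReal (V y) ∂(P x) ≤ ENNReal.ofReal (V x + b) := by
  rw [← ofReal_integral_eq_lintegral_ofReal (S.v4.integrable x)
    (ae_of_all _ fun y => (S.V_pos y).le)]
  exact ENNReal.ofReal_le_ofReal (S.PV_le x)

/-- Iterating the crude bound `P V ≤ V + b`. Linear growth suffices: the weights of `R` decay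
geometrically, and polynomial growth is invisible to the spectral radius of `P`. -/
lemma lintegral_pow_V_le (n : ℕ) (x : X) :
    ∫⁻ y, ENNReal.ofReal (V y) ∂((P ^ n) x) ≤ ENNReal.ofReal (V x + n * b) := by
  induction n generalizing x with
  | zero =>
    change ∫⁻ y, ENNReal.ofReal (V y) ∂(Kernel.id x) ≤ _
    rw [Kernel.id_apply, lintegral_dirac' _ S.V_meas.ennreal_ofReal]
    simp
  | succ n ih =>
    rw [add_comm n 1, Kernel.pow_add, pow_one, Kernel.lintegral_comp _ _ _ S.V_meas.ennreal_ofReal]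
    have hb := S.b_pos.le
    calc ∫⁻ y, ∫⁻ z, ENNReal.ofReal (V z) ∂(P y) ∂((P ^ n) x)
        ≤ ∫⁻ y, (ENNReal.ofReal (V y) + ENNReal.ofReal b) ∂((P ^ n) x) :=
          lintegral_mono fun y => (S.lintegral_PV_le y).trans_eq
            (ENNReal.ofReal_add (S.V_pos y).le hb)
      _ = ∫⁻ y, ENNReal.ofReal (V y) ∂((P ^ n) x) + ENNReal.ofReal b := by
          rw [lintegral_add_right _ measurable_const]; simp
      _ ≤ ENNReal.ofReal (V x + n * b) + ENNReal.ofReal b := by gcongr; exact ih x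
      _ = ENNReal.ofReal (V x + (1 + n : ℕ) * b) := by
          rw [← ENNReal.ofReal_add (by have := S.V_pos x; positivity) hb]
          congr 1; push_cast; ring

lemma integrable_of_lintegral_V {μ : Measure X}
    (h : ∫⁻ y, ENNReal.ofReal (V y) ∂μ < ∞) : Integrable V μ := by
  refine ⟨S.V_meas.aestronglyMeasurable, ?_⟩
  rw [hasFiniteIntegral_iff_ofReal (ae_of_all _ fun y => (S.V_pos y).le)]
  exact h

lemma integrable_pow (n : ℕ) (x : X) : Integrable V ((P ^ n) x) :=
  S.integrable_of_lintegral_V ((S.lintegral_pow_V_le n x).trans_lt ENNReal.ofReal_lt_top)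

lemma pow_V_le (n : ℕ) (x : X) : ∫ y, V y ∂((P ^ n) x) ≤ V x + n * b := by
  have h := S.lintegral_pow_V_le n x
  rw [← ofReal_integral_eq_lintegral_ofReal (S.integrable_pow n x)
    (ae_of_all _ fun y => (S.V_pos y).le)] at h
  have hb := S.b_pos.le
  exact (ENNReal.ofReal_le_ofReal_iff (by have := S.V_pos x; positivity)).1 h

lemma lintegral_res_V_le : ∃ C : ℝ, 0 ≤ C ∧ ∀ x,
    ∫⁻ y, ENNReal.ofReal (V y) ∂(resKernel P x) ≤ ENNReal.ofReal (C * V x) := by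
  have hb := S.b_pos.le
  refine ⟨1 + (∑' n : ℕ, resWeight n * n) * b, ?_, fun x => ?_⟩
  · have : 0 ≤ ∑' n : ℕ, resWeight n * n :=
      tsum_nonneg fun n => mul_nonneg (resWeight_pos n).le n.cast_nonneg
    positivity
  have hV := S.one_le_V x
  have hs : HasSum (fun n : ℕ => resWeight n * (V x + n * b))
      (1 * V x + (∑' n : ℕ, resWeight n * n) * b) := by
    refine ((hasSum_resWeight.mul_right (V x)).add
      (summable_resWeight_mul.hasSum.mul_right b)).congr_fun ?_
    intro n; ring
  rw [resKernel_apply, lintegral_sum_measure]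
  calc ∑' n, ∫⁻ y, ENNReal.ofReal (V y) ∂(ENNReal.ofReal (resWeight n) • (P ^ n) x)
      ≤ ∑' n : ℕ, ENNReal.ofReal (resWeight n * (V x + n * b)) := by
        refine ENNReal.tsum_le_tsum fun n => ?_
        rw [lintegral_smul_measure, ENNReal.ofReal_mul (resWeight_pos n).le, smul_eq_mul]
        gcongr
        exact S.lintegral_pow_V_le n x
    _ = ENNReal.ofReal (1 * V x + (∑' n : ℕ, resWeight n * n) * b) := by
        rw [← ENNReal.ofReal_tsum_of_nonneg _ hs.summable, hs.tsum_eq]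
        intro n
        have := (resWeight_pos n).le
        positivity
    _ ≤ _ := by
        refine ENNReal.ofReal_le_ofReal ?_
        have : 0 ≤ ∑' n : ℕ, resWeight n * n :=
          tsum_nonneg fun n => mul_nonneg (resWeight_pos n).le n.cast_nonneg
        nlinarith [mul_nonneg this hb]

lemma integrable_res (x : X) : Integrable V (resKernel P x) := by
  obtain ⟨C, -, hC⟩ := S.lintegral_res_V_le
  exact S.integrable_of_lintegral_V ((hC x).trans_lt ENNReal.ofReal_lt_top)

lemma exists_res_V_le : ∃ C : ℝ, 0 ≤ C ∧ ∀ x, ∫ y, V y ∂(resKernel P x) ≤ C * V x := by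
  obtain ⟨C, hC0, hC⟩ := S.lintegral_res_V_le
  refine ⟨C, hC0, fun x => ?_⟩
  have h := hC x
  rw [← ofReal_integral_eq_lintegral_ofReal (S.integrable_res x)
    (ae_of_all _ fun y => (S.V_pos y).le)] at h
  exact (ENNReal.ofReal_le_ofReal_iff (mul_nonneg hC0 (S.V_pos x).le)).1 h

lemma smul_nu_le_res (x : X) : ENNReal.ofReal (s x) • ν ≤ resKernel P x := by
  refine Measure.le_iff.2 fun A hA => ?_
  rw [resKernel_apply_eq_resolvent P x hA, Measure.smul_apply, smul_eq_mul]
  exact S.v4.minor x A hA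

/-- Inherited from the resolvent at any single point, since `s(x) ν ≤ R(x, ·)` with `s(x) > 0`. -/
lemma integrable_nu : Integrable V ν := by
  obtain ⟨x⟩ := S.nonempty
  have h := (S.integrable_res x).mono_measure (S.smul_nu_le_res x)
  exact (integrable_smul_measure (by simpa using S.v4.s_pos x) ENNReal.ofReal_ne_top).1 h

lemma s_mul_nu_le_res {g : X → ℝ} (hg : VBdd V g) (h0 : ∀ x, 0 ≤ g x) (x : X) :
    s x * ∫ y, g y ∂ν ≤ ∫ y, g y ∂(resKernel P x) := by
  have h := integral_mono_measure (S.smul_nu_le_res x) (ae_of_all _ h0)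
    (hg.integrable (S.integrable_res x))
  rwa [integral_smul_measure, ENNReal.toReal_ofReal (S.v4.s_pos x).le, smul_eq_mul] at h

section

variable {G : Type*} [NormedAddCommGroup G] [NormedSpace ℝ G] [CompleteSpace G] [MeasurableSpace G]
  [BorelSpace G] [SecondCountableTopology G] {g : X → G}

lemma vbdd_P (hg : VBdd V g) : VBdd V (fun x => ∫ y, g y ∂(P x)) := by
  refine hg.kernel (C := 1 + b) S.v4.integrable (fun x => (S.PV_le x).trans ?_) S.one_le_V
  nlinarith [S.one_le_V x, S.b_pos]

lemma vbdd_res (hg : VBdd V g) : VBdd V (fun x => ∫ y, g y ∂(resKernel P x)) := by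
  obtain ⟨C, -, hC⟩ := S.exists_res_V_le
  exact hg.kernel S.integrable_res hC S.one_le_V

lemma vbdd_pow (n : ℕ) (hg : VBdd V g) : VBdd V (fun x => ∫ y, g y ∂((P ^ n) x)) := by
  refine hg.kernel (C := 1 + n * b) (S.integrable_pow n) (fun x => (S.pow_V_le n x).trans ?_)
    S.one_le_V
  have := mul_nonneg (n.cast_nonneg (α := ℝ)) S.b_pos.le
  nlinarith [S.one_le_V x]

lemma integral_pow_succ (n : ℕ) (hg : VBdd V g) (x : X) :
    ∫ y, g y ∂((P ^ (n + 1)) x) = ∫ y, ∫ z, g z ∂(P y) ∂((P ^ n) x) := by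
  have h : P ^ (n + 1) = P ∘ₖ (P ^ n) := by rw [add_comm, Kernel.pow_add, pow_one]
  have hi := hg.integrable (S.integrable_pow (n + 1) x)
  rw [h] at hi ⊢
  exact Kernel.integral_comp hi

lemma integral_pow_succ' (n : ℕ) (hg : VBdd V g) (x : X) :
    ∫ y, g y ∂((P ^ (n + 1)) x) = ∫ y, ∫ z, g z ∂((P ^ n) y) ∂(P x) := by
  have h : P ^ (n + 1) = (P ^ n) ∘ₖ P := by rw [Kernel.pow_add, pow_one]
  have hi := hg.integrable (S.integrable_pow (n + 1) x)
  rw [h] at hi ⊢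
  exact Kernel.integral_comp hi

omit S in
lemma integral_pow_zero (hg : Measurable g) (x : X) : ∫ y, g y ∂((P ^ 0) x) = g x := by
  change ∫ y, g y ∂(Kernel.id x) = _
  rw [Kernel.id_apply, integral_dirac' _ _ hg.stronglyMeasurable]

end

/-- Common core of the two identities that follow; `K` stands for either order of composition of `P`
and `R`. -/
lemma integral_res_aux {K : Measure X} {g : X → ℝ} (hg : VBdd V g) (x : X)
    (h : resKernel P x = ENNReal.ofReal (1 - Real.exp (-1)) • Measure.dirac x +
      ENNReal.ofReal (Real.exp (-1)) • K) :
    Integrable g K ∧ Real.exp 1 * ∫ y, g y ∂(resKernel P x) =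
      (Real.exp 1 - 1) * g x + ∫ y, g y ∂K := by
  have hi := hg.integrable (S.integrable_res x)
  rw [h] at hi
  have h1 := hi.left_of_add_measure
  have h2 := hi.right_of_add_measure
  refine ⟨(integrable_smul_measure (by simp [Real.exp_pos]) ENNReal.ofReal_ne_top).1 h2, ?_⟩
  rw [h, integral_add_measure h1 h2, integral_smul_measure, integral_smul_measure,
    ENNReal.toReal_ofReal (sub_pos.2 exp_neg_one_lt_one).le,
    ENNReal.toReal_ofReal (Real.exp_pos _).le, integral_dirac' _ _ hg.1.stronglyMeasurable,
    smul_eq_mul, smul_eq_mul]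
  have : Real.exp 1 * Real.exp (-1) = 1 := by rw [← Real.exp_add]; simp
  linear_combination (∫ y, g y ∂K - g x) * this

/-- `e R g = (e - 1) g + R (P g)`. -/
lemma exp_mul_res {g : X → ℝ} (hg : VBdd V g) (x : X) :
    Real.exp 1 * ∫ y, g y ∂(resKernel P x) =
      (Real.exp 1 - 1) * g x + ∫ y, ∫ z, g z ∂(P y) ∂(resKernel P x) := by
  obtain ⟨hi, h⟩ := S.integral_res_aux hg x (resKernel_eq_add_comp P x)
  rw [h, Kernel.integral_comp hi]

/-- `e R g = (e - 1) g + P (R g)`. -/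
lemma exp_mul_res' {g : X → ℝ} (hg : VBdd V g) (x : X) :
    Real.exp 1 * ∫ y, g y ∂(resKernel P x) =
      (Real.exp 1 - 1) * g x + ∫ y, ∫ z, g z ∂(resKernel P y) ∂(P x) := by
  obtain ⟨hi, h⟩ := S.integral_res_aux hg x (resKernel_eq_add_comp' P x)
  rw [h, Kernel.integral_comp hi]

end Setup

end MultErgodic

/-! ### The Lyapunov function of `R - s ⊗ ν` and the a priori estimate. -/

namespace MultErgodic

variable {X : Type*} [MeasurableSpace X]

/-- The measurable set `Y` is absorbing: from `Y` the chain never leaves it. -/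
def IsAbsorbing (P : Kernel X X) (Y : Set X) : Prop :=
  MeasurableSet Y ∧ ∀ x ∈ Y, P x Yᶜ = 0

/-- The Lyapunov function of `R - s ⊗ ν`. -/
def Wfun (V s : X → ℝ) (δ b : ℝ) (x : X) : ℝ :=
  (Real.exp 1 - 1 + δ) * V x - b * s x +
    (Real.exp 1 - 1) * (δ - etaRate δ b) / etaRate δ b

lemma exp_one_sub_one_pos : (0 : ℝ) < Real.exp 1 - 1 := by
  have : (1 : ℝ) < Real.exp 1 := Real.one_lt_exp_iff.2 one_pos
  linarith

namespace Setup

variable {P : Kernel X X} [IsMarkovKernel P] {V F : X → ℝ} {π : Measure X} {δ b : ℝ}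
    {s : X → ℝ} {ν : Measure X} (S : Setup P V F π δ b s ν)

include S

lemma vbdd_V : VBdd V V := vbdd_self S.one_le_V S.V_meas

lemma vbdd_const (c : ℝ) : VBdd V (fun _ : X => c) :=
  VBdd.of_bdd S.one_le_V measurable_const (K := ‖c‖) fun _ => le_rfl

lemma vbdd_s : VBdd V s := by
  refine VBdd.of_bdd S.one_le_V S.v4.s_meas (K := 1) fun x => ?_
  rw [Real.norm_of_nonneg (S.v4.s_pos x).le]
  exact S.v4.s_le_one x

lemma vbdd_W : VBdd V (Wfun V s δ b) :=
  ((S.vbdd_V.const_mul _).sub (S.vbdd_s.const_mul _)).add (S.vbdd_const _)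

/-- This is where `ā` enters: the inequality is a rearrangement of `η ≤ (e-1)δ/(2b-δ)`. Together
with `W_eq` it yields `W ≥ b` everywhere. -/
lemma two_b_le : 2 * b ≤ (Real.exp 1 - 1) * δ / etaRate δ b + δ := by
  have h1 : etaRate δ b ≤ abar δ b := min_le_right _ _
  have h2 := S.etaRate_pos
  have h3 := S.denom_pos
  have : 2 * b - δ ≤ (Real.exp 1 - 1) * δ / etaRate δ b := by
    rw [le_div_iff₀ h2]
    calc (2 * b - δ) * etaRate δ b ≤ (2 * b - δ) * abar δ b :=
          mul_le_mul_of_nonneg_left h1 h3.le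
      _ = (Real.exp 1 - 1) * δ := by unfold abar; field_simp
  linarith

lemma W_eq (x : X) : Wfun V s δ b x = (Real.exp 1 - 1 + δ) * (V x - 1) - b * s x +
    ((Real.exp 1 - 1) * δ / etaRate δ b + δ) := by
  have h2 := S.etaRate_pos.ne'
  unfold Wfun
  field_simp
  ring

lemma exists_V_le_W : ∃ c : ℝ, 0 < c ∧ ∀ x, c * V x ≤ Wfun V s δ b x := by
  have he := exp_one_sub_one_pos
  have hδ := S.delta_pos
  -- `W` is at least `b + (e-1+δ)(V-1)`, so both `b` and the slope `e-1+δ` bound the admissible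
  -- constant.
  refine ⟨min (Real.exp 1 - 1 + δ) b, lt_min (by linarith) S.b_pos, fun x => ?_⟩
  rw [S.W_eq]
  have h1 := S.two_b_le
  have h2 := S.one_le_V x
  have h3 := mul_le_mul_of_nonneg_left (S.v4.s_le_one x) S.b_pos.le
  have h4 : min (Real.exp 1 - 1 + δ) b ≤ b := min_le_right _ _
  have h5 : min (Real.exp 1 - 1 + δ) b * (V x - 1) ≤ (Real.exp 1 - 1 + δ) * (V x - 1) :=
    mul_le_mul_of_nonneg_right (min_le_left _ _) (by linarith)
  linarith

lemma W_pos (x : X) : 0 < Wfun V s δ b x := by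
  obtain ⟨c, hc, h⟩ := S.exists_V_le_W
  exact (mul_pos hc (S.V_pos x)).trans_le (h x)

/-- The drift of `W` under `R - s ⊗ ν`. -/
lemma res_W_sub_le (x : X) :
    ∫ y, Wfun V s δ b y ∂(resKernel P x) - s x * ∫ y, Wfun V s δ b y ∂ν ≤
      (Real.exp 1 - 1) / (Real.exp 1 - 1 + etaRate δ b) * Wfun V s δ b x := by
  have := S.v4.nu_prob
  have he := exp_one_sub_one_pos
  have hη := S.etaRate_pos
  have hδ := S.delta_pos
  have hbp := S.b_pos
  set K := resKernel P x with hK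
  set η := etaRate δ b with hηd
  have hVR : Integrable V K := S.integrable_res x
  have hsR : Integrable s K := S.vbdd_s.integrable hVR
  -- the drift inequality integrated against the resolvent
  have h1 : ∫ y, ∫ z, V z ∂(P y) ∂K ≤ (1 - δ) * ∫ y, V y ∂K + b * ∫ y, s y ∂K := by
    rw [← integral_const_mul, ← integral_const_mul,
      ← integral_add (hVR.const_mul _) (hsR.const_mul _)]
    refine integral_mono ((S.vbdd_P S.vbdd_V).integrable hVR)
      ((hVR.const_mul _).add (hsR.const_mul _)) fun y => ?_
    have := S.v4.drift y
    dsimp only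
    linarith
  have h2 := S.exp_mul_res S.vbdd_V x
  have hW : ∫ y, Wfun V s δ b y ∂K = (Real.exp 1 - 1 + δ) * ∫ y, V y ∂K - b * ∫ y, s y ∂K +
      (Real.exp 1 - 1) * (δ - η) / η := by
    have hi : Integrable (fun y => (Real.exp 1 - 1 + δ) * V y - b * s y) K :=
      (hVR.const_mul _).sub (hsR.const_mul _)
    unfold Wfun
    rw [integral_add hi (integrable_const _),
      integral_sub (hVR.const_mul _) (hsR.const_mul _), integral_const_mul, integral_const_mul]
    simp [← hηd]
  have hν : b ≤ ∫ y, Wfun V s δ b y ∂ν := by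
    have : ∫ _, b ∂ν ≤ ∫ y, Wfun V s δ b y ∂ν := by
      refine integral_mono (integrable_const _) (S.vbdd_W.integrable S.integrable_nu) fun y => ?_
      dsimp only
      rw [S.W_eq]
      have h1 := S.two_b_le
      have h3 := mul_le_mul_of_nonneg_left (S.v4.s_le_one y) hbp.le
      have h5 : 0 ≤ (Real.exp 1 - 1 + δ) * (V y - 1) :=
        mul_nonneg (by linarith) (by linarith [S.one_le_V y])
      linarith
    simpa using this
  have hs0 := S.v4.s_pos x
  have h3 : ∫ y, Wfun V s δ b y ∂K - s x * ∫ y, Wfun V s δ b y ∂ν ≤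
      (Real.exp 1 - 1) * V x + (Real.exp 1 - 1) * (δ - η) / η - s x * b := by
    have := mul_le_mul_of_nonneg_left hν hs0.le
    rw [hW]; linarith
  refine h3.trans ?_
  rw [div_mul_eq_mul_div, le_div_iff₀ (by linarith)]
  unfold Wfun
  rw [← hηd]
  -- The additive constant of `W` is the one whose product with `η` is `(e-1)(δ-η)`; the difference
  -- of the two sides is then at least `(e-1)(δ-η)(V-1) + η b s ≥ 0`.
  have h4 : η ≤ δ := min_le_left _ _
  have h5 : (Real.exp 1 - 1) * (δ - η) / η * η = (Real.exp 1 - 1) * (δ - η) := by field_simp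
  have h6 := mul_nonneg (mul_nonneg he.le (sub_nonneg.2 h4)) (sub_nonneg.2 (S.one_le_V x))
  nlinarith [mul_pos (mul_pos hs0 hbp) hη]

/-- A priori estimate: a nonnegative subsolution is controlled by its integral against `ν`. -/
lemma apriori {a κ : ℝ} (hκ : Real.exp |a| * qrate δ b < κ) :
    ∃ C : ℝ, 0 ≤ C ∧ ∀ g : X → ℝ, VBdd V g → (∀ x, 0 ≤ g x) → ∀ ε : ℝ, 0 ≤ ε →
      (∀ x, κ * g x ≤ Real.exp (a * F x) * ∫ y, g y ∂(P x) + ε * V x) →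
      ∀ x, g x ≤ C * (∫ y, g y ∂ν + ε) * V x := by
  have he := exp_one_sub_one_pos
  have hη := S.etaRate_pos
  obtain ⟨c, hc, hcW⟩ := S.exists_V_le_W
  obtain ⟨D, hD0, hD⟩ := S.vbdd_W.exists_nonneg S.one_le_V
  obtain ⟨CR, hCR0, hCR⟩ := S.exists_res_V_le
  -- Multiplying the hypothesis by `e^{-|a|}` removes the weight `e^{aF}` and leaves `c0 g ≤ P g + ε
  -- V`. Integrated against `R`, with `e R g = (e-1) g + R P g`, this is `(e-1) g ≤ (e - c0) R g + ε
  -- R V`. The truncation in `k` only serves to keep the coefficient nonnegative.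
  set c0 := κ * Real.exp (-|a|) with hc0
  set k := max (Real.exp 1 - c0) 0 with hk
  have hk0 : 0 ≤ k := le_max_right _ _
  -- Since `c0 > q ≥ 1 - η`, one has `e - c0 < e - 1 + η`, so `θ < 1`. With `M = sup g/W` the goal
  -- is `M ≤ θ M + A (ν(g) + ε)`, in which `M` can be absorbed.
  set θ := k / (Real.exp 1 - 1 + etaRate δ b) with hθ
  have hθ1 : θ < 1 := by
    rw [hθ, div_lt_one (by linarith), hk, max_lt_iff]
    refine ⟨?_, by linarith⟩
    have h1 : qrate δ b < c0 := by
      rw [hc0, Real.exp_neg, ← div_eq_mul_inv, lt_div_iff₀ (Real.exp_pos _), mul_comm]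
      exact hκ
    have := one_sub_etaRate_le (δ := δ) (b := b)
    linarith
  set A := (k + CR) / ((Real.exp 1 - 1) * c) with hA
  have hA0 : 0 ≤ A := by positivity
  refine ⟨A / (1 - θ) * D, by have := sub_pos.2 hθ1; positivity, fun g hg h0 ε hε hsub => ?_⟩
  have hν0 : 0 ≤ ∫ y, g y ∂ν := integral_nonneg h0
  obtain ⟨Cg, hCg0, hCg⟩ := hg.exists_nonneg S.one_le_V
  have hbdd : BddAbove (range fun x => g x / Wfun V s δ b x) := by
    refine ⟨Cg / c, ?_⟩
    rintro _ ⟨x, rfl⟩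
    dsimp only
    rw [div_le_div_iff₀ (S.W_pos x) hc]
    have h1 := hCg x
    rw [Real.norm_of_nonneg (h0 x)] at h1
    nlinarith [hcW x, h1]
  set M := ⨆ x, g x / Wfun V s δ b x with hM
  have hMle : ∀ x, g x ≤ M * Wfun V s δ b x := fun x =>
    (div_le_iff₀ (S.W_pos x)).1 (le_ciSup hbdd x)
  have hMW : VBdd V (fun x => M * Wfun V s δ b x) := S.vbdd_W.const_mul M
  have key : ∀ x, g x / Wfun V s δ b x ≤ θ * M + A * (∫ y, g y ∂ν + ε) := by
    intro x
    have hWx := S.W_pos x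
    have hiR : Integrable g (resKernel P x) := hg.integrable (S.integrable_res x)
    have h1 : c0 * ∫ y, g y ∂(resKernel P x) ≤
        ∫ y, ∫ z, g z ∂(P y) ∂(resKernel P x) + ε * ∫ y, V y ∂(resKernel P x) := by
      rw [← integral_const_mul, ← integral_const_mul,
        ← integral_add ((S.vbdd_P hg).integrable (S.integrable_res x))
          ((S.integrable_res x).const_mul _)]
      refine integral_mono (hiR.const_mul _) (((S.vbdd_P hg).integrable (S.integrable_res x)).add
          ((S.integrable_res x).const_mul _)) fun y => ?_
      dsimp only
      have hPg : 0 ≤ ∫ z, g z ∂(P y) := integral_nonneg h0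
      have h2 := hsub y
      have h3 : κ * g y ≤ Real.exp |a| * ∫ z, g z ∂(P y) + ε * V y :=
        h2.trans
          (add_le_add (mul_le_mul_of_nonneg_right (exp_mul_le_exp_abs (S.F_mem y)) hPg) le_rfl)
      have h4 : Real.exp (-|a|) * Real.exp |a| = 1 := by rw [← Real.exp_add]; simp
      have h5 := mul_le_mul_of_nonneg_left h3 (Real.exp_pos (-|a|)).le
      have h6 : Real.exp (-|a|) ≤ 1 := Real.exp_le_one_iff.2 (by simp)
      have h7 : Real.exp (-|a|) * (ε * V y) ≤ 1 * (ε * V y) :=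
        mul_le_mul_of_nonneg_right h6 (mul_nonneg hε (S.V_pos y).le)
      calc c0 * g y = Real.exp (-|a|) * (κ * g y) := by rw [hc0]; ring
        _ ≤ Real.exp (-|a|) * (Real.exp |a| * ∫ z, g z ∂(P y) + ε * V y) := h5
        _ = (Real.exp (-|a|) * Real.exp |a|) * ∫ z, g z ∂(P y) +
              Real.exp (-|a|) * (ε * V y) := by ring
        _ ≤ _ := by rw [h4]; linarith
    have h2 := S.exp_mul_res hg x
    have hRg0 : 0 ≤ ∫ y, g y ∂(resKernel P x) := integral_nonneg h0
    have h3 : (Real.exp 1 - 1) * g x ≤ k * ∫ y, g y ∂(resKernel P x) + ε * (CR * V x) := by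
      have h4 : (Real.exp 1 - c0) * ∫ y, g y ∂(resKernel P x) ≤
        k * ∫ y, g y ∂(resKernel P x) := mul_le_mul_of_nonneg_right (le_max_left _ _) hRg0
      have h5 := mul_le_mul_of_nonneg_left (hCR x) hε
      linarith
    -- Minorization applied to `M W - g ≥ 0` gives `R g - s ν(g) ≤ M (R W - s ν(W))`, where the
    -- drift of `W` is available.
    have h4 := S.s_mul_nu_le_res (hMW.sub hg) (fun y => sub_nonneg.2 (hMle y)) x
    rw [integral_sub (hMW.integrable S.integrable_nu) (hg.integrable S.integrable_nu),
      integral_sub (hMW.integrable (S.integrable_res x)) hiR, integral_const_mul,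
      integral_const_mul] at h4
    have hM0 : 0 ≤ M := (div_nonneg (h0 x) hWx.le).trans (le_ciSup hbdd x)
    have h5 := mul_le_mul_of_nonneg_left (S.res_W_sub_le x) hM0
    have h6 : ∫ y, g y ∂(resKernel P x) ≤ M * ((Real.exp 1 - 1) /
        (Real.exp 1 - 1 + etaRate δ b) * Wfun V s δ b x) + V x * ∫ y, g y ∂ν := by
      have h7 : s x * ∫ y, g y ∂ν ≤ V x * ∫ y, g y ∂ν :=
        mul_le_mul_of_nonneg_right ((S.v4.s_le_one x).trans (S.one_le_V x)) hν0
      linarith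
    have h7 : V x ≤ Wfun V s δ b x / c := by rw [le_div_iff₀ hc, mul_comm]; exact hcW x
    have h8 : k * ∫ y, g y ∂(resKernel P x) ≤ k * (M * ((Real.exp 1 - 1) /
        (Real.exp 1 - 1 + etaRate δ b) * Wfun V s δ b x) +
        Wfun V s δ b x / c * ∫ y, g y ∂ν) := by
      refine mul_le_mul_of_nonneg_left (h6.trans ?_) hk0
      gcongr
    have h9 : ε * (CR * V x) ≤ ε * (CR * (Wfun V s δ b x / c)) := by gcongr
    have h10 : 0 ≤ Wfun V s δ b x * (k * ε + CR * ∫ y, g y ∂ν) := by positivity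
    rw [div_le_iff₀ hWx, ← mul_le_mul_iff_right₀ he]
    refine h3.trans ((add_le_add h8 h9).trans ?_)
    have h11 : (Real.exp 1 - 1) * ((θ * M + A * (∫ y, g y ∂ν + ε)) * Wfun V s δ b x) =
        k * (M * ((Real.exp 1 - 1) / (Real.exp 1 - 1 + etaRate δ b) * Wfun V s δ b x)) +
        (k + CR) / c * (∫ y, g y ∂ν + ε) * Wfun V s δ b x := by
      rw [hθ, hA]; field_simp
    rw [h11]
    have h12 : (k + CR) / c * (∫ y, g y ∂ν + ε) * Wfun V s δ b x =
       k * (Wfun V s δ b x / c * ∫ y, g y ∂ν) + ε * (CR * (Wfun V s δ b x / c)) +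
        Wfun V s δ b x * (k * ε + CR * ∫ y, g y ∂ν) / c := by
      field_simp; ring
    have h13 := div_nonneg h10 hc.le
    rw [h12]; linarith
  have hne := S.nonempty
  have hMle2 : M ≤ θ * M + A * (∫ y, g y ∂ν + ε) := ciSup_le key
  have hM3 : M ≤ A / (1 - θ) * (∫ y, g y ∂ν + ε) := by
    rw [div_mul_eq_mul_div, le_div_iff₀ (sub_pos.2 hθ1)]
    linarith
  intro x
  have hWD : Wfun V s δ b x ≤ D * V x := (le_abs_self _).trans (hD x)
  calc g x ≤ M * Wfun V s δ b x := hMle x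
    _ ≤ (A / (1 - θ) * (∫ y, g y ∂ν + ε)) * (D * V x) := by
        refine mul_le_mul hM3 hWD (S.W_pos x).le ?_
        have := sub_pos.2 hθ1
        positivity
    _ = _ := by ring

/-! ### Absorbing sets -/

lemma IsAbsorbing.pow_compl {Y : Set X} (hY : IsAbsorbing P Y) (n : ℕ) {x : X} (hx : x ∈ Y) :
    (P ^ n) x Yᶜ = 0 := by
  induction n generalizing x with
  | zero =>
    change Kernel.id x Yᶜ = 0
    rw [Kernel.id_apply, Measure.dirac_apply' _ hY.1.compl]
    simpa using hx
  | succ n ih =>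
    rw [Kernel.pow_add, pow_one, Kernel.comp_apply' _ _ _ hY.1.compl,
      lintegral_eq_zero_iff ((P ^ n).measurable_coe hY.1.compl)]
    have h : ∀ᵐ y ∂(P x), y ∈ Y := hY.2 x hx
    filter_upwards [h] with y hy using ih hy

lemma IsAbsorbing.res_compl {Y : Set X} (hY : IsAbsorbing P Y) {x : X} (hx : x ∈ Y) :
    resKernel P x Yᶜ = 0 := by
  rw [resKernel_apply' P x hY.1.compl]
  simp [IsAbsorbing.pow_compl S hY _ hx]

/-- From a point `x` of `Y` the resolvent never charges `Yᶜ`, and it dominates `s(x) ν` with `s(x) >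
0`. This turns one point of an absorbing set into a `ν`-almost sure statement, and is used mostly
for zero sets. -/
lemma IsAbsorbing.nu_compl {Y : Set X} (hY : IsAbsorbing P Y) (hne : Y.Nonempty) :
    ν Yᶜ = 0 := by
  obtain ⟨x, hx⟩ := hne
  have h := S.smul_nu_le_res x Yᶜ
  rw [IsAbsorbing.res_compl S hY hx, Measure.smul_apply, smul_eq_mul, nonpos_iff_eq_zero,
    mul_eq_zero, ENNReal.ofReal_eq_zero] at h
  exact h.resolve_left (not_le.2 (S.v4.s_pos x))

/-- On the complement of an absorbing set of full `ν`-measure, `Pⁿ V` decays geometrically. -/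
lemma pow_V_compl_le : ∃ C : ℝ, 0 ≤ C ∧ ∀ Y : Set X, IsAbsorbing P Y → ν Yᶜ = 0 → ∀ n x,
    ∫ y in Yᶜ, V y ∂((P ^ n) x) ≤ C * qrate δ b ^ n * V x := by
  have he := exp_one_sub_one_pos
  have hη := S.etaRate_pos
  obtain ⟨c, hc, hcW⟩ := S.exists_V_le_W
  obtain ⟨D, hD0, hD⟩ := S.vbdd_W.exists_nonneg S.one_le_V
  have hE : 0 < Real.exp 1 := Real.exp_pos 1
  refine ⟨Real.exp 1 / ((Real.exp 1 - 1) * c) * D, by positivity, fun Y hY hν n x => ?_⟩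
  set g : X → ℝ := Yᶜ.indicator (Wfun V s δ b) with hgdef
  have hg : VBdd V g := S.vbdd_W.indicator hY.1.compl S.one_le_V
  have hg0 : ∀ x, 0 ≤ g x := fun x => indicator_nonneg (fun y _ => (S.W_pos y).le) x
  -- As `ν` does not charge `Yᶜ`, the whole of `s ν(W)` is dominated by the part of `R W` on `Y`, so
  -- `H ≤ R W - s ν(W) ≤ (e-1)/(e-1+η) W`. Off `Y` this turns `P H = e H - (e-1) W` into `P H ≤
  -- (1-η) H`; on `Y` both sides vanish. Finally `H` dominates a multiple of `V` off `Y`.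
  set H : X → ℝ := fun x => ∫ y, g y ∂(resKernel P x) with hH
  have hHV : VBdd V H := S.vbdd_res hg
  have hHnn : ∀ x, 0 ≤ H x := fun x => integral_nonneg hg0
  have hH0 : ∀ x ∈ Y, H x = 0 := by
    intro x hx
    refine integral_eq_zero_of_ae ?_
    have : ∀ᵐ y ∂(resKernel P x), y ∈ Y := IsAbsorbing.res_compl S hY hx
    filter_upwards [this] with y hy
    simp [hgdef, hy]
  have hHle : ∀ x, H x ≤ (Real.exp 1 - 1) / (Real.exp 1 - 1 + etaRate δ b) * Wfun V s δ b x := by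
    intro x
    have hg' : VBdd V (Y.indicator (Wfun V s δ b)) := S.vbdd_W.indicator hY.1 S.one_le_V
    have h1 := S.s_mul_nu_le_res hg' (fun x => indicator_nonneg (fun y _ => (S.W_pos y).le) x) x
    have h2 : ∫ y, Y.indicator (Wfun V s δ b) y ∂ν = ∫ y, Wfun V s δ b y ∂ν := by
      refine integral_congr_ae ?_
      have : ∀ᵐ y ∂ν, y ∈ Y := hν
      filter_upwards [this] with y hy
      simp [hy]
    have h3 : H x + ∫ y, Y.indicator (Wfun V s δ b) y ∂(resKernel P x) =
        ∫ y, Wfun V s δ b y ∂(resKernel P x) := by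
      rw [hH]
      dsimp only
      rw [← integral_add (hg.integrable (S.integrable_res x)) (hg'.integrable (S.integrable_res x))]
      refine integral_congr_ae (ae_of_all _ fun y => ?_)
      exact indicator_compl_add_self_apply Y _ y
    have h4 := S.res_W_sub_le x
    rw [h2] at h1
    linarith
  have hPH : ∀ x, ∫ y, H y ∂(P x) ≤ qrate δ b * H x := by
    intro x
    have h1 := S.exp_mul_res' hg x
    by_cases hx : x ∈ Y
    · have h2 : g x = 0 := by simp [hgdef, hx]
      have h3 : ∫ y, g y ∂(resKernel P x) = 0 := hH0 x hx
      have h4 : ∫ y, H y ∂(P x) = 0 := by rw [h2, h3] at h1; linarith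
      rw [h4, hH0 x hx, mul_zero]
    · have h2 : g x = Wfun V s δ b x := by simp [hgdef, hx]
      have h3 := hHle x
      rw [div_mul_eq_mul_div, le_div_iff₀ (by linarith)] at h3
      rw [h2] at h1
      have h4 : ∫ y, H y ∂(P x) ≤ (1 - etaRate δ b) * H x := by
        change _ ≤ (1 - etaRate δ b) * ∫ y, g y ∂(resKernel P x)
        change (∫ y, g y ∂(resKernel P x)) * _ ≤ _ at h3
        change _ = _ + ∫ y, H y ∂(P x) at h1
        linarith
      exact h4.trans (mul_le_mul_of_nonneg_right one_sub_etaRate_le (hHnn x))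
  have hPn : ∀ n x, ∫ y, H y ∂((P ^ n) x) ≤ qrate δ b ^ n * H x := by
    intro n
    induction n with
    | zero => intro x; rw [integral_pow_zero hHV.1]; simp
    | succ n ih =>
      intro x
      rw [S.integral_pow_succ n hHV]
      calc ∫ y, ∫ z, H z ∂(P y) ∂((P ^ n) x) ≤ ∫ y, qrate δ b * H y ∂((P ^ n) x) :=
            integral_mono ((S.vbdd_P hHV).integrable (S.integrable_pow n x))
              ((hHV.const_mul _).integrable (S.integrable_pow n x)) hPH
        _ = qrate δ b * ∫ y, H y ∂((P ^ n) x) := integral_const_mul _ _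
        _ ≤ qrate δ b * (qrate δ b ^ n * H x) := mul_le_mul_of_nonneg_left (ih x) qrate_nonneg
        _ = _ := by ring
  have hVH : ∀ x, Yᶜ.indicator V x ≤ Real.exp 1 / ((Real.exp 1 - 1) * c) * H x := by
    intro x
    have h1 := S.exp_mul_res' hg x
    have h2 : 0 ≤ ∫ y, H y ∂(P x) := integral_nonneg hHnn
    have h3 : (Real.exp 1 - 1) * g x ≤ Real.exp 1 * H x := by
      change _ = _ + ∫ y, H y ∂(P x) at h1
      change _ ≤ Real.exp 1 * ∫ y, g y ∂(resKernel P x)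
      linarith
    have h4 : c * Yᶜ.indicator V x ≤ g x := by
      by_cases hx : x ∈ Y
      · simp [hgdef, hx]
      · simpa [hgdef, hx] using hcW x
    rw [div_mul_eq_mul_div, le_div_iff₀ (by positivity)]
    calc Yᶜ.indicator V x * ((Real.exp 1 - 1) * c)
        = (Real.exp 1 - 1) * (c * Yᶜ.indicator V x) := by ring
      _ ≤ (Real.exp 1 - 1) * g x := mul_le_mul_of_nonneg_left h4 he.le
      _ ≤ _ := h3
  rw [← integral_indicator hY.1.compl]
  calc ∫ y, Yᶜ.indicator V y ∂((P ^ n) x)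
      ≤ ∫ y, Real.exp 1 / ((Real.exp 1 - 1) * c) * H y ∂((P ^ n) x) :=
        integral_mono ((S.vbdd_V.indicator hY.1.compl S.one_le_V).integrable (S.integrable_pow n x))
          ((hHV.const_mul _).integrable (S.integrable_pow n x)) hVH
    _ = Real.exp 1 / ((Real.exp 1 - 1) * c) * ∫ y, H y ∂((P ^ n) x) := integral_const_mul _ _
    _ ≤ Real.exp 1 / ((Real.exp 1 - 1) * c) * (qrate δ b ^ n * (D * V x)) := by
        have h1 : H x ≤ D * V x := by
          refine (hHle x).trans ?_
          have hle : (Real.exp 1 - 1) / (Real.exp 1 - 1 + etaRate δ b) ≤ 1 := by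
            rw [div_le_one (by linarith)]; linarith
          calc _ ≤ 1 * Wfun V s δ b x := mul_le_mul_of_nonneg_right hle (S.W_pos x).le
            _ ≤ D * V x := by rw [one_mul]; exact (le_abs_self _).trans (hD x)
        have h2 := pow_nonneg (qrate_nonneg (δ := δ) (b := b)) n
        exact mul_le_mul_of_nonneg_left ((hPn n x).trans (mul_le_mul_of_nonneg_left h1 h2))
          (by positivity)
    _ = _ := by ring

end Setup

end MultErgodic

namespace MultErgodic

variable {X : Type*} [MeasurableSpace X]

/-! ### The Banach space `L_∞^V` -/

/-- The space `L_∞^V` as a submodule of the space of all functions. -/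
def submoduleLV (V : X → ℝ) : Submodule ℂ (X → ℂ) where
  carrier := {g | VBdd V g}
  add_mem' hf hg := VBdd.add hf hg
  zero_mem' := ⟨measurable_const, 0, fun x => by simp⟩
  smul_mem' c g hg := by
    have h := VBdd.const_mul (𝕜 := ℂ) hg c
    exact h

/-- The space `L_∞^V` with the weighted supremum norm. -/
def LV (V : X → ℝ) (_ : ∀ x, 1 ≤ V x) : Type _ := submoduleLV V

section LV

variable {V : X → ℝ} {hV : ∀ x, 1 ≤ V x}

instance : AddCommGroup (LV V hV) := inferInstanceAs (AddCommGroup (submoduleLV V))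

instance : Module ℂ (LV V hV) := inferInstanceAs (Module ℂ (submoduleLV V))

instance : CoeFun (LV V hV) fun _ => X → ℂ := ⟨Subtype.val⟩

lemma LV.vbdd (g : LV V hV) : VBdd V g := g.2

/-- The element of `L_∞^V` given by a dominated function. -/
def LV.mk (hV : ∀ x, 1 ≤ V x) (g : X → ℂ) (hg : VBdd V g) : LV V hV := ⟨g, hg⟩

@[simp] lemma LV.mk_apply (g : X → ℂ) (hg : VBdd V g) (x : X) : LV.mk hV g hg x = g x := rfl

@[simp] lemma LV.add_apply (g h : LV V hV) (x : X) : (g + h) x = g x + h x := rfl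

@[simp] lemma LV.sub_apply (g h : LV V hV) (x : X) : (g - h) x = g x - h x := rfl

@[simp] lemma LV.smul_apply (c : ℂ) (g : LV V hV) (x : X) : (c • g) x = c * g x := rfl

@[simp] lemma LV.zero_apply (x : X) : (0 : LV V hV) x = 0 := rfl

lemma LV.ext {g h : LV V hV} (H : ∀ x, g x = h x) : g = h := Subtype.ext (funext H)

/-- Division by the weight embeds `L_∞^V` into the bounded functions. -/
def LV.toLp : LV V hV →ₗ[ℂ] lp (fun _ : X => ℂ) ∞ where
  toFun g := ⟨fun x => g x / V x, memℓp_infty <| by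
    obtain ⟨-, C, hC⟩ := g.vbdd
    refine ⟨C, ?_⟩
    rintro _ ⟨x, rfl⟩
    have hx : 0 < V x := zero_lt_one.trans_le (hV x)
    dsimp only
    rw [norm_div, Complex.norm_real, Real.norm_of_nonneg hx.le, div_le_iff₀ hx]
    exact hC x⟩
  map_add' g h := by
    ext x
    exact add_div _ _ _
  map_smul' c g := by
    ext x
    exact mul_div_assoc _ _ _

lemma LV.toLp_apply (g : LV V hV) (x : X) : (LV.toLp g : ∀ _ : X, ℂ) x = g x / V x := rfl

lemma LV.toLp_injective : Function.Injective (LV.toLp (V := V) (hV := hV)) := by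
  intro g h H
  refine LV.ext fun x => ?_
  have hx : (V x : ℂ) ≠ 0 := by exact_mod_cast (zero_lt_one.trans_le (hV x)).ne'
  have h1 : (LV.toLp g : ∀ _ : X, ℂ) x = (LV.toLp h : ∀ _ : X, ℂ) x := by rw [H]
  rw [LV.toLp_apply, LV.toLp_apply] at h1
  field_simp at h1
  exact h1

instance : NormedAddCommGroup (LV V hV) :=
  NormedAddCommGroup.induced _ _ LV.toLp LV.toLp_injective

instance : NormedSpace ℂ (LV V hV) := NormedSpace.induced ℂ _ _ (LV.toLp (V := V) (hV := hV))

lemma LV.norm_toLp (g : LV V hV) : ‖LV.toLp g‖ = ‖g‖ := rfl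

lemma LV.norm_eq (g : LV V hV) : ‖g‖ = normV V g := by
  rw [← LV.norm_toLp, lp.norm_eq_ciSup]
  unfold normV
  congr 1
  ext x
  have hx : 0 < V x := zero_lt_one.trans_le (hV x)
  rw [LV.toLp_apply, norm_div, Complex.norm_real, Real.norm_of_nonneg hx.le]

lemma LV.norm_apply_le (g : LV V hV) (x : X) : ‖g x‖ ≤ ‖g‖ * V x := by
  have hx : 0 < V x := zero_lt_one.trans_le (hV x)
  have h := lp.norm_apply_le_norm (by simp) (LV.toLp g) x
  rwa [LV.toLp_apply, norm_div, Complex.norm_real, Real.norm_of_nonneg hx.le, LV.norm_toLp,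
    div_le_iff₀ hx] at h

lemma LV.norm_le {g : LV V hV} {C : ℝ} (hC : 0 ≤ C) (h : ∀ x, ‖g x‖ ≤ C * V x) : ‖g‖ ≤ C := by
  rw [← LV.norm_toLp]
  refine lp.norm_le_of_forall_le hC fun x => ?_
  have hx : 0 < V x := zero_lt_one.trans_le (hV x)
  rw [LV.toLp_apply, norm_div, Complex.norm_real, Real.norm_of_nonneg hx.le, div_le_iff₀ hx]
  exact h x

lemma LV.isometry_toLp : Isometry (LV.toLp (V := V) (hV := hV)) :=
  AddMonoidHomClass.isometry_of_norm _ fun _ => rfl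

/-- Evaluation at a point as a continuous linear functional. -/
def LV.eval (x : X) : LV V hV →L[ℂ] ℂ :=
  LinearMap.mkContinuous
    { toFun := fun g => g x
      map_add' := fun _ _ => rfl
      map_smul' := fun _ _ => rfl } (V x)
    (fun g => by rw [mul_comm]; exact g.norm_apply_le x)

@[simp] lemma LV.eval_apply (x : X) (g : LV V hV) : LV.eval x g = g x := rfl

/-- Uniform limits are pointwise limits and hence measurable, so the image of `L_∞^V` in the Banach
space of bounded functions is closed. -/
lemma LV.complete (hVm : Measurable V) : CompleteSpace (LV V hV) := by
  rw [completeSpace_iff_isComplete_range (LV.isometry_toLp).isUniformInducing]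
  refine IsClosed.isComplete ?_
  have hr : range (LV.toLp (V := V) (hV := hV)) =
      {u : lp (fun _ : X => ℂ) ∞ | Measurable fun x => (u : ∀ _ : X, ℂ) x} := by
    ext u
    constructor
    · rintro ⟨g, rfl⟩
      exact g.vbdd.1.div (Complex.measurable_ofReal.comp hVm)
    · intro hu
      refine ⟨⟨fun x => u x * V x, ⟨hu.mul (Complex.measurable_ofReal.comp hVm), ‖u‖, fun x => ?_⟩⟩,
        ?_⟩
      · have hx : 0 < V x := zero_lt_one.trans_le (hV x)
        rw [norm_mul, Complex.norm_real, Real.norm_of_nonneg hx.le]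
        exact mul_le_mul_of_nonneg_right (lp.norm_apply_le_norm (by simp) u x) hx.le
      · ext x
        have hx : (V x : ℂ) ≠ 0 := by exact_mod_cast (zero_lt_one.trans_le (hV x)).ne'
        exact mul_div_cancel_right₀ _ hx
  rw [hr, ← isSeqClosed_iff_isClosed]
  intro u v hu huv
  refine measurable_of_tendsto_metrizable hu (tendsto_pi_nhds.2 fun x => ?_)
  rw [tendsto_iff_norm_sub_tendsto_zero] at huv ⊢
  refine squeeze_zero (fun _ => norm_nonneg _) (fun n => ?_) huv
  exact lp.norm_apply_le_norm (by simp) (u n - v) x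

lemma memLV_iff (hV : ∀ x, 1 ≤ V x) {g : X → ℂ} : MemLV V g ↔ VBdd V g := by
  refine and_congr_right fun _ => ⟨fun ⟨C, hC⟩ => ⟨C, fun x => ?_⟩, fun ⟨C, hC⟩ => ⟨C, ?_⟩⟩
  · have hx : 0 < V x := zero_lt_one.trans_le (hV x)
    exact (div_le_iff₀ hx).1 (hC ⟨x, rfl⟩)
  · rintro _ ⟨x, rfl⟩
    have hx : 0 < V x := zero_lt_one.trans_le (hV x)
    exact (div_le_iff₀ hx).2 (hC x)

end LV

lemma VBdd.ofReal {V : X → ℝ} {g : X → ℝ} (hg : VBdd V g) : VBdd V (fun x => (g x : ℂ)) :=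
  ⟨Complex.measurable_ofReal.comp hg.1, by simpa using hg.2⟩

lemma VBdd.re {V : X → ℝ} {g : X → ℂ} (hg : VBdd V g) : VBdd V (fun x => (g x).re) := by
  obtain ⟨hm, C, hC⟩ := hg
  exact ⟨Complex.measurable_re.comp hm, C, fun x => (Complex.abs_re_le_norm _).trans (hC x)⟩

lemma norm_exp_mul_ofReal (α : ℂ) (t : ℝ) : ‖Complex.exp (α * t)‖ = Real.exp (α.re * t) := by
  rw [Complex.norm_exp]; simp

lemma norm_exp_le {α : ℂ} {t : ℝ} (ht : t ∈ Icc (-1 : ℝ) 1) :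
    ‖Complex.exp (α * t)‖ ≤ Real.exp |α.re| := by
  rw [norm_exp_mul_ofReal]; exact exp_mul_le_exp_abs ht

/-! ### The operators `P̂_α` on `L_∞^V`. -/

namespace Setup

variable {P : Kernel X X} [IsMarkovKernel P] {V F : X → ℝ} {π : Measure X} {δ b : ℝ}
    {s : X → ℝ} {ν : Measure X} (S : Setup P V F π δ b s ν)

/-- The space `L_∞^V` of the chain. -/
abbrev E (S : Setup P V F π δ b s ν) : Type _ := LV V S.one_le_V

instance : CompleteSpace S.E := LV.complete S.V_meas

include S

lemma measurable_exp (α : ℂ) : Measurable fun x => Complex.exp (α * F x) :=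
  Complex.measurable_exp.comp ((Complex.measurable_ofReal.comp S.F_meas).const_mul α)

lemma vbdd_tilted (α : ℂ) {g : X → ℂ} (hg : VBdd V g) : VBdd V (tilted P F α g) :=
  (S.vbdd_P hg).mul_bdd S.one_le_V (S.measurable_exp α) fun x => norm_exp_le (S.F_mem x)

/-- The operator `P̂_α` on `L_∞^V`. -/
def op (α : ℂ) : S.E →L[ℂ] S.E :=
  LinearMap.mkContinuous
    { toFun := fun g => LV.mk S.one_le_V (tilted P F α g) (S.vbdd_tilted α g.vbdd)
      map_add' := fun g h => LV.ext fun x => by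
        simp only [LV.mk_apply, LV.add_apply, tilted]
        rw [integral_add (g.vbdd.integrable (S.v4.integrable x))
          (h.vbdd.integrable (S.v4.integrable x)), mul_add]
      map_smul' := fun c g => LV.ext fun x => by
        simp only [LV.mk_apply, LV.smul_apply, tilted, RingHom.id_apply]
        rw [integral_const_mul]
        ring } (Real.exp |α.re| * (1 + b))
    (fun g => by
      have hb := S.b_pos
      refine LV.norm_le (by positivity) fun x => ?_
      change ‖tilted P F α g x‖ ≤ _
      unfold tilted
      rw [norm_mul, mul_assoc, mul_assoc]
      refine mul_le_mul (norm_exp_le (S.F_mem x)) ?_ (norm_nonneg _) (Real.exp_pos _).le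
      calc ‖∫ y, g y ∂(P x)‖ ≤ ∫ y, ‖g‖ * V y ∂(P x) :=
            norm_integral_le_of_norm_le ((S.v4.integrable x).const_mul _)
              (ae_of_all _ fun y => g.norm_apply_le y)
        _ = ‖g‖ * ∫ y, V y ∂(P x) := integral_const_mul _ _
        _ ≤ ‖g‖ * ((1 + b) * V x) := by
            refine mul_le_mul_of_nonneg_left ((S.PV_le x).trans ?_) (norm_nonneg _)
            nlinarith [S.one_le_V x]
        _ = _ := by ring)

lemma op_apply (α : ℂ) (g : S.E) (x : X) :
    S.op α g x = Complex.exp (α * F x) * ∫ y, g y ∂(P x) := rfl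

lemma vbdd_real (a : ℝ) {g : X → ℝ} (hg : VBdd V g) :
    VBdd V (fun x => Real.exp (a * F x) * ∫ y, g y ∂(P x)) := by
  refine (S.vbdd_P hg).mul_bdd S.one_le_V ?_ (K := Real.exp |a|) fun x => ?_
  · exact Real.measurable_exp.comp (S.F_meas.const_mul a)
  · rw [Real.norm_of_nonneg (Real.exp_pos _).le]; exact exp_mul_le_exp_abs (S.F_mem x)

/-- A real dominated function as an element of `L_∞^V`. -/
def real (g : X → ℝ) (hg : VBdd V g) : S.E := LV.mk S.one_le_V (fun x => (g x : ℂ)) hg.ofReal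

@[simp] lemma real_apply (g : X → ℝ) (hg : VBdd V g) (x : X) : S.real g hg x = (g x : ℂ) := rfl

lemma op_real_apply (a : ℝ) {g : X → ℝ} (hg : VBdd V g) (x : X) :
    S.op a (S.real g hg) x = ((Real.exp (a * F x) * ∫ y, g y ∂(P x) : ℝ) : ℂ) := by
  rw [op_apply]
  simp only [real_apply]
  rw [integral_complex_ofReal]
  push_cast
  rfl

lemma op_real (a : ℝ) {g : X → ℝ} (hg : VBdd V g) :
    S.op a (S.real g hg) =
      S.real (fun x => Real.exp (a * F x) * ∫ y, g y ∂(P x)) (S.vbdd_real a hg) :=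
  LV.ext fun x => S.op_real_apply a hg x

/-- `|P̂_α g| ≤ P̂_{Re α} |g|`. -/
lemma norm_op_apply_le (α : ℂ) (g : S.E) (x : X) :
    ‖S.op α g x‖ ≤ Real.exp (α.re * F x) * ∫ y, ‖g y‖ ∂(P x) := by
  rw [op_apply, norm_mul, norm_exp_mul_ofReal]
  exact mul_le_mul_of_nonneg_left (norm_integral_le_integral_norm _) (Real.exp_pos _).le

end Setup

end MultErgodic

namespace MultErgodic

variable {X : Type*} [MeasurableSpace X]

/-! ### The path law -/

instance (P : Kernel X X) [IsMarkovKernel P] (x : X) : IsProbabilityMeasure (pathLaw P x) := by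
  unfold pathLaw; infer_instance

/-- The Markov property: joint law of the history up to time `n` and of `Φ(n+1)`. -/
lemma pathLaw_map_succ (P : Kernel X X) [IsMarkovKernel P] (x : X) (n : ℕ) :
    (pathLaw P x).map (fun φ => (Preorder.frestrictLe (π := fun _ : ℕ => X) n φ, φ (n + 1))) =
      ((pathLaw P x).map (Preorder.frestrictLe (π := fun _ : ℕ => X) n)) ⊗ₘ (stepKernel P n) := by
  unfold pathLaw
  rw [← Kernel.partialTraj_compProd_eq_map_traj (Nat.zero_le n), Kernel.traj_map_frestrictLe_apply]

lemma pathLaw_map_zero (P : Kernel X X) [IsMarkovKernel P] (x : X) :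
    (pathLaw P x).map (fun φ => φ 0) = Measure.dirac x := by
  have h : (pathLaw P x).map (Preorder.frestrictLe (π := fun _ : ℕ => X) 0) =
      Measure.dirac (fun _ => x) := by
    unfold pathLaw
    rw [Kernel.traj_map_frestrictLe_apply, Kernel.partialTraj_self, Kernel.id_apply]
  have h2 := congrArg (fun m => m.map (fun y : (i : Finset.Iic 0) → X =>
    y ⟨0, Finset.mem_Iic.2 le_rfl⟩)) h
  rw [Measure.map_map (by fun_prop) (by fun_prop), Measure.map_dirac' (by fun_prop)] at h2
  exact h2

lemma pathLaw_zero_ae (P : Kernel X X) [IsMarkovKernel P] (x : X) {β : Type*} [MeasurableSpace β]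
    [MeasurableSingletonClass β] {u : X → β} (hu : Measurable u) :
    ∀ᵐ φ ∂(pathLaw P x), u (φ 0) = u x := by
  have hm : MeasurableSet {y | u y = u x} := hu (measurableSet_singleton (u x))
  have h : ∀ᵐ y ∂((pathLaw P x).map (fun φ => φ 0)), u y = u x := by
    rw [pathLaw_map_zero, ae_dirac_iff hm]
  exact ae_of_ae_map (measurable_pi_apply 0).aemeasurable h

/-- The law of `Φ(n)` under `P_x` is `Pⁿ(x, ·)`. -/
lemma pathLaw_map_eval (P : Kernel X X) [IsMarkovKernel P] (x : X) (n : ℕ) :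
    (pathLaw P x).map (fun φ => φ n) = (P ^ n) x := by
  induction n with
  | zero => rw [pathLaw_map_zero]; exact (Kernel.id_apply x).symm
  | succ n ih =>
    have h := congrArg (fun m => m.map Prod.snd) (pathLaw_map_succ P x n)
    rw [Measure.map_map measurable_snd (by fun_prop)] at h
    change (pathLaw P x).map (fun φ => φ (n + 1)) = _ at h
    rw [h]
    ext A hA
    rw [Measure.map_apply measurable_snd hA, Measure.compProd_apply (measurable_snd hA),
      lintegral_map (Kernel.measurable_kernel_prodMk_left (measurable_snd hA)) (by fun_prop),
      Kernel.pow_succ_apply_eq_lintegral _ _ _ hA, ← ih,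
      lintegral_map (P.measurable_coe hA) (by fun_prop)]
    rfl

/-- The law of `(Φ(n), Φ(n+1))` given the history, for almost sure statements. -/
lemma pathLaw_ae_succ (P : Kernel X X) [IsMarkovKernel P] (x : X) (n : ℕ) {A : Set (X × X)}
    (hA : MeasurableSet A) (h : ∀ y, ∀ᵐ z ∂(P y), (y, z) ∈ A) :
    ∀ᵐ φ ∂(pathLaw P x), (φ n, φ (n + 1)) ∈ A := by
  have h1 := pathLaw_map_succ P x n
  have hB : MeasurableSet {p : ((i : Finset.Iic n) → X) × X |
      (p.1 ⟨n, Finset.mem_Iic.2 le_rfl⟩, p.2) ∈ A} :=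
    measurableSet_preimage (by fun_prop) hA
  have h2 : ∀ᵐ p ∂((pathLaw P x).map
      (fun φ => (Preorder.frestrictLe (π := fun _ : ℕ => X) n φ, φ (n + 1)))),
      (p.1 ⟨n, Finset.mem_Iic.2 le_rfl⟩, p.2) ∈ A := by
    rw [h1, Measure.ae_compProd_iff hB]
    exact ae_of_all _ fun y => h _
  exact ae_of_ae_map (f := fun φ : ℕ → X => (Preorder.frestrictLe (π := fun _ : ℕ => X) n φ,
    φ (n + 1))) (by fun_prop) h2

section

variable {P : Kernel X X} [IsMarkovKernel P] {V : X → ℝ}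

lemma measurable_partialSum {F : X → ℝ} (hF : Measurable F) (n : ℕ) :
    Measurable (partialSum F n) := by
  unfold partialSum
  exact Finset.measurable_sum _ fun i _ => hF.comp (measurable_pi_apply i)

lemma partialSum_succ (F : X → ℝ) (n : ℕ) (φ : ℕ → X) :
    partialSum F (n + 1) φ = partialSum F n φ + F (φ n) := by
  unfold partialSum
  rw [Finset.sum_range_succ]

lemma abs_partialSum_le {F : X → ℝ} (hF : ∀ x, F x ∈ Icc (-1 : ℝ) 1) (n : ℕ) (φ : ℕ → X) :
    |partialSum F n φ| ≤ n := by
  unfold partialSum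
  refine (Finset.abs_sum_le_sum_abs _ _).trans ?_
  refine (Finset.sum_le_sum fun i _ => abs_le.2 (hF (φ i))).trans ?_
  simp

end

namespace Setup

variable {P : Kernel X X} [IsMarkovKernel P] {V F : X → ℝ} {π : Measure X} {δ b : ℝ}
    {s : X → ℝ} {ν : Measure X} (S : Setup P V F π δ b s ν)

include S

lemma integral_pathLaw_eval {G : Type*} [NormedAddCommGroup G] [NormedSpace ℝ G]
    {g : X → G} (hg : StronglyMeasurable g) (x : X) (n : ℕ) :
    ∫ φ, g (φ n) ∂(pathLaw P x) = ∫ y, g y ∂((P ^ n) x) := by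
  rw [← pathLaw_map_eval, integral_map (measurable_pi_apply n).aemeasurable hg.aestronglyMeasurable]

lemma integrable_V_path (x : X) (n : ℕ) : Integrable (fun φ => V (φ n)) (pathLaw P x) := by
  have h := S.integrable_pow n x
  rw [← pathLaw_map_eval] at h
  exact (integrable_map_measure S.V_meas.aestronglyMeasurable (measurable_pi_apply n).aemeasurable).1 h

lemma norm_exp_partialSum_le (α : ℂ) (n : ℕ) (φ : ℕ → X) :
    ‖Complex.exp (α * partialSum F n φ)‖ ≤ Real.exp (|α.re| * n) := by
  rw [norm_exp_mul_ofReal]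
  refine Real.exp_le_exp.2 ((le_abs_self _).trans ?_)
  rw [abs_mul]
  exact mul_le_mul_of_nonneg_left (abs_partialSum_le S.F_mem n φ) (abs_nonneg _)

lemma integrable_path (α : ℂ) (n m : ℕ) {g : X → ℂ} (hg : VBdd V g) (x : X) :
    Integrable (fun φ => Complex.exp (α * partialSum F n φ) * g (φ m)) (pathLaw P x) := by
  obtain ⟨C, hC0, hC⟩ := hg.exists_nonneg S.one_le_V
  refine ((S.integrable_V_path x m).const_mul (Real.exp (|α.re| * n) * C)).mono' ?_
    (ae_of_all _ fun φ => ?_)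
  · have h1 := measurable_partialSum S.F_meas n
    have h2 := hg.1
    exact Measurable.aestronglyMeasurable (by fun_prop)
  · rw [norm_mul, mul_assoc]
    exact mul_le_mul (S.norm_exp_partialSum_le α n φ) (hC _) (norm_nonneg _) (Real.exp_pos _).le

/-- One step of the Markov property in integrated form. -/
lemma integral_path_succ (α : ℂ) (n : ℕ) {g : X → ℂ} (hg : VBdd V g) (x : X) :
    ∫ φ, Complex.exp (α * partialSum F (n + 1) φ) * g (φ (n + 1)) ∂(pathLaw P x) =
      ∫ φ, Complex.exp (α * partialSum F n φ) * tilted P F α g (φ n) ∂(pathLaw P x) := by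
  -- `S_{n+1}` involves only the times `0, …, n`, so its exponential is a function of the history
  -- and comes out of the integral over `Φ(n+1)`.
  set T : ((i : Finset.Iic n) → X) → ℂ := fun y => Complex.exp (α * ((∑ i ∈ (Finset.range (n + 1)).attach,
    F (y ⟨i.1, Finset.mem_Iic.2 (Nat.lt_succ_iff.1 (Finset.mem_range.1 i.2))⟩) : ℝ) : ℂ)) with hT
  have hFm := S.F_meas
  have hgm := hg.1
  have hTm : Measurable T := by rw [hT]; fun_prop
  have hT2 : ∀ φ : ℕ → X, T (Preorder.frestrictLe (π := fun _ : ℕ => X) n φ) =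
      Complex.exp (α * partialSum F (n + 1) φ) := by
    intro φ
    rw [hT]
    dsimp only
    congr 3
    unfold partialSum
    exact Finset.sum_attach (Finset.range (n + 1)) fun i => F (φ i)
  have hmp : AEMeasurable (fun φ : ℕ → X =>
      (Preorder.frestrictLe (π := fun _ : ℕ => X) n φ, φ (n + 1))) (pathLaw P x) := by fun_prop
  have hUm : Measurable fun p : ((i : Finset.Iic n) → X) × X => T p.1 * g p.2 := by fun_prop
  have h1 : ∫ φ, Complex.exp (α * partialSum F (n + 1) φ) * g (φ (n + 1)) ∂(pathLaw P x) =
      ∫ p, T p.1 * g p.2 ∂((pathLaw P x).map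
        (fun φ => (Preorder.frestrictLe (π := fun _ : ℕ => X) n φ, φ (n + 1)))) := by
    rw [integral_map hmp hUm.aestronglyMeasurable]
    simp only [hT2]
  have hint : Integrable (fun p : ((i : Finset.Iic n) → X) × X => T p.1 * g p.2)
      ((pathLaw P x).map
        (fun φ => (Preorder.frestrictLe (π := fun _ : ℕ => X) n φ, φ (n + 1)))) := by
    rw [integrable_map_measure hUm.aestronglyMeasurable hmp]
    have := S.integrable_path α (n + 1) (n + 1) hg x
    refine this.congr (ae_of_all _ fun φ => ?_)
    simp only [Function.comp, hT2]
  rw [h1]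
  rw [pathLaw_map_succ] at hint ⊢
  rw [Measure.integral_compProd hint, integral_map (by fun_prop)
    (StronglyMeasurable.integral_kernel_prod_right' hUm.stronglyMeasurable).aestronglyMeasurable]
  refine integral_congr_ae (ae_of_all _ fun φ => ?_)
  dsimp only
  rw [integral_const_mul, hT2, partialSum_succ]
  push_cast
  rw [mul_add, Complex.exp_add, mul_assoc]
  rfl

/-- `P̂_αⁿ g (x) = E_x[exp(α S_n) g(Φ(n))]`. -/
lemma op_pow_apply (α : ℂ) (n : ℕ) (g : S.E) (x : X) :
    (S.op α ^ n) g x = ∫ φ, Complex.exp (α * partialSum F n φ) * g (φ n) ∂(pathLaw P x) := by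
  induction n generalizing g with
  | zero =>
    have h : ∫ φ : ℕ → X, g (φ 0) ∂(pathLaw P x) = g x := by
      rw [S.integral_pathLaw_eval g.vbdd.1.stronglyMeasurable, integral_pow_zero g.vbdd.1]
    simp [partialSum, h]
  | succ n ih =>
    rw [pow_succ, mul_apply_eq_comp, ih, S.integral_path_succ α n g.vbdd]
    rfl

end Setup

end MultErgodic

namespace MultErgodic

/-! ### Spectral radius in complex Banach algebras -/

section Banach

variable {A : Type*} [NormedRing A] [NormedAlgebra ℂ A] [CompleteSpace A] [Nontrivial A]
  [NormOneClass A]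

/-- The spectral radius as a real number. -/
def sr (T : A) : ℝ := (spectralRadius ℂ T).toReal

lemma sr_nonneg (T : A) : 0 ≤ sr T := ENNReal.toReal_nonneg

lemma spectralRadius_ne_top (T : A) : spectralRadius ℂ T ≠ ∞ :=
  ((spectrum.spectralRadius_le_nnnorm T).trans_lt ENNReal.coe_lt_top).ne

lemma exists_mem_spectrum_norm_eq_sr (T : A) : ∃ z ∈ spectrum ℂ T, ‖z‖ = sr T := by
  obtain ⟨z, hz, h⟩ := spectrum.exists_nnnorm_eq_spectralRadius T
  exact ⟨z, hz, by simp [sr, ← h]⟩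

lemma norm_le_sr {T : A} {z : ℂ} (hz : z ∈ spectrum ℂ T) : ‖z‖ ≤ sr T := by
  have h : (‖z‖₊ : ℝ≥0∞) ≤ spectralRadius ℂ T := le_iSup₂ (f := fun z _ => (‖z‖₊ : ℝ≥0∞)) z hz
  have := (ENNReal.toReal_le_toReal ENNReal.coe_ne_top (spectralRadius_ne_top T)).2 h
  simpa [sr] using this

lemma sr_tendsto (T : A) : Tendsto (fun n : ℕ => ‖T ^ n‖ ^ (1 / n : ℝ)) atTop (𝓝 (sr T)) := by
  have h := spectrum.pow_norm_pow_one_div_tendsto_nhds_spectralRadius T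
  have h2 := (ENNReal.tendsto_toReal (spectralRadius_ne_top T)).comp h
  refine h2.congr fun n => ?_
  simp only [Function.comp]
  rw [ENNReal.toReal_ofReal]
  positivity

lemma exists_pow_norm_le {T : A} {ρ : ℝ} (h : sr T < ρ) :
    ∃ C : ℝ, 0 < C ∧ ∀ n, ‖T ^ n‖ ≤ C * ρ ^ n := by
  have hρ : 0 < ρ := (sr_nonneg T).trans_lt h
  have h1 : ∀ᶠ n : ℕ in atTop, ‖T ^ n‖ ≤ ρ ^ n := by
    filter_upwards [(sr_tendsto T).eventually_lt_const h, eventually_gt_atTop 0] with n hn hn0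
    have h2 : ‖T ^ n‖ = (‖T ^ n‖ ^ (1 / n : ℝ)) ^ n := by
      rw [one_div, Real.rpow_inv_natCast_pow (norm_nonneg _) hn0.ne']
    rw [h2]
    exact pow_le_pow_left₀ (by positivity) hn.le n
  obtain ⟨N, hN⟩ := eventually_atTop.1 h1
  refine ⟨1 + ∑ k ∈ Finset.range N, ‖T ^ k‖ / ρ ^ k, ?_, fun n => ?_⟩
  · have : 0 ≤ ∑ k ∈ Finset.range N, ‖T ^ k‖ / ρ ^ k := Finset.sum_nonneg fun k _ => by positivity
    linarith
  · have h0 : 0 ≤ ∑ k ∈ Finset.range N, ‖T ^ k‖ / ρ ^ k :=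
      Finset.sum_nonneg fun k _ => by positivity
    rw [← div_le_iff₀ (by positivity)]
    by_cases hn : n < N
    · have := Finset.single_le_sum (f := fun k => ‖T ^ k‖ / ρ ^ k) (fun k _ => by positivity)
        (Finset.mem_range.2 hn)
      linarith
    · have : ‖T ^ n‖ / ρ ^ n ≤ 1 := by
        rw [div_le_one (by positivity)]; exact hN n (not_lt.1 hn)
      linarith

lemma sr_le_of_pow_norm_le {T : A} {C ρ : ℝ} (hρ : 0 ≤ ρ)
    (h : ∀ n, ‖T ^ n‖ ≤ C * ρ ^ n) : sr T ≤ ρ := by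
  have hC : 0 < max C 1 := lt_max_of_lt_right one_pos
  have h1 : Tendsto (fun n : ℕ => (max C 1) ^ (1 / n : ℝ) * ρ) atTop (𝓝 (1 * ρ)) := by
    refine Tendsto.mul_const ρ ?_
    have := (Real.continuousAt_const_rpow hC.ne' (b := 0)).tendsto.comp
      (tendsto_one_div_atTop_nhds_zero_nat (𝕜 := ℝ))
    rw [Real.rpow_zero] at this
    exact this
  rw [one_mul] at h1
  refine le_of_tendsto_of_tendsto (sr_tendsto T) h1 ?_
  filter_upwards [eventually_gt_atTop 0] with n hn
  calc ‖T ^ n‖ ^ (1 / n : ℝ) ≤ (max C 1 * ρ ^ n) ^ (1 / n : ℝ) := by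
        refine Real.rpow_le_rpow (norm_nonneg _) ((h n).trans ?_) (by positivity)
        exact mul_le_mul_of_nonneg_right (le_max_left _ _) (by positivity)
    _ = (max C 1) ^ (1 / n : ℝ) * ρ := by
        rw [Real.mul_rpow hC.le (by positivity), one_div, Real.pow_rpow_inv_natCast hρ hn.ne']

lemma exists_pow_norm_lt_one {T : A} {r : ℝ} (h : sr T < r) :
    ∃ n, ‖T ^ n‖ < r ^ n := by
  obtain ⟨ρ, h1, h2⟩ := exists_between h
  obtain ⟨C, hC, hb⟩ := exists_pow_norm_le h1
  have hρ : 0 < ρ := (sr_nonneg T).trans_lt h1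
  have hr : 0 < r := hρ.trans h2
  have h3 : Tendsto (fun n : ℕ => C * (ρ / r) ^ n) atTop (𝓝 (C * 0)) :=
    (tendsto_pow_atTop_nhds_zero_of_lt_one (by positivity) ((div_lt_one hr).2 h2)).const_mul C
  rw [mul_zero] at h3
  obtain ⟨n, hn⟩ := (h3.eventually_lt_const one_pos).exists
  refine ⟨n, (hb n).trans_lt ?_⟩
  rw [div_pow, ← mul_div_assoc, div_lt_one (by positivity)] at hn
  exact hn

lemma isUnit_of_sr_lt {T : A} {z : ℂ} (h : sr T < ‖z‖) : IsUnit (algebraMap ℂ A z - T) := by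
  by_contra hn
  exact (norm_le_sr (T := T) hn).not_gt h

/-- Geometric decay is uniform on compact sets of parameters. -/
lemma IsCompact.exists_uniform_pow_norm_le {Z : Type*} [TopologicalSpace Z] {K : Set Z}
    (hK : IsCompact K) {T : Z → A} (hT : ContinuousOn T K) (h : ∀ p ∈ K, ∃ n, ‖T p ^ n‖ < 1) :
    ∃ B γ : ℝ, 0 < γ ∧ γ < 1 ∧ ∀ p ∈ K, ∀ n, ‖T p ^ n‖ ≤ B * γ ^ n := by
  refine hK.induction_on (p := fun s => ∃ B γ : ℝ, 0 < γ ∧ γ < 1 ∧ ∀ p ∈ s, ∀ n,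
    ‖T p ^ n‖ ≤ B * γ ^ n) ⟨0, 1 / 2, by norm_num, by norm_num, by simp⟩ ?_ ?_ ?_
  · rintro s t hst ⟨B, γ, h0, h1, hb⟩
    exact ⟨B, γ, h0, h1, fun p hp => hb p (hst hp)⟩
  · rintro s t ⟨B, γ, h0, h1, hb⟩ ⟨B', γ', h0', h1', hb'⟩
    refine ⟨max (max B B') 0, max γ γ', lt_max_of_lt_left h0, max_lt h1 h1', ?_⟩
    have key : ∀ (D c : ℝ), D ≤ max B B' → 0 < c → c ≤ max γ γ' → ∀ n : ℕ,
        D * c ^ n ≤ max (max B B') 0 * max γ γ' ^ n := by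
      intro D c hD hc hc' n
      refine mul_le_mul (hD.trans (le_max_left _ _)) (pow_le_pow_left₀ hc.le hc' n)
        (by positivity) (le_max_right _ _)
    rintro p (hp | hp) n
    · exact (hb p hp n).trans (key B γ (le_max_left _ _) h0 (le_max_left _ _) n)
    · exact (hb' p hp n).trans (key B' γ' (le_max_right _ _) h0' (le_max_right _ _) n)
  -- Near `p` a single power `N` with `‖T^N‖ < c < 1` persists. Writing `n = N (n / N) + n % N`
  -- gives the rate `γ = c^{1/N}`, and the factor `M^N / γ^N` pays for the remainder.
  · intro p hp
    obtain ⟨N, hN⟩ := h p hp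
    obtain ⟨c, hc1, hc2⟩ := exists_between hN
    have hN0 : N ≠ 0 := by
      rintro rfl
      simp at hN
    have hc0 : 0 < c := (norm_nonneg _).trans_lt hc1
    have hTp := hT p hp
    have e1 : ∀ᶠ q in 𝓝[K] p, ‖T q ^ N‖ < c := (hTp.pow N).norm.eventually_lt_const hc1
    have e2 : ∀ᶠ q in 𝓝[K] p, ‖T q‖ < ‖T p‖ + 1 :=
      hTp.norm.eventually_lt_const (lt_add_one _)
    refine ⟨_, e1.and e2, ?_⟩
    set M := ‖T p‖ + 1 with hM
    have hM1 : 1 ≤ M := by have := norm_nonneg (T p); linarith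
    set γ := c ^ (1 / N : ℝ) with hγ
    have hγN : γ ^ N = c := by
      rw [hγ, one_div, Real.rpow_inv_natCast_pow hc0.le hN0]
    have hγ0 : 0 < γ := by positivity
    have hγ1 : γ < 1 := Real.rpow_lt_one hc0.le hc2 (by positivity)
    refine ⟨M ^ N / γ ^ N, γ, hγ0, hγ1, ?_⟩
    rintro q ⟨hq1, hq2⟩ n
    have hn := Nat.div_add_mod n N
    have hlt : n % N < N := Nat.mod_lt _ (Nat.pos_of_ne_zero hN0)
    calc ‖T q ^ n‖ = ‖(T q ^ N) ^ (n / N) * T q ^ (n % N)‖ := by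
          rw [← pow_mul, ← pow_add, hn]
      _ ≤ ‖T q ^ N‖ ^ (n / N) * ‖T q‖ ^ (n % N) :=
          (norm_mul_le _ _).trans (mul_le_mul (norm_pow_le _ _) (norm_pow_le _ _)
            (norm_nonneg _) (by positivity))
      _ ≤ c ^ (n / N) * M ^ N := by
          refine mul_le_mul (pow_le_pow_left₀ (norm_nonneg _) hq1.le _) ?_ (by positivity)
            (by positivity)
          exact (pow_le_pow_left₀ (norm_nonneg _) hq2.le _).trans
            (pow_le_pow_right₀ hM1 hlt.le)
      _ ≤ M ^ N / γ ^ N * γ ^ n := by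
          rw [← hγN, ← pow_mul, div_mul_eq_mul_div, le_div_iff₀ (by positivity), mul_comm,
            ← mul_assoc, mul_comm]
          refine mul_le_mul_of_nonneg_left ?_ (by positivity)
          rw [← pow_add]
          exact pow_le_pow_of_le_one hγ0.le hγ1.le (by omega)

end Banach

/-! ### Approximate eigenvectors -/

section Operators

variable {E : Type*} [NormedAddCommGroup E] [NormedSpace ℂ E] [CompleteSpace E] [Nontrivial E]

/-- The resolvent of `T` is large near the spectrum. -/
lemma exists_resolvent_large {T : E →L[ℂ] E} {z w : ℂ} (hz : z ∈ spectrum ℂ T)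
    (hw : w ∉ spectrum ℂ T) :
    ∃ y : E, y ≠ 0 ∧ ‖y‖ ≤ 2 * ‖w - z‖ * ‖_root_.resolvent T w y‖ := by
  have hu : IsUnit (algebraMap ℂ (E →L[ℂ] E) w - T) := by
    by_contra h; exact hw h
  have hwz : 0 < ‖w - z‖ := by
    rw [norm_pos_iff, sub_ne_zero]
    rintro rfl
    exact hw hz
  by_contra! hcon
  -- With so small a resolvent at `w`, the factorisation `z - T = (w - T)(1 - (w - z)(w - T)⁻¹)`
  -- would make `z - T` invertible.
  have hle : ‖_root_.resolvent T w‖ ≤ 1 / (2 * ‖w - z‖) := by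
    refine ContinuousLinearMap.opNorm_le_bound _ (by positivity) fun y => ?_
    by_cases hy : y = 0
    · simp [hy]
    · rw [div_mul_eq_mul_div, le_div_iff₀ (by positivity), one_mul, mul_comm]
      exact (hcon y hy).le
  have h1 : ‖(w - z) • _root_.resolvent T w‖ < 1 := by
    rw [norm_smul]
    calc ‖w - z‖ * ‖_root_.resolvent T w‖ ≤ ‖w - z‖ * (1 / (2 * ‖w - z‖)) := by gcongr
      _ = 1 / 2 := by field_simp
      _ < 1 := by norm_num
  have h2 := isUnit_one_sub_of_norm_lt_one h1
  have h3 : algebraMap ℂ (E →L[ℂ] E) z - T =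
      (algebraMap ℂ (E →L[ℂ] E) w - T) * (1 - (w - z) • _root_.resolvent T w) := by
    have h4 : (algebraMap ℂ (E →L[ℂ] E) w - T) * _root_.resolvent T w = 1 :=
      Ring.mul_inverse_cancel _ hu
    rw [mul_sub, mul_one, mul_smul_comm, h4, Algebra.algebraMap_eq_smul_one,
      Algebra.algebraMap_eq_smul_one, sub_smul]
    abel
  exact hz (show IsUnit _ by rw [h3]; exact hu.mul h2)

/-- A point of the spectrum of maximal modulus is an approximate eigenvalue. -/
lemma exists_approx_eigenvector {T : E →L[ℂ] E} {z : ℂ} (hz : z ∈ spectrum ℂ T)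
    (hz0 : z ≠ 0) (hsr : ‖z‖ = sr T) :
    ∃ g : ℕ → E, (∀ n, ‖g n‖ = 1) ∧ Tendsto (fun n => ‖z • g n - T (g n)‖) atTop (𝓝 0) := by
  -- `w n` tends to `z` radially from outside the spectral disc, so the resolvent exists there; it
  -- is large on some `y n`, and the normalised images are the approximate eigenvectors.
  set w : ℕ → ℂ := fun n => (1 + 1 / ((n : ℂ) + 1)) * z with hwdef
  have hwz : ∀ n, w n - z = (1 / ((n : ℂ) + 1)) * z := fun n => by rw [hwdef]; ring
  have hnorm : ∀ n : ℕ, ‖w n - z‖ = 1 / ((n : ℝ) + 1) * ‖z‖ := by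
    intro n
    rw [hwz, norm_mul, norm_div, norm_one]
    congr 2
    have : ((n : ℂ) + 1) = ((n + 1 : ℕ) : ℂ) := by push_cast; rfl
    rw [this, Complex.norm_natCast]; push_cast; rfl
  have hw : ∀ n, w n ∉ spectrum ℂ T := by
    intro n h
    have h1 := norm_le_sr h
    have h2 : ‖w n‖ = (1 + 1 / ((n : ℝ) + 1)) * ‖z‖ := by
      rw [hwdef]
      dsimp only
      rw [norm_mul]
      congr 1
      have : (1 + 1 / ((n : ℂ) + 1)) = ((1 + 1 / ((n : ℝ) + 1) : ℝ) : ℂ) := by push_cast; rfl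
      rw [this, Complex.norm_real, Real.norm_of_nonneg (by positivity)]
    have h3 : 0 < ‖z‖ := norm_pos_iff.2 hz0
    rw [← hsr, h2] at h1
    have h4 : 0 < 1 / ((n : ℝ) + 1) * ‖z‖ := by positivity
    linarith
  choose y hy0 hy using fun n => exists_resolvent_large hz (hw n)
  set v : ℕ → E := fun n => _root_.resolvent T (w n) (y n) with hv
  have hTv : ∀ n, w n • v n - T (v n) = y n := by
    intro n
    have hu : IsUnit (algebraMap ℂ (E →L[ℂ] E) (w n) - T) := by
      by_contra h; exact hw n h
    have h4 : (algebraMap ℂ (E →L[ℂ] E) (w n) - T) * _root_.resolvent T (w n) = 1 :=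
      Ring.mul_inverse_cancel _ hu
    have h5 := congrArg (fun L : E →L[ℂ] E => L (y n)) h4
    simpa [Algebra.algebraMap_eq_smul_one] using h5
  have hv0 : ∀ n, v n ≠ 0 := by
    intro n h
    have := hTv n
    rw [h] at this
    simp only [smul_zero, map_zero, sub_zero] at this
    exact hy0 n this.symm
  have hvn : ∀ n, 0 < ‖v n‖ := fun n => norm_pos_iff.2 (hv0 n)
  refine ⟨fun n => ((‖v n‖⁻¹ : ℝ) : ℂ) • v n, fun n => ?_, ?_⟩
  · rw [norm_smul, Complex.norm_real, norm_inv, norm_norm, inv_mul_cancel₀ (hvn n).ne']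
  · have hlim : Tendsto (fun n : ℕ => 3 * (1 / ((n : ℝ) + 1) * ‖z‖)) atTop (𝓝 0) := by
      have := ((tendsto_one_div_add_atTop_nhds_zero_nat (𝕜 := ℝ)).mul_const ‖z‖).const_mul 3
      simpa using this
    refine squeeze_zero (fun n => norm_nonneg _) (fun n => ?_) hlim
    have h1 : z • (((‖v n‖⁻¹ : ℝ) : ℂ) • v n) - T (((‖v n‖⁻¹ : ℝ) : ℂ) • v n) =
        ((‖v n‖⁻¹ : ℝ) : ℂ) • (y n - (w n - z) • v n) := by
      rw [← hTv n, map_smul, sub_smul, smul_sub, smul_sub, smul_sub,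
        smul_comm z]
      abel
    rw [h1, norm_smul, Complex.norm_real, norm_inv, norm_norm, ← hnorm n]
    have h2 : ‖y n - (w n - z) • v n‖ ≤ 3 * ‖w n - z‖ * ‖v n‖ := by
      refine (norm_sub_le _ _).trans ?_
      rw [norm_smul]
      have := hy n
      linarith
    rw [inv_mul_le_iff₀ (hvn n)]
    linarith

/-- The Neumann series of the resolvent outside the spectral radius. -/
lemma hasSum_resolvent {T : E →L[ℂ] E} {w : ℂ} (hw : sr T < ‖w‖) :
    HasSum (fun k : ℕ => (w⁻¹) ^ (k + 1) • T ^ k) (_root_.resolvent T w) := by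
  obtain ⟨ρ, h1, h2⟩ := exists_between hw
  obtain ⟨C, hC, hb⟩ := exists_pow_norm_le h1
  have hρ : 0 < ρ := (sr_nonneg T).trans_lt h1
  have hw0 : 0 < ‖w‖ := hρ.trans h2
  have hw0' : w ≠ 0 := norm_pos_iff.1 hw0
  have hsum : Summable (fun k : ℕ => (w⁻¹) ^ (k + 1) • T ^ k) := by
    refine Summable.of_norm_bounded (g := fun k : ℕ => ‖w‖⁻¹ * C * (ρ / ‖w‖) ^ k) ?_ fun k => ?_
    · exact (summable_geometric_of_lt_one (by positivity) ((div_lt_one hw0).2 h2)).mul_left _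
    · rw [norm_smul, norm_pow, norm_inv]
      calc ‖w‖⁻¹ ^ (k + 1) * ‖T ^ k‖ ≤ ‖w‖⁻¹ ^ (k + 1) * (C * ρ ^ k) := by gcongr; exact hb k
        _ = _ := by rw [pow_succ, div_eq_mul_inv, mul_pow]; ring
  have hu : IsUnit (algebraMap ℂ (E →L[ℂ] E) w - T) := isUnit_of_sr_lt hw
  set R := ∑' k : ℕ, (w⁻¹) ^ (k + 1) • T ^ k with hR
  have hR1 : w • R = 1 + T * R := by
    have e1 : w • R = ∑' k : ℕ, (w⁻¹) ^ k • T ^ k := by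
      rw [hR, ← hsum.tsum_const_smul w]
      refine tsum_congr fun k => ?_
      rw [smul_smul, pow_succ', ← mul_assoc, mul_inv_cancel₀ hw0', one_mul]
    have hsum' : Summable fun k : ℕ => (w⁻¹) ^ k • T ^ k := by
      refine (hsum.const_smul w).congr fun k => ?_
      rw [smul_smul, pow_succ', ← mul_assoc, mul_inv_cancel₀ hw0', one_mul]
    rw [e1, hsum'.tsum_eq_zero_add, hR, ← hsum.tsum_mul_left T]
    simp only [pow_zero, one_smul]
    congr 1
    refine tsum_congr fun k => ?_
    rw [mul_smul_comm, ← pow_succ']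
  have h4 : (algebraMap ℂ (E →L[ℂ] E) w - T) * R = 1 := by
    rw [sub_mul, Algebra.algebraMap_eq_smul_one, smul_mul_assoc, one_mul, hR1]
    abel
  have h5 : (algebraMap ℂ (E →L[ℂ] E) w - T) * _root_.resolvent T w = 1 := Ring.mul_inverse_cancel _ hu
  have h6 : R = _root_.resolvent T w := hu.mul_left_cancel (h4.trans h5.symm)
  rw [← h6]
  exact hsum.hasSum

end Operators

end MultErgodic

namespace MultErgodic

variable {X : Type*} [MeasurableSpace X]

/-! ### Weak sequential compactness -/

/-- A bounded sequence of functions has a subsequence that converges when tested against any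
integrable function. -/
lemma exists_weak_subseq [MeasurableSpace.CountablyGenerated X] (π : Measure X)
    [IsFiniteMeasure π] {u : ℕ → X → ℂ} (hu : ∀ n, Measurable (u n)) (hu1 : ∀ n x, ‖u n x‖ ≤ 1) :
    ∃ φ : ℕ → ℕ, StrictMono φ ∧ ∀ k : X → ℂ, Integrable k π →
      CauchySeq fun n => ∫ x, k x * u (φ n) x ∂π := by
  set L : ℕ → (X → ℂ) → ℂ := fun n k => ∫ x, k x * u n x ∂π with hL
  have hint : ∀ n (k : X → ℂ), Integrable k π → Integrable (fun x => k x * u n x) π :=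
    fun n k hk => hk.mul_bdd (hu n).aestronglyMeasurable (ae_of_all _ (hu1 n))
  have hbound : ∀ n (k : X → ℂ), Integrable k π → ‖L n k‖ ≤ ∫ x, ‖k x‖ ∂π := by
    intro n k hk
    refine norm_integral_le_of_norm_le hk.norm (ae_of_all _ fun x => ?_)
    rw [norm_mul]
    exact mul_le_of_le_one_right (norm_nonneg _) (hu1 n x)
  have hsub : ∀ n (k k' : X → ℂ), Integrable k π → Integrable k' π →
      ‖L n k - L n k'‖ ≤ ∫ x, ‖k x - k' x‖ ∂π := by
    intro n k k' hk hk'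
    have h := hbound n (fun x => k x - k' x) (hk.sub hk')
    rw [hL] at h ⊢
    dsimp only at h ⊢
    simp only [sub_mul] at h
    rwa [integral_sub (hint n k hk) (hint n k' hk')] at h
  have : Fact ((1 : ℝ≥0∞) ≠ ∞) := ⟨ENNReal.one_ne_top⟩
  -- Separability of `L¹(π)` rests on the countably generated σ-field. The values on a dense
  -- sequence lie in a countable product of discs, which is sequentially compact; the uniform bound
  -- on `u` extends convergence to all test functions by an `ε/3` argument.
  set d : ℕ → Lp ℂ 1 π := TopologicalSpace.denseSeq (Lp ℂ 1 π) with hd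
  have hdi : ∀ i, Integrable (d i) π := fun i => L1.integrable_coeFn (d i)
  have hcomp : IsCompact (Set.pi univ fun i => Metric.closedBall (0 : ℂ) (∫ x, ‖d i x‖ ∂π)) :=
    isCompact_univ_pi fun i => isCompact_closedBall _ _
  obtain ⟨l, -, φ, hφ, hl⟩ := hcomp.tendsto_subseq (x := fun n i => L n (d i)) (fun n i _ => by
    rw [mem_closedBall_zero_iff]
    exact hbound n _ (hdi i))
  refine ⟨φ, hφ, fun k hk => ?_⟩
  rw [Metric.cauchySeq_iff]
  intro ε hε
  obtain ⟨i, hi⟩ := (TopologicalSpace.denseRange_denseSeq (Lp ℂ 1 π)).exists_dist_lt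
    (hk.toL1 k) (ε := ε / 3) (by positivity)
  have hi' : ∫ x, ‖k x - d i x‖ ∂π < ε / 3 := by
    rw [L1.dist_eq_integral_dist] at hi
    refine lt_of_eq_of_lt (integral_congr_ae ?_) hi
    filter_upwards [hk.coeFn_toL1] with x hx
    rw [dist_eq_norm, hx]
  have hc : CauchySeq fun n => L (φ n) (d i) := ((tendsto_pi_nhds.1 hl) i).cauchySeq
  obtain ⟨N, hN⟩ := Metric.cauchySeq_iff.1 hc (ε / 3) (by positivity)
  refine ⟨N, fun m hm n hn => ?_⟩
  have h1 := hN m hm n hn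
  rw [dist_eq_norm] at h1 ⊢
  have h2 := hsub (φ m) k (d i) hk (hdi i)
  have h3 := hsub (φ n) k (d i) hk (hdi i)
  have h4 : L (φ m) k - L (φ n) k = (L (φ m) k - L (φ m) (d i)) +
      (L (φ m) (d i) - L (φ n) (d i)) - (L (φ n) k - L (φ n) (d i)) := by ring
  change ‖L (φ m) k - L (φ n) k‖ < ε
  rw [h4]
  refine (norm_sub_le _ _).trans_lt ?_
  have := norm_add_le (L (φ m) k - L (φ m) (d i)) (L (φ m) (d i) - L (φ n) (d i))
  linarith

/-- A measure is absolutely continuous with respect to `π` off a `π`-null set. -/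
lemma exists_null_restrict_compl_ac (μ π : Measure X) [SigmaFinite μ] [SigmaFinite π] :
    ∃ N, MeasurableSet N ∧ π N = 0 ∧ μ.restrict Nᶜ ≪ π := by
  obtain ⟨T, hT, h1, h2⟩ := Measure.mutuallySingular_singularPart μ π
  refine ⟨Tᶜ, hT.compl, h2, ?_⟩
  rw [compl_compl, Measure.haveLebesgueDecomposition_add μ π, Measure.restrict_add]
  have h3 : (μ.singularPart π).restrict T = 0 := Measure.restrict_eq_zero.2 h1
  rw [h3, zero_add]
  exact Measure.absolutelyContinuous_of_le Measure.restrict_le_self |>.trans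
    (withDensity_absolutelyContinuous _ _)

/-! ### Absorbing sets of full measure and convergence of path expectations. -/

namespace Setup

variable {P : Kernel X X} [IsMarkovKernel P] {V F : X → ℝ} {π : Measure X} {δ b : ℝ}
    {s : X → ℝ} {ν : Measure X} (S : Setup P V F π δ b s ν)

omit [IsMarkovKernel P] in
lemma res_zero_iff_aux {x : X} {A : Set X} (hA : MeasurableSet A)
    (h : resKernel P x A = 0) : x ∉ A ∧ ∫⁻ y, resKernel P y A ∂(P x) = 0 := by
  rw [resKernel_eq_add_comp', Measure.add_apply, Measure.smul_apply, Measure.smul_apply,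
    Kernel.comp_apply' _ _ _ hA, smul_eq_mul, smul_eq_mul, add_eq_zero, mul_eq_zero,
    mul_eq_zero] at h
  have h1 : ENNReal.ofReal (1 - Real.exp (-1)) ≠ 0 := by
    simp
  have h2 : ENNReal.ofReal (Real.exp (-1)) ≠ 0 := by simp [Real.exp_pos]
  refine ⟨fun hx => ?_, h.2.resolve_left h2⟩
  have := h.1.resolve_left h1
  simp [Measure.dirac_apply' _ hA, hx] at this

omit [IsMarkovKernel P] in
/-- The points from which the chain never reaches `A` form an absorbing set. -/
lemma isAbsorbing_res_zero {A : Set X} (hA : MeasurableSet A) :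
    IsAbsorbing P {x | resKernel P x A = 0} := by
  have hm : MeasurableSet {x | resKernel P x A = 0} :=
    (resKernel P).measurable_coe hA (measurableSet_singleton 0)
  refine ⟨hm, fun x hx => ?_⟩
  have h := (res_zero_iff_aux hA hx).2
  rw [lintegral_eq_zero_iff ((resKernel P).measurable_coe hA)] at h
  exact h

include S

lemma lintegral_P_pi {f : X → ℝ≥0∞} (hf : Measurable f) :
    ∫⁻ x, ∫⁻ y, f y ∂(P x) ∂π = ∫⁻ x, f x ∂π := by
  conv_rhs => rw [← S.pi_inv.def]
  rw [Measure.lintegral_bind P.aemeasurable hf.aemeasurable]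

/-- Invariance of `π` and `π(A) = 0` show that the finite number `J = ∫ R(x, A) dπ` satisfies `J =
e⁻¹ J`, so `J = 0`. -/
lemma pi_res_zero_compl {A : Set X} (hA : MeasurableSet A) (h : π A = 0) :
    π {x | resKernel P x A = 0}ᶜ = 0 := by
  have := S.pi_prob
  have hm := (resKernel P).measurable_coe hA
  have hJ : ∫⁻ x, resKernel P x A ∂π =
      ENNReal.ofReal (Real.exp (-1)) * ∫⁻ x, resKernel P x A ∂π := by
    calc ∫⁻ x, resKernel P x A ∂π = ∫⁻ x, (ENNReal.ofReal (1 - Real.exp (-1)) * A.indicator 1 x +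
          ENNReal.ofReal (Real.exp (-1)) * ∫⁻ y, resKernel P y A ∂(P x)) ∂π := by
          refine lintegral_congr fun x => ?_
          rw [resKernel_eq_add_comp', Measure.add_apply, Measure.smul_apply, Measure.smul_apply,
            Kernel.comp_apply' _ _ _ hA, smul_eq_mul, smul_eq_mul, Measure.dirac_apply' _ hA]
      _ = _ := by
          rw [lintegral_add_left ((measurable_one.indicator hA).const_mul _),
            lintegral_const_mul _ (measurable_one.indicator hA), lintegral_indicator_one hA, h,
            mul_zero, zero_add, lintegral_const_mul _ hm.lintegral_kernel, S.lintegral_P_pi hm]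
  have hfin : ∫⁻ x, resKernel P x A ∂π ≠ ∞ := by
    refine ((lintegral_mono fun x => prob_le_one).trans_lt ?_).ne (b := ∞) (a := _)
    simp
  have hz : ∫⁻ x, resKernel P x A ∂π = 0 := by
    by_contra hne
    have h1 : ENNReal.ofReal (Real.exp (-1)) * ∫⁻ x, resKernel P x A ∂π <
        1 * ∫⁻ x, resKernel P x A ∂π := by
      rw [ENNReal.mul_lt_mul_iff_left hne hfin]
      rw [ENNReal.ofReal_lt_one]
      exact exp_neg_one_lt_one
    rw [one_mul, ← hJ] at h1
    exact lt_irrefl _ h1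
  rw [lintegral_eq_zero_iff hm] at hz
  exact hz

/-- A `π`-null set is contained in the complement of an absorbing set of full measure. -/
lemma exists_absorbing_of_null {A : Set X} (hA : MeasurableSet A) (h : π A = 0) :
    ∃ Y, IsAbsorbing P Y ∧ Disjoint Y A ∧ π Yᶜ = 0 ∧ ν Yᶜ = 0 := by
  have := S.pi_prob
  have h0 := S.pi_res_zero_compl hA h
  refine ⟨_, isAbsorbing_res_zero hA, ?_, h0, ?_⟩
  · exact Set.disjoint_left.2 fun x hx => (res_zero_iff_aux hA hx).1
  · refine IsAbsorbing.nu_compl S (isAbsorbing_res_zero hA) ?_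
    by_contra hne
    rw [not_nonempty_iff_eq_empty] at hne
    rw [hne] at h0
    simp at h0

/-- The singular parts of the countably many laws `P^m(x, ·)` live on one `π`-null set, and an
absorbing set of full measure avoids it. On that set weak convergence with respect to `π` controls
expectations started at the single point `x`. -/
lemma exists_absorbing_ac (x : X) :
    ∃ Y, IsAbsorbing P Y ∧ π Yᶜ = 0 ∧ ν Yᶜ = 0 ∧ ∀ m, ((P ^ m) x).restrict Y ≪ π := by
  have := S.pi_prob
  choose N hN hN0 hac using fun m : ℕ => exists_null_restrict_compl_ac ((P ^ m) x) π
  obtain ⟨Y, hY, hd, h1, h2⟩ := S.exists_absorbing_of_null (MeasurableSet.iUnion hN)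
    (measure_iUnion_null hN0)
  refine ⟨Y, hY, h1, h2, fun m => ?_⟩
  refine (Measure.absolutelyContinuous_of_le (Measure.restrict_mono ?_ le_rfl)).trans (hac m)
  intro y hy hyN
  exact Set.disjoint_left.1 hd hy (mem_iUnion.2 ⟨m, hyN⟩)

/-- Convergence of `E[w 1_Y(Φ_m) g_n(Φ_m)]` for nonnegative bounded weights `w`. -/
lemma cauchySeq_weighted {x : X} {m : ℕ} {Y : Set X} (hY : MeasurableSet Y)
    (hac : ((P ^ m) x).restrict Y ≪ π) {g : ℕ → X → ℂ} (hg : ∀ n, VBdd V (g n))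
    (hweak : ∀ k : X → ℂ, Integrable k π → CauchySeq fun n => ∫ y, k y * (g n y / V y) ∂π)
    {w : (ℕ → X) → ℝ} (hw : Measurable w) (hw0 : ∀ φ, 0 ≤ w φ) {K : ℝ} (hK : ∀ φ, w φ ≤ K) :
    CauchySeq fun n => ∫ φ, (w φ : ℂ) * Y.indicator (g n) (φ m) ∂(pathLaw P x) := by
  have := S.pi_prob
  have hem : Measurable fun φ : ℕ → X => φ m := measurable_pi_apply m
  set μ₀ : Measure (ℕ → X) := (pathLaw P x).withDensity fun φ => ENNReal.ofReal (w φ) with hμ₀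
  set μ : Measure X := (μ₀.map fun φ => φ m).restrict Y with hμ
  have hle : μ ≤ ENNReal.ofReal K • ((P ^ m) x).restrict Y := by
    rw [hμ, ← Measure.restrict_smul]
    refine Measure.restrict_mono le_rfl ?_
    rw [← pathLaw_map_eval, ← Measure.map_smul]
    refine Measure.map_mono ?_ hem
    rw [hμ₀, ← withDensity_const]
    exact withDensity_mono (ae_of_all _ fun φ => ENNReal.ofReal_le_ofReal (hK φ))
  have hVμ : Integrable V μ := by
    refine Integrable.mono_measure ?_ hle
    exact ((S.integrable_pow m x).mono_measure Measure.restrict_le_self).smul_measure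
      ENNReal.ofReal_ne_top
  have hfin : IsFiniteMeasure μ := by
    refine ⟨(hle univ).trans_lt ?_⟩
    rw [Measure.smul_apply, smul_eq_mul]
    exact ENNReal.mul_lt_top ENNReal.ofReal_lt_top (measure_lt_top _ _)
  have hμac : μ ≪ π := by
    refine (Measure.absolutelyContinuous_of_le hle).trans ?_
    exact (Measure.smul_absolutelyContinuous).trans hac
  -- The weighted law `μ` of `Φ(m)` on `Y` has a `π`-density; multiplied by `V` it is the test
  -- function against which `g n / V` converges weakly.
  set k : X → ℂ := fun y => ((μ.rnDeriv π y).toReal : ℂ) * (V y : ℂ) with hk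
  have hki : Integrable k π := by
    have h1 : Integrable (fun y => (μ.rnDeriv π y).toReal • V y) π :=
      (integrable_rnDeriv_smul_iff hμac).2 hVμ
    have h2 := h1.ofReal (𝕜 := ℂ)
    refine h2.congr (ae_of_all _ fun y => ?_)
    simp [hk]
  refine (congrArg CauchySeq (funext fun n => ?_)).mpr (hweak k hki)
  have h1 : ∫ φ, (w φ : ℂ) * Y.indicator (g n) (φ m) ∂(pathLaw P x) =
      ∫ φ, Y.indicator (g n) (φ m) ∂μ₀ := by
    rw [hμ₀, integral_withDensity_eq_integral_toReal_smul hw.ennreal_ofReal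
      (ae_of_all _ fun φ => ENNReal.ofReal_lt_top)]
    refine integral_congr_ae (ae_of_all _ fun φ => ?_)
    dsimp only
    rw [ENNReal.toReal_ofReal (hw0 φ), Complex.real_smul]
  have h2 : ∫ φ, Y.indicator (g n) (φ m) ∂μ₀ = ∫ y, g n y ∂μ := by
    rw [hμ, ← integral_indicator hY, integral_map hem.aemeasurable
      ((hg n).1.indicator hY).aestronglyMeasurable]
  rw [h1, h2, ← integral_rnDeriv_smul hμac]
  refine integral_congr_ae (ae_of_all _ fun y => ?_)
  have hV : (V y : ℂ) ≠ 0 := by exact_mod_cast (S.V_pos y).ne'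
  simp only [hk, Complex.real_smul]
  field_simp

/-- Convergence of `E[c 1_Y(Φ_m) g_n(Φ_m)]` for bounded complex weights `c`. -/
lemma cauchySeq_weighted_complex {x : X} {m : ℕ} {Y : Set X} (hY : MeasurableSet Y)
    (hac : ((P ^ m) x).restrict Y ≪ π) {g : ℕ → X → ℂ} (hg : ∀ n, VBdd V (g n))
    (hweak : ∀ k : X → ℂ, Integrable k π → CauchySeq fun n => ∫ y, k y * (g n y / V y) ∂π)
    {c : (ℕ → X) → ℂ} (hc : Measurable c) {K : ℝ} (hK : ∀ φ, ‖c φ‖ ≤ K) :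
    CauchySeq fun n => ∫ φ, c φ * Y.indicator (g n) (φ m) ∂(pathLaw P x) := by
  have hint : ∀ n (w : (ℕ → X) → ℝ), Measurable w → ∀ K', (∀ φ, ‖w φ‖ ≤ K') →
      Integrable (fun φ => (w φ : ℂ) * Y.indicator (g n) (φ m)) (pathLaw P x) := by
    intro n w hw K' hK'
    have h1 : Integrable (fun φ : ℕ → X => Y.indicator (g n) (φ m)) (pathLaw P x) := by
      have := S.integrable_path 0 0 m ((hg n).indicator hY S.one_le_V) x
      simpa using this
    refine h1.bdd_mul (c := K') (by fun_prop) (ae_of_all _ fun φ => ?_)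
    rw [Complex.norm_real]; exact hK' φ
  have hre : ∀ φ, |(c φ).re| ≤ K := fun φ => (Complex.abs_re_le_norm _).trans (hK φ)
  have him : ∀ φ, |(c φ).im| ≤ K := fun φ => (Complex.abs_im_le_norm _).trans (hK φ)
  have hcre : Measurable fun φ => (c φ).re := Complex.measurable_re.comp hc
  have hcim : Measurable fun φ => (c φ).im := Complex.measurable_im.comp hc
  -- The complex weight is reduced to nonnegative ones by `c = (Re c + K) + i (Im c + K) - K (1 +
  -- i)`.
  have c1 := S.cauchySeq_weighted hY hac hg hweak (w := fun φ => (c φ).re + K)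
    (hcre.add_const K) (fun φ => by linarith [neg_abs_le (c φ).re, hre φ]) (K := 2 * K)
    (fun φ => by linarith [le_abs_self (c φ).re, hre φ])
  have c2 := S.cauchySeq_weighted hY hac hg hweak (w := fun φ => (c φ).im + K)
    (hcim.add_const K) (fun φ => by linarith [neg_abs_le (c φ).im, him φ]) (K := 2 * K)
    (fun φ => by linarith [le_abs_self (c φ).im, him φ])
  have c3 := S.cauchySeq_weighted (x := x) hY hac hg hweak (w := fun _ => 1)
    measurable_const (fun φ => zero_le_one) (K := 1) (fun φ => le_rfl)
  obtain ⟨l1, h1⟩ := cauchySeq_tendsto_of_complete c1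
  obtain ⟨l2, h2⟩ := cauchySeq_tendsto_of_complete c2
  obtain ⟨l3, h3⟩ := cauchySeq_tendsto_of_complete c3
  have h := (h1.add (h2.const_mul Complex.I)).sub (h3.const_mul (K * (1 + Complex.I)))
  refine (congrArg CauchySeq (funext fun n => ?_)).mpr h.cauchySeq
  have i1 := hint n (fun φ => (c φ).re + K) (hcre.add_const K) (K + |K|) (fun φ => by
    rw [Real.norm_eq_abs]; exact (abs_add_le _ _).trans (by linarith [hre φ]))
  have i2 := hint n (fun φ => (c φ).im + K) (hcim.add_const K) (K + |K|) (fun φ => by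
    rw [Real.norm_eq_abs]; exact (abs_add_le _ _).trans (by linarith [him φ]))
  have i3 := hint n (fun _ => 1) measurable_const 1 (fun φ => by simp)
  have i12 := i1.add (i2.const_mul Complex.I)
  rw [← integral_const_mul, ← integral_const_mul]
  have e1 := integral_add i1 (i2.const_mul Complex.I)
  have e2 := integral_sub i12 (i3.const_mul (K * (1 + Complex.I)))
  simp only [Pi.add_apply] at e2
  rw [← e1, ← e2]
  refine integral_congr_ae (ae_of_all _ fun φ => ?_)
  dsimp only
  have : c φ = ((c φ).re : ℂ) + (c φ).im * Complex.I := (Complex.re_add_im _).symm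
  conv_lhs => rw [this]
  push_cast
  ring

end Setup

end MultErgodic

/-! ### Compactness of approximate eigenvectors. -/

namespace MultErgodic

variable {X : Type*} [MeasurableSpace X]

namespace Setup

variable {P : Kernel X X} [IsMarkovKernel P] {V F : X → ℝ} {π : Measure X} {δ b : ℝ}
    {s : X → ℝ} {ν : Measure X} (S : Setup P V F π δ b s ν)

/-- Powers of the operator on approximate eigenvectors. -/
lemma tendsto_pow_approx {E : Type*} [NormedAddCommGroup E] [NormedSpace ℂ E] {T : E →L[ℂ] E}
    {z : ℂ} {g : ℕ → E} (h : Tendsto (fun n => z • g n - T (g n)) atTop (𝓝 0)) (m : ℕ) :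
    Tendsto (fun n => z ^ m • g n - (T ^ m) (g n)) atTop (𝓝 0) := by
  induction m with
  | zero => simp
  | succ m ih =>
    have h1 := (T.continuous.tendsto 0).comp ih
    rw [map_zero] at h1
    have h2 := (h.const_smul (z ^ m)).add h1
    rw [smul_zero, add_zero] at h2
    refine h2.congr fun n => ?_
    simp only [Function.comp, map_sub, map_smul, smul_sub]
    rw [pow_succ, mul_smul, pow_succ', mul_apply_eq_comp]
    abel

include S

/-- `|S_m| ≤ m` bounds the exponential weight by `e^{|Re α| m}`, and `pow_V_compl_le` supplies
`q^m`. The product is the source of the radius `e^{|Re α|} q` outside which compactness holds. -/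
lemma norm_integral_compl_le (α : ℂ) : ∃ C : ℝ, 0 ≤ C ∧ ∀ Y : Set X, IsAbsorbing P Y → ν Yᶜ = 0 →
    ∀ (g : S.E) m x, ‖∫ φ, Complex.exp (α * partialSum F m φ) * Yᶜ.indicator g (φ m)
      ∂(pathLaw P x)‖ ≤ C * (Real.exp |α.re| * qrate δ b) ^ m * V x * ‖g‖ := by
  obtain ⟨C, hC0, hC⟩ := S.pow_V_compl_le
  refine ⟨C, hC0, fun Y hY hν g m x => ?_⟩
  have h1 : ∀ φ : ℕ → X, ‖Complex.exp (α * partialSum F m φ) * Yᶜ.indicator g (φ m)‖ ≤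
      Real.exp (|α.re| * m) * ‖g‖ * Yᶜ.indicator V (φ m) := by
    intro φ
    rw [norm_mul, mul_assoc]
    refine mul_le_mul (S.norm_exp_partialSum_le α m φ) ?_ (norm_nonneg _) (Real.exp_pos _).le
    by_cases hφ : φ m ∈ Yᶜ
    · rw [indicator_of_mem hφ, indicator_of_mem hφ]; exact g.norm_apply_le _
    · rw [indicator_of_notMem hφ, indicator_of_notMem hφ]; simp
  have hVi : VBdd V (Yᶜ.indicator V) := S.vbdd_V.indicator hY.1.compl S.one_le_V
  have h2 : Integrable (fun φ : ℕ → X => Yᶜ.indicator V (φ m)) (pathLaw P x) := by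
    have h := hVi.integrable (S.integrable_pow m x)
    rw [← pathLaw_map_eval] at h
    exact (integrable_map_measure hVi.1.aestronglyMeasurable
      (measurable_pi_apply m).aemeasurable).1 h
  refine (norm_integral_le_of_norm_le (h2.const_mul _) (ae_of_all _ h1)).trans ?_
  rw [integral_const_mul, S.integral_pathLaw_eval hVi.1.stronglyMeasurable,
    integral_indicator hY.1.compl]
  calc Real.exp (|α.re| * m) * ‖g‖ * ∫ y in Yᶜ, V y ∂((P ^ m) x)
      ≤ Real.exp (|α.re| * m) * ‖g‖ * (C * qrate δ b ^ m * V x) := by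
        refine mul_le_mul_of_nonneg_left (hC Y hY hν m x) (by positivity)
    _ = _ := by rw [mul_comm |α.re| (m : ℝ), Real.exp_nat_mul, mul_pow]; ring

/-- Up to a vanishing residual `z^m g_n(x)` equals `E_x[e^{αS_m} g_n(Φ(m))]`. The part with `Φ(m) ∉
Y` is small compared with `|z|^m` once `m` is large, uniformly in `n`; for that fixed `m` the part
in `Y` is Cauchy by weak convergence. -/
lemma cauchySeq_apply {α z : ℂ} (hz : Real.exp |α.re| * qrate δ b < ‖z‖) {g : ℕ → S.E}
    (hg : ∀ n, ‖g n‖ ≤ 1) (h : Tendsto (fun n => z • g n - S.op α (g n)) atTop (𝓝 0))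
    (hweak : ∀ k : X → ℂ, Integrable k π → CauchySeq fun n => ∫ y, k y * (g n y / V y) ∂π)
    (x : X) : CauchySeq fun n => g n x := by
  have hq0 : 0 ≤ Real.exp |α.re| * qrate δ b := mul_nonneg (Real.exp_pos _).le qrate_nonneg
  have hz0 : 0 < ‖z‖ := hq0.trans_lt hz
  obtain ⟨C, hC0, hC⟩ := S.norm_integral_compl_le α
  obtain ⟨Y, hY, -, hν, hac⟩ := S.exists_absorbing_ac x
  rw [Metric.cauchySeq_iff]
  intro ε hε
  -- choose the number of steps
  have hlim : Tendsto (fun m : ℕ => C * V x * (Real.exp |α.re| * qrate δ b / ‖z‖) ^ m) atTop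
      (𝓝 (C * V x * 0)) :=
    (tendsto_pow_atTop_nhds_zero_of_lt_one (by positivity) ((div_lt_one hz0).2 hz)).const_mul _
  rw [mul_zero] at hlim
  obtain ⟨m, hm⟩ := (hlim.eventually_lt_const (show 0 < ε / 6 by positivity)).exists
  have hzm : 0 < ‖z‖ ^ m := by positivity
  have h1 := S.cauchySeq_weighted_complex hY.1 (hac m) (fun n => (g n).vbdd) hweak
    (c := fun φ => Complex.exp (α * partialSum F m φ))
    (by have := measurable_partialSum S.F_meas m; fun_prop) (S.norm_exp_partialSum_le α m)
  obtain ⟨N1, hN1⟩ := Metric.cauchySeq_iff.1 h1 (ε / 3 * ‖z‖ ^ m) (by positivity)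
  have h2 := ((LV.eval (hV := S.one_le_V) x).continuous.tendsto 0).comp (tendsto_pow_approx h m)
  rw [map_zero] at h2
  have h3 := h2.norm
  rw [norm_zero] at h3
  obtain ⟨N2, hN2⟩ := eventually_atTop.1
    (h3.eventually_lt_const (show 0 < ε / 6 * ‖z‖ ^ m by positivity))
  refine ⟨max N1 N2, fun k hk n hn => ?_⟩
  have e1 := hN1 k (le_of_max_le_left hk) n (le_of_max_le_left hn)
  have e2 := hN2 k (le_of_max_le_right hk)
  have e3 := hN2 n (le_of_max_le_right hn)
  have hsplit : ∀ n, (S.op α ^ m) (g n) x =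
      ∫ φ, Complex.exp (α * partialSum F m φ) * Y.indicator (g n) (φ m) ∂(pathLaw P x) +
      ∫ φ, Complex.exp (α * partialSum F m φ) * Yᶜ.indicator (g n) (φ m) ∂(pathLaw P x) := by
    intro n
    rw [S.op_pow_apply, ← integral_add
      (S.integrable_path α m m ((g n).vbdd.indicator hY.1 S.one_le_V) x)
      (S.integrable_path α m m ((g n).vbdd.indicator hY.1.compl S.one_le_V) x)]
    refine integral_congr_ae (ae_of_all _ fun φ => ?_)
    dsimp only
    rw [← mul_add]
    congr 1
    exact (indicator_self_add_compl_apply Y _ _).symm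
  have hsmall : ∀ n, ‖∫ φ, Complex.exp (α * partialSum F m φ) * Yᶜ.indicator (g n) (φ m)
      ∂(pathLaw P x)‖ ≤ ε / 6 * ‖z‖ ^ m := by
    intro n
    refine (hC Y hY hν (g n) m x).trans ?_
    rw [div_pow, ← mul_div_assoc, div_lt_iff₀ hzm] at hm
    have hV := (S.V_pos x).le
    calc C * (Real.exp |α.re| * qrate δ b) ^ m * V x * ‖g n‖
        ≤ C * (Real.exp |α.re| * qrate δ b) ^ m * V x * 1 :=
          mul_le_mul_of_nonneg_left (hg n) (by positivity)
      _ = C * V x * (Real.exp |α.re| * qrate δ b) ^ m := by ring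
      _ ≤ _ := hm.le
  rw [dist_eq_norm] at e1 ⊢
  simp only [Function.comp, LV.eval_apply, LV.sub_apply, LV.smul_apply] at e2 e3
  have hkey : z ^ m * (g k x - g n x) = (z ^ m * g k x - (S.op α ^ m) (g k) x) -
      (z ^ m * g n x - (S.op α ^ m) (g n) x) + ((S.op α ^ m) (g k) x - (S.op α ^ m) (g n) x) := by
    ring
  have hnorm : ‖z‖ ^ m * ‖g k x - g n x‖ < ε * ‖z‖ ^ m := by
    rw [← norm_pow, ← norm_mul, hkey, norm_pow]
    rw [hsplit k, hsplit n] at *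
    have s1 := hsmall k
    have s2 := hsmall n
    set Ak := ∫ φ, Complex.exp (α * partialSum F m φ) * Y.indicator (g k) (φ m) ∂(pathLaw P x)
    set An := ∫ φ, Complex.exp (α * partialSum F m φ) * Y.indicator (g n) (φ m) ∂(pathLaw P x)
    set Bk := ∫ φ, Complex.exp (α * partialSum F m φ) * Yᶜ.indicator (g k) (φ m) ∂(pathLaw P x)
    set Bn := ∫ φ, Complex.exp (α * partialSum F m φ) * Yᶜ.indicator (g n) (φ m) ∂(pathLaw P x)
    have t1 := norm_add_le (z ^ m * g k x - (Ak + Bk) - (z ^ m * g n x - (An + Bn)))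
      (Ak + Bk - (An + Bn))
    have t2 := norm_sub_le (z ^ m * g k x - (Ak + Bk)) (z ^ m * g n x - (An + Bn))
    have t3 : Ak + Bk - (An + Bn) = (Ak - An) + (Bk - Bn) := by ring
    have t4 := norm_add_le (Ak - An) (Bk - Bn)
    have t5 := norm_sub_le Bk Bn
    rw [t3] at t1 ⊢
    linarith
  rw [mul_comm] at hnorm
  exact lt_of_mul_lt_mul_right hnorm hzm.le

/-- Approximate eigenvectors for eigenvalues outside the essential spectral radius subconverge
to eigenvectors. -/
theorem exists_subseq_tendsto [MeasurableSpace.CountablyGenerated X] {α z : ℂ}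
    (hz : Real.exp |α.re| * qrate δ b < ‖z‖) {g : ℕ → S.E}
    (hg : ∀ n, ‖g n‖ ≤ 1) (h : Tendsto (fun n => z • g n - S.op α (g n)) atTop (𝓝 0)) :
    ∃ φ : ℕ → ℕ, StrictMono φ ∧ ∃ g₀ : S.E, Tendsto (g ∘ φ) atTop (𝓝 g₀) ∧
      S.op α g₀ = z • g₀ := by
  have := S.pi_prob
  obtain ⟨φ, hφ, hweak⟩ := exists_weak_subseq π (u := fun n x => g n x / V x)
    (fun n => (g n).vbdd.1.div (Complex.measurable_ofReal.comp S.V_meas)) (fun n x => by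
      have hx := S.V_pos x
      rw [norm_div, Complex.norm_real, Real.norm_of_nonneg hx.le, div_le_one hx]
      have h1 := (g n).norm_apply_le x
      have h2 := mul_le_mul_of_nonneg_right (hg n) hx.le
      linarith)
  have hφt := hφ.tendsto_atTop
  have h' := h.comp hφt
  have hc : ∀ x, CauchySeq fun n => g (φ n) x :=
    S.cauchySeq_apply hz (fun n => hg (φ n)) h' hweak
  choose u hu using fun x => cauchySeq_tendsto_of_complete (hc x)
  have hbd : ∀ n x, ‖g (φ n) x‖ ≤ V x := by
    intro n x
    have h1 := (g (φ n)).norm_apply_le x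
    have h2 := mul_le_mul_of_nonneg_right (hg (φ n)) (S.V_pos x).le
    linarith
  have hub : VBdd V u := by
    refine ⟨measurable_of_tendsto_metrizable (fun n => (g (φ n)).vbdd.1) (tendsto_pi_nhds.2 hu),
      1, fun x => ?_⟩
    rw [one_mul]
    exact le_of_tendsto (hu x).norm (Eventually.of_forall fun n => hbd n x)
  set g₀ : S.E := LV.mk S.one_le_V u hub with hg₀
  have heig : S.op α g₀ = z • g₀ := by
    refine LV.ext fun x => ?_
    have h1 : Tendsto (fun n => S.op α (g (φ n)) x) atTop (𝓝 (S.op α g₀ x)) := by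
      simp only [S.op_apply]
      refine Tendsto.const_mul _ ?_
      exact tendsto_integral_of_dominated_convergence V
        (fun n => (g (φ n)).vbdd.1.aestronglyMeasurable) (S.v4.integrable x)
        (fun n => ae_of_all _ (hbd n)) (ae_of_all _ hu)
    have h2 : Tendsto (fun n => z * g (φ n) x - S.op α (g (φ n)) x) atTop
        (𝓝 (z * u x - S.op α g₀ x)) := ((hu x).const_mul z).sub h1
    have h3 := ((LV.eval (hV := S.one_le_V) x).continuous.tendsto 0).comp h'
    rw [map_zero] at h3
    have h4 := tendsto_nhds_unique h2 h3
    rw [LV.smul_apply]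
    exact (sub_eq_zero.1 h4).symm
  refine ⟨φ, hφ, g₀, ?_, heig⟩
  -- Norm convergence comes from the a priori estimate for `|g n - u|`: its `ν`-integral tends to
  -- zero by dominated convergence, and the norm of the residual serves as `ε`.
  obtain ⟨C, hC0, hC⟩ := S.apriori (a := α.re) hz
  have hν : Tendsto (fun n => ∫ y, ‖g (φ n) y - u y‖ ∂ν) atTop (𝓝 0) := by
    have : Tendsto (fun n => ∫ y, ‖g (φ n) y - u y‖ ∂ν) atTop (𝓝 (∫ _, (0 : ℝ) ∂ν)) := by
      refine tendsto_integral_of_dominated_convergence (fun y => 2 * V y)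
        (fun n => ((g (φ n)).vbdd.1.sub hub.1).norm.aestronglyMeasurable)
        (S.integrable_nu.const_mul 2) (fun n => ae_of_all _ fun y => ?_) (ae_of_all _ fun y => ?_)
      · rw [norm_norm]
        have h1 : ‖u y‖ ≤ V y := le_of_tendsto (hu y).norm (Eventually.of_forall fun n => hbd n y)
        have := norm_sub_le (g (φ n) y) (u y)
        linarith [hbd n y]
      · exact tendsto_iff_norm_sub_tendsto_zero.1 (hu y)
    simpa using this
  have he : Tendsto (fun n => ‖z • g (φ n) - S.op α (g (φ n))‖) atTop (𝓝 0) := by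
    simpa using h'.norm
  rw [tendsto_iff_norm_sub_tendsto_zero]
  have hlim := (hν.add he).const_mul C
  rw [add_zero, mul_zero] at hlim
  refine squeeze_zero (fun n => norm_nonneg _) (fun n => ?_) hlim
  refine LV.norm_le (mul_nonneg hC0 (add_nonneg (integral_nonneg fun _ => norm_nonneg _)
    (norm_nonneg _))) fun x => ?_
  refine hC (fun y => ‖g (φ n) y - u y‖) ((g (φ n)).vbdd.sub hub).norm (fun y => norm_nonneg _)
    _ (norm_nonneg _) (fun y => ?_) x
  set d : S.E := g (φ n) - g₀ with hd
  have e1 : z • d - S.op α d = z • g (φ n) - S.op α (g (φ n)) := by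
    rw [hd, map_sub, heig, smul_sub]; abel
  have e2 := (z • d - S.op α d).norm_apply_le y
  rw [e1] at e2
  have e3 := S.norm_op_apply_le α d y
  have e4 : (z • g (φ n) - S.op α (g (φ n))) y = z * d y - S.op α d y := by
    rw [← e1]; rfl
  rw [e4] at e2
  have e5 := norm_sub_norm_le (z * d y) (S.op α d y)
  rw [norm_mul] at e5
  change ‖z‖ * ‖d y‖ ≤ Real.exp (α.re * F y) * ∫ y, ‖d y‖ ∂(P y) + _
  linarith

end Setup

end MultErgodic

/-! ### The spectral radius `λ_a`: comparison, lower bound and value at zero. -/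

namespace MultErgodic

variable {X : Type*} [MeasurableSpace X]

namespace Setup

variable {P : Kernel X X} [IsMarkovKernel P] {V F : X → ℝ} {π : Measure X} {δ b : ℝ}
    {s : X → ℝ} {ν : Measure X} (S : Setup P V F π δ b s ν)

include S in
lemma vbdd_one : VBdd V (fun _ : X => (1 : ℝ)) := S.vbdd_const 1

instance : Nontrivial S.E := by
  obtain ⟨x⟩ := S.nonempty
  refine ⟨S.real _ S.vbdd_one, 0, fun h => ?_⟩
  have := congrArg (fun g : S.E => g x) h
  simp at this

/-- The spectral radius `λ_a` of `P̂_a`. -/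
def lam (a : ℝ) : ℝ := sr (S.op a)

/-- `E_x[exp(a S_n) g(Φ(n))]` for real `g`. -/
def pexp (_ : Setup P V F π δ b s ν) (a : ℝ) (n : ℕ) (g : X → ℝ) (x : X) : ℝ :=
  ∫ φ, Real.exp (a * partialSum F n φ) * g (φ n) ∂(pathLaw P x)

include S

lemma op_pow_real (a : ℝ) (n : ℕ) {g : X → ℝ} (hg : VBdd V g) (x : X) :
    (S.op a ^ n) (S.real g hg) x = (S.pexp a n g x : ℂ) := by
  rw [op_pow_apply, pexp, ← integral_complex_ofReal]
  refine integral_congr_ae (ae_of_all _ fun φ => ?_)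
  simp

lemma integrable_pexp (a : ℝ) (n m : ℕ) {g : X → ℝ} (hg : VBdd V g) (x : X) :
    Integrable (fun φ => Real.exp (a * partialSum F n φ) * g (φ m)) (pathLaw P x) := by
  have h := (S.integrable_path a n m hg.ofReal x).re
  refine h.congr (ae_of_all _ fun φ => ?_)
  dsimp only
  rw [← Complex.ofReal_mul, ← Complex.ofReal_exp, ← Complex.ofReal_mul]
  rfl

lemma pexp_nonneg (a : ℝ) (n : ℕ) {g : X → ℝ} (hg : ∀ x, 0 ≤ g x) (x : X) :
    0 ≤ S.pexp a n g x :=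
  integral_nonneg fun _ => mul_nonneg (Real.exp_pos _).le (hg _)

lemma pexp_mono (a : ℝ) (n : ℕ) {g h : X → ℝ} (hg : VBdd V g) (hh : VBdd V h)
    (hgh : ∀ x, g x ≤ h x) (x : X) : S.pexp a n g x ≤ S.pexp a n h x :=
  integral_mono (S.integrable_pexp a n n hg x) (S.integrable_pexp a n n hh x)
    fun _ => mul_le_mul_of_nonneg_left (hgh _) (Real.exp_pos _).le

lemma norm_op_pow_le_pexp (α : ℂ) (n : ℕ) (g : S.E) (x : X) :
    ‖(S.op α ^ n) g x‖ ≤ S.pexp α.re n (fun y => ‖g y‖) x := by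
  rw [op_pow_apply]
  refine norm_integral_le_of_norm_le (S.integrable_pexp _ n n g.vbdd.norm x)
    (ae_of_all _ fun φ => ?_)
  rw [norm_mul, norm_exp_mul_ofReal]

lemma pexp_le_norm (a : ℝ) (n : ℕ) {g : X → ℝ} (hg : VBdd V g) (x : X) :
    S.pexp a n g x ≤ ‖S.op a ^ n‖ * ‖S.real g hg‖ * V x := by
  have h1 := ((S.op a ^ n) (S.real g hg)).norm_apply_le x
  rw [S.op_pow_real a n hg, Complex.norm_real] at h1
  refine (le_abs_self _).trans (h1.trans ?_)
  exact mul_le_mul_of_nonneg_right ((S.op a ^ n).le_opNorm _) (S.V_pos x).le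

lemma norm_real_V : ‖S.real V S.vbdd_V‖ ≤ 1 := by
  refine LV.norm_le zero_le_one fun x => ?_
  rw [one_mul, S.real_apply, Complex.norm_real, Real.norm_of_nonneg (S.V_pos x).le]

lemma norm_real_one : ‖S.real _ S.vbdd_one‖ ≤ 1 := by
  refine LV.norm_le zero_le_one fun x => ?_
  rw [one_mul, S.real_apply]
  simpa using S.one_le_V x

lemma pexp_V_le_norm (a : ℝ) (n : ℕ) (x : X) :
    S.pexp a n V x ≤ ‖S.op a ^ n‖ * V x := by
  refine (S.pexp_le_norm a n S.vbdd_V x).trans ?_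
  refine mul_le_mul_of_nonneg_right ?_ (S.V_pos x).le
  exact mul_le_of_le_one_right (norm_nonneg _) S.norm_real_V

/-- A bound on `E_x[exp(a S_n) V(Φ(n))]` is a bound on the norm of `P̂_αⁿ`. -/
lemma norm_op_pow_le {α : ℂ} {a : ℝ} {n : ℕ} {C K : ℝ} (hC : 0 ≤ C) (hK : 0 ≤ K)
    (h : ∀ x, S.pexp a n V x ≤ C * V x)
    (h2 : ∀ φ : ℕ → X, Real.exp (α.re * partialSum F n φ) ≤ K * Real.exp (a * partialSum F n φ)) :
    ‖S.op α ^ n‖ ≤ K * C := by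
  refine ContinuousLinearMap.opNorm_le_bound _ (by positivity) fun g => ?_
  refine LV.norm_le (by positivity) fun x => ?_
  rw [op_pow_apply]
  have hi := S.integrable_pexp a n n S.vbdd_V x
  refine (norm_integral_le_of_norm_le (hi.const_mul (K * ‖g‖)) (ae_of_all _ fun φ => ?_)).trans ?_
  · rw [norm_mul, norm_exp_mul_ofReal]
    calc Real.exp (α.re * partialSum F n φ) * ‖g (φ n)‖
        ≤ (K * Real.exp (a * partialSum F n φ)) * (‖g‖ * V (φ n)) :=
          mul_le_mul (h2 φ) (g.norm_apply_le _) (norm_nonneg _) (by positivity)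
      _ = _ := by ring
  · rw [integral_const_mul]
    calc K * ‖g‖ * S.pexp a n V x ≤ K * ‖g‖ * (C * V x) :=
          mul_le_mul_of_nonneg_left (h x) (by positivity)
      _ = _ := by ring

/-- Comparison of the operators for different parameters. -/
lemma norm_op_pow_le_norm_op_pow (α : ℂ) (a : ℝ) (n : ℕ) :
    ‖S.op α ^ n‖ ≤ Real.exp |α.re - a| ^ n * ‖S.op a ^ n‖ := by
  refine S.norm_op_pow_le (norm_nonneg _) (by positivity) (S.pexp_V_le_norm a n) fun φ => ?_
  rw [← Real.exp_nat_mul, ← Real.exp_add]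
  refine Real.exp_le_exp.2 ?_
  have h1 := abs_partialSum_le S.F_mem n φ
  have h2 : (α.re - a) * partialSum F n φ ≤ |α.re - a| * n := by
    refine (le_abs_self _).trans ?_
    rw [abs_mul]
    exact mul_le_mul_of_nonneg_left h1 (abs_nonneg _)
  linarith

/-- Changing the real part of the parameter changes the weight by at most `e^{|Re α - a| n}`,
because `|S_n| ≤ n`; the imaginary part disappears with absolute values. The case `a = Re α` bounds
the spectral radius off the axis, real `α` gives continuity of `λ`. -/
lemma sr_op_le (α : ℂ) (a : ℝ) : sr (S.op α) ≤ Real.exp |α.re - a| * S.lam a := by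
  have he := Real.exp_pos |α.re - a|
  refine le_of_forall_gt_imp_ge_of_dense fun r hr => ?_
  have h1 : S.lam a < r / Real.exp |α.re - a| := by rwa [lt_div_iff₀ he, mul_comm]
  obtain ⟨C, hC, hb⟩ := exists_pow_norm_le h1
  have h0 : 0 < r / Real.exp |α.re - a| := (sr_nonneg _).trans_lt h1
  have hr0 : 0 < r := (div_pos_iff_of_pos_right he).1 h0
  refine sr_le_of_pow_norm_le (C := C) hr0.le fun n => ?_
  calc ‖S.op α ^ n‖ ≤ Real.exp |α.re - a| ^ n * ‖S.op a ^ n‖ :=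
        S.norm_op_pow_le_norm_op_pow α a n
    _ ≤ Real.exp |α.re - a| ^ n * (C * (r / Real.exp |α.re - a|) ^ n) := by gcongr; exact hb n
    _ = C * (Real.exp |α.re - a| * (r / Real.exp |α.re - a|)) ^ n := by rw [mul_pow]; ring
    _ = C * r ^ n := by rw [mul_div_cancel₀ _ he.ne']

lemma lam_le (a a' : ℝ) : S.lam a' ≤ Real.exp |a' - a| * S.lam a := by
  simpa [lam] using S.sr_op_le (a' : ℂ) a

lemma sr_op_le_lam (α : ℂ) : sr (S.op α) ≤ S.lam α.re := by
  simpa using S.sr_op_le α α.re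

lemma integral_pow_pi {g : X → ℝ} (hg : VBdd V g) (n : ℕ) :
    ∫ x, ∫ y, g y ∂((P ^ n) x) ∂π = ∫ x, g x ∂π := by
  have := S.pi_prob
  induction n with
  | zero => simp_rw [integral_pow_zero hg.1]
  | succ n ih =>
    simp_rw [S.integral_pow_succ' n hg]
    have hi := (S.vbdd_pow n hg).integrable S.pi_V
    rw [← ih]
    conv_rhs => rw [← S.pi_inv.def]
    rw [integral_bind_kernel (by rw [S.pi_inv.def]; exact hi)]

lemma vbdd_F : VBdd V F :=
  VBdd.of_bdd S.one_le_V S.F_meas (K := 1) fun x => by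
    rw [Real.norm_eq_abs]; exact abs_le.2 (S.F_mem x)

lemma integrable_partialSum (n : ℕ) (x : X) : Integrable (partialSum F n) (pathLaw P x) := by
  refine (integrable_const (n : ℝ)).mono' (measurable_partialSum S.F_meas n).aestronglyMeasurable
    (ae_of_all _ fun φ => ?_)
  rw [Real.norm_eq_abs]
  exact abs_partialSum_le S.F_mem n φ

lemma integral_partialSum (n : ℕ) (x : X) :
    ∫ φ, partialSum F n φ ∂(pathLaw P x) =
      ∑ i ∈ Finset.range n, ∫ y, F y ∂((P ^ i) x) := by
  unfold partialSum
  rw [integral_finsetSum]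
  · exact Finset.sum_congr rfl fun i _ =>
      S.integral_pathLaw_eval S.F_meas.stronglyMeasurable x i
  · intro i _
    refine (integrable_const (1 : ℝ)).mono'
      (S.F_meas.comp (measurable_pi_apply i)).aestronglyMeasurable (ae_of_all _ fun φ => ?_)
    rw [Real.norm_eq_abs]; exact abs_le.2 (S.F_mem _)

/-- `E_x[e^{aS_n}] ≥ 1 + a E_x[S_n]` is integrated against `π`, where the linear term vanishes
because `π(F) = 0`; the left side is at most `‖P̂_aⁿ‖ V(x)`. -/
lemma one_le_norm_op_pow_mul (a : ℝ) (n : ℕ) : 1 ≤ ‖S.op a ^ n‖ * ∫ x, V x ∂π := by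
  have := S.pi_prob
  have h1 : ∀ x, 1 + a * ∑ i ∈ Finset.range n, ∫ y, F y ∂((P ^ i) x) ≤
      ‖S.op a ^ n‖ * V x := by
    intro x
    have hi := S.integrable_pexp a n n S.vbdd_one x
    have h2 : ∫ φ, (1 + a * partialSum F n φ) ∂(pathLaw P x) ≤ S.pexp a n (fun _ => 1) x := by
      refine integral_mono ((integrable_const _).add ((S.integrable_partialSum n x).const_mul _))
        hi fun φ => ?_
      dsimp only
      rw [mul_one, add_comm]
      exact Real.add_one_le_exp _
    rw [integral_add (integrable_const _) ((S.integrable_partialSum n x).const_mul _),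
      integral_const_mul, S.integral_partialSum] at h2
    simp only [integral_const, probReal_univ, smul_eq_mul, mul_one] at h2
    refine h2.trans ((S.pexp_mono a n S.vbdd_one S.vbdd_V S.one_le_V x).trans ?_)
    exact S.pexp_V_le_norm a n x
  have hF : ∀ i, Integrable (fun x => ∫ y, F y ∂((P ^ i) x)) π := fun i =>
    (S.vbdd_pow i S.vbdd_F).integrable S.pi_V
  have hs : Integrable (fun x => ∑ i ∈ Finset.range n, ∫ y, F y ∂((P ^ i) x)) π :=
    integrable_finsetSum _ fun i _ => hF i
  have h2 := integral_mono ((integrable_const (1 : ℝ)).add (hs.const_mul a))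
    (S.pi_V.const_mul ‖S.op a ^ n‖) h1
  rw [integral_const_mul] at h2
  refine le_trans (le_of_eq ?_) h2
  have h3 := integral_add (integrable_const (1 : ℝ)) (hs.const_mul a)
  simp only [Pi.add_apply]
  rw [h3, integral_const_mul, integral_finsetSum _ fun i _ => hF i]
  simp [S.integral_pow_pi S.vbdd_F, S.F_mean]

/-- `λ_a ≥ 1`. -/
lemma one_le_lam (a : ℝ) : 1 ≤ S.lam a := by
  by_contra! h
  obtain ⟨ρ, h1, h2⟩ := exists_between h
  obtain ⟨C, hC, hb⟩ := exists_pow_norm_le h1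
  have hρ : 0 ≤ ρ := (sr_nonneg _).trans h1.le
  have hlim : Tendsto (fun n : ℕ => C * ρ ^ n * ∫ x, V x ∂π) atTop (𝓝 (C * 0 * ∫ x, V x ∂π)) :=
    ((tendsto_pow_atTop_nhds_zero_of_lt_one hρ h2).const_mul C).mul_const _
  rw [mul_zero, zero_mul] at hlim
  obtain ⟨n, hn⟩ := (hlim.eventually_lt_const one_pos).exists
  have h3 := S.one_le_norm_op_pow_mul a n
  have h4 := mul_le_mul_of_nonneg_right (hb n)
    (show 0 ≤ ∫ x, V x ∂π from integral_nonneg fun x => (S.V_pos x).le)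
  linarith

lemma lam_pos (a : ℝ) : 0 < S.lam a := zero_lt_one.trans_le (S.one_le_lam a)

lemma norm_op_zero_pow_le (n : ℕ) : ‖S.op 0 ^ n‖ ≤ 1 + n * b := by
  have hb := S.b_pos.le
  have h := S.norm_op_pow_le (α := 0) (a := 0) (n := n) (C := 1 + n * b) (K := 1) (by positivity)
    zero_le_one (fun x => ?_) (fun φ => by simp)
  · simpa using h
  · unfold pexp
    simp only [zero_mul, Real.exp_zero, one_mul]
    rw [S.integral_pathLaw_eval S.V_meas.stronglyMeasurable]
    refine (S.pow_V_le n x).trans ?_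
    have := mul_nonneg (n.cast_nonneg (α := ℝ)) hb
    nlinarith [S.one_le_V x]

/-- The upper bound holds because `‖Pⁿ‖ ≤ 1 + n b` grows more slowly than any `rⁿ` with `r > 1`. -/
lemma lam_zero : S.lam 0 = 1 := by
  refine le_antisymm ?_ (S.one_le_lam 0)
  have hb := S.b_pos
  refine le_of_forall_gt_imp_ge_of_dense fun r hr => ?_
  have h0 : (0 : ℝ) < r := one_pos.trans hr
  have hlim := tendsto_pow_const_div_const_pow_of_one_lt 1 hr
  obtain ⟨B, hB⟩ := hlim.bddAbove_range
  refine sr_le_of_pow_norm_le (C := 1 + B * b) h0.le fun n => ?_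
  have h1 := S.norm_op_zero_pow_le n
  have h2 : (n : ℝ) ≤ B * r ^ n := by
    have := hB ⟨n, rfl⟩
    dsimp only at this
    rwa [div_le_iff₀ (by positivity), pow_one] at this
  have h3 : (1 : ℝ) ≤ r ^ n := one_le_pow₀ hr.le
  have h4 := mul_le_mul_of_nonneg_right h2 hb.le
  rw [Complex.ofReal_zero]
  linarith

/-! ### Positivity of the resolvent -/

lemma hasSum_resolvent_apply {α w : ℂ} (hw : sr (S.op α) < ‖w‖) (g : S.E) (x : X) :
    HasSum (fun k : ℕ => (w⁻¹) ^ (k + 1) * (S.op α ^ k) g x) (_root_.resolvent (S.op α) w g x) := by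
  have h := hasSum_resolvent hw
  have h2 := ((ContinuousLinearMap.apply ℂ S.E g).hasSum h)
  exact (LV.eval (hV := S.one_le_V) x).hasSum h2

/-- `(w - P̂_a)⁻¹ g` for `g ≥ 0` and real `w > λ_a`. -/
def posRes (a w : ℝ) (g : X → ℝ) (x : X) : ℝ := ∑' k : ℕ, (w⁻¹) ^ (k + 1) * S.pexp a k g x

lemma hasSum_posRes {a w : ℝ} (hw : S.lam a < w) {g : X → ℝ} (hg : VBdd V g) (x : X) :
    HasSum (fun k : ℕ => (w⁻¹) ^ (k + 1) * S.pexp a k g x) (S.posRes a w g x) ∧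
      _root_.resolvent (S.op a) (w : ℂ) (S.real g hg) x = (S.posRes a w g x : ℂ) := by
  have hw0 : 0 < w := (S.lam_pos a).trans hw
  have h := S.hasSum_resolvent_apply (α := a) (w := w)
    (by rwa [Complex.norm_real, Real.norm_of_nonneg hw0.le]) (S.real g hg) x
  have h2 : HasSum (fun k : ℕ => (((w⁻¹) ^ (k + 1) * S.pexp a k g x : ℝ) : ℂ))
      (_root_.resolvent (S.op a) (w : ℂ) (S.real g hg) x) := by
    refine h.congr_fun fun k => ?_
    rw [S.op_pow_real a k hg]
    push_cast; rfl
  have h3 : Summable (fun k : ℕ => (w⁻¹) ^ (k + 1) * S.pexp a k g x) := by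
    have := h2.summable
    exact_mod_cast this
  refine ⟨h3.hasSum, ?_⟩
  have h4 : HasSum (fun k : ℕ => (((w⁻¹) ^ (k + 1) * S.pexp a k g x : ℝ) : ℂ))
      ((S.posRes a w g x : ℝ) : ℂ) := by exact_mod_cast h3.hasSum
  exact h2.unique h4

lemma posRes_nonneg {a w : ℝ} (hw : S.lam a < w) {g : X → ℝ} (hg0 : ∀ x, 0 ≤ g x) (x : X) :
    0 ≤ S.posRes a w g x := by
  have hw0 : 0 < w := (S.lam_pos a).trans hw
  exact tsum_nonneg fun k => mul_nonneg (by positivity) (S.pexp_nonneg a k hg0 x)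

lemma vbdd_posRes {a w : ℝ} (hw : S.lam a < w) {g : X → ℝ} (hg : VBdd V g) :
    VBdd V (S.posRes a w g) := by
  have h := (_root_.resolvent (S.op a) (w : ℂ) (S.real g hg)).vbdd.re
  have h2 : (fun x => ((_root_.resolvent (S.op a) (w : ℂ) (S.real g hg)) x).re) =
      S.posRes a w g := by
    ext x
    rw [(S.hasSum_posRes hw hg x).2, Complex.ofReal_re]
  rwa [h2] at h

/-- Termwise in the Neumann series, `|P̂_αᵏ g| ≤ ‖g‖ P̂_{Re α}ᵏ V`. So the resolvent at a complex
point is controlled by the resolvent of `V` at the positive real point `|w|`. -/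
lemma norm_resolvent_apply_le {α w : ℂ} (hw : S.lam α.re < ‖w‖) (g : S.E) (x : X) :
    ‖_root_.resolvent (S.op α) w g x‖ ≤ ‖g‖ * S.posRes α.re ‖w‖ V x := by
  have h1 := S.hasSum_resolvent_apply ((S.sr_op_le_lam α).trans_lt hw) g x
  have h2 := (S.hasSum_posRes hw S.vbdd_V x).1.mul_left ‖g‖
  refine h1.norm_le_of_bounded h2 fun k => ?_
  rw [norm_mul, norm_pow, norm_inv, mul_left_comm]
  refine mul_le_mul_of_nonneg_left ?_ (by positivity)
  refine (S.norm_op_pow_le_pexp α k g x).trans ?_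
  refine (S.pexp_mono _ k g.vbdd.norm (S.vbdd_V.const_mul ‖g‖) (fun y => g.norm_apply_le y)
    x).trans (le_of_eq ?_)
  unfold pexp
  rw [← integral_const_mul]
  refine integral_congr_ae (ae_of_all _ fun φ => ?_)
  dsimp only
  ring

end Setup

end MultErgodic

/-! ### Perron data and blow-up of the resolvent at `λ_a`. -/

namespace MultErgodic

variable {X : Type*} [MeasurableSpace X]

namespace Setup

variable {P : Kernel X X} [IsMarkovKernel P] {V F : X → ℝ} {π : Measure X} {δ b : ℝ}
    {s : X → ℝ} {ν : Measure X} (S : Setup P V F π δ b s ν)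

/-- Integration against `ν` as a functional on `L_∞^V`. -/
def nuL : S.E →L[ℂ] ℂ :=
  LinearMap.mkContinuous
    { toFun := fun g => ∫ y, g y ∂ν
      map_add' := fun g h => by
        simp only [LV.add_apply]
        exact integral_add (g.vbdd.integrable S.integrable_nu) (h.vbdd.integrable S.integrable_nu)
      map_smul' := fun c g => by
        simp only [LV.smul_apply, RingHom.id_apply, smul_eq_mul]
        exact integral_const_mul _ _ }
    (∫ y, V y ∂ν) (fun g => by
      have h := norm_integral_le_of_norm_le (S.integrable_nu.const_mul ‖g‖)
        (ae_of_all ν fun x => g.norm_apply_le x)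
      rw [integral_const_mul] at h
      rw [mul_comm]
      exact h)

lemma nuL_apply (g : S.E) : S.nuL g = ∫ y, g y ∂ν := rfl

/-- A positive eigenfunction `f` and a positive eigenfunctional `ℓ` of `P̂_a` for the spectral
radius `λ_a`. -/
structure Perron (a : ℝ) (f : X → ℝ) (ℓ : S.E →L[ℂ] ℂ) : Prop where
  gap : Real.exp |a| * qrate δ b < S.lam a
  vbdd : VBdd V f
  pos : ∀ x, 0 < f x
  eig : ∀ x, Real.exp (a * F x) * ∫ y, f y ∂(P x) = S.lam a * f x
  dual : ∀ g, ℓ (S.op a g) = S.lam a * ℓ g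
  real_im : ∀ (g : X → ℝ) (hg : VBdd V g), (ℓ (S.real g hg)).im = 0
  real_nonneg : ∀ (g : X → ℝ) (hg : VBdd V g), (∀ x, 0 ≤ g x) → 0 ≤ (ℓ (S.real g hg)).re
  apply_V : ℓ (S.real V S.vbdd_V) = 1

include S

lemma tendsto_scale (r : ℝ) : Tendsto (fun n : ℕ => (1 + 1 / ((n : ℝ) + 1)) * r) atTop (𝓝 r) := by
  have h := (tendsto_one_div_add_atTop_nhds_zero_nat (𝕜 := ℝ)).const_add 1
  have h2 := h.mul_const r
  rwa [add_zero, one_mul] at h2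

lemma lt_scale (a : ℝ) (n : ℕ) : S.lam a < (1 + 1 / ((n : ℝ) + 1)) * S.lam a := by
  have h := S.lam_pos a
  have : 0 < 1 / ((n : ℝ) + 1) := Nat.one_div_pos_of_nat
  nlinarith

/-- Some `z` in the spectrum has modulus `λ_a`, and the resolvent blows up along the ray towards it.
By positivity the resolvent of `V` at the real point of the same modulus dominates it, so it blows
up at `λ_a` even before `λ_a` is known to lie in the spectrum. -/
lemma norm_resolvent_V_ge (a : ℝ) (n : ℕ) :
    ((n : ℝ) + 1) / (2 * S.lam a) ≤ ‖_root_.resolvent (S.op a)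
      (((1 + 1 / ((n : ℝ) + 1)) * S.lam a : ℝ) : ℂ) (S.real V S.vbdd_V)‖ := by
  set w : ℝ := (1 + 1 / ((n : ℝ) + 1)) * S.lam a with hw
  have hl := S.lam_pos a
  have hlw : S.lam a < w := S.lt_scale a n
  have hc : 0 < 1 / ((n : ℝ) + 1) := Nat.one_div_pos_of_nat
  obtain ⟨z, hz, hzn⟩ := exists_mem_spectrum_norm_eq_sr (S.op a)
  set w' : ℂ := ((1 + 1 / ((n : ℝ) + 1) : ℝ) : ℂ) * z with hw'
  have hwn : ‖w'‖ = w := by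
    rw [hw', norm_mul, Complex.norm_real, Real.norm_of_nonneg (by positivity), hzn]; rfl
  have hns : w' ∉ spectrum ℂ (S.op a) := fun h => by
    have := norm_le_sr h
    rw [hwn] at this
    exact not_le.2 hlw this
  obtain ⟨y, hy0, hy⟩ := exists_resolvent_large hz hns
  set h := _root_.resolvent (S.op a) (w : ℂ) (S.real V S.vbdd_V) with hh
  have h1 : ‖_root_.resolvent (S.op a) w' y‖ ≤ ‖y‖ * ‖h‖ := by
    refine LV.norm_le (by positivity) fun x => ?_
    have h2 := S.norm_resolvent_apply_le (α := a) (w := w') (by rwa [hwn, Complex.ofReal_re]) y x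
    rw [hwn, Complex.ofReal_re] at h2
    refine h2.trans ?_
    rw [mul_assoc]
    refine mul_le_mul_of_nonneg_left ?_ (norm_nonneg _)
    have h3 := h.norm_apply_le x
    rw [hh, (S.hasSum_posRes hlw S.vbdd_V x).2, Complex.norm_real] at h3
    exact (le_abs_self _).trans h3
  have h4 : ‖w' - z‖ = 1 / ((n : ℝ) + 1) * S.lam a := by
    have : w' - z = ((1 / ((n : ℝ) + 1) : ℝ) : ℂ) * z := by rw [hw']; push_cast; ring
    rw [this, norm_mul, Complex.norm_real, Real.norm_of_nonneg hc.le, hzn]; rfl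
  have hy' : 0 < ‖y‖ := norm_pos_iff.2 hy0
  have h5 : ‖y‖ ≤ 2 * (1 / ((n : ℝ) + 1) * S.lam a) * (‖y‖ * ‖h‖) := by
    rw [h4] at hy
    exact hy.trans (mul_le_mul_of_nonneg_left h1 (by positivity))
  have h6 : 1 ≤ 2 * (1 / ((n : ℝ) + 1) * S.lam a) * ‖h‖ := by
    refine le_of_mul_le_mul_left ?_ hy'
    linarith
  rw [div_le_iff₀ (by positivity)]
  have h7 : (0 : ℝ) < (n : ℝ) + 1 := by positivity
  have h8 := mul_le_mul_of_nonneg_left h6 h7.le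
  have h9 : ((n : ℝ) + 1) * (2 * (1 / ((n : ℝ) + 1) * S.lam a) * ‖h‖) = ‖h‖ * (2 * S.lam a) := by
    field_simp
  linarith

lemma smul_sub_op_resolvent {α w : ℂ} (hw : S.lam α.re < ‖w‖) (g : S.E) :
    w • _root_.resolvent (S.op α) w g - S.op α (_root_.resolvent (S.op α) w g) = g := by
  have hu : IsUnit (algebraMap ℂ (S.E →L[ℂ] S.E) w - S.op α) :=
    isUnit_of_sr_lt ((S.sr_op_le_lam α).trans_lt hw)
  have h := congrArg (fun T : S.E →L[ℂ] S.E => T g) (Ring.mul_inverse_cancel _ hu)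
  simpa [_root_.resolvent, Algebra.algebraMap_eq_smul_one] using h

lemma resolvent_smul_sub_op {α w : ℂ} (hw : S.lam α.re < ‖w‖) (g : S.E) :
    _root_.resolvent (S.op α) w (w • g - S.op α g) = g := by
  have hu : IsUnit (algebraMap ℂ (S.E →L[ℂ] S.E) w - S.op α) :=
    isUnit_of_sr_lt ((S.sr_op_le_lam α).trans_lt hw)
  have h := congrArg (fun T : S.E →L[ℂ] S.E => T g) (Ring.inverse_mul_cancel _ hu)
  simpa [_root_.resolvent, Algebra.algebraMap_eq_smul_one] using h

/-- A nonnegative nonzero eigenfunction is strictly positive and `ν`-nondegenerate. -/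
lemma pos_of_eigen {a : ℝ} (ha : Real.exp |a| * qrate δ b < S.lam a) {f : X → ℝ} (hf : VBdd V f)
    (hf0 : ∀ x, 0 ≤ f x) (hne : ∃ x, f x ≠ 0)
    (heig : ∀ x, Real.exp (a * F x) * ∫ y, f y ∂(P x) = S.lam a * f x) :
    (∀ x, 0 < f x) ∧ 0 < ∫ y, f y ∂ν := by
  obtain ⟨C, -, hC⟩ := S.apriori ha
  have hν : 0 < ∫ y, f y ∂ν := by
    refine (integral_nonneg hf0).lt_of_ne fun h => ?_
    obtain ⟨x, hx⟩ := hne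
    have := hC f hf hf0 0 le_rfl (fun x => by rw [heig]; simp) x
    rw [← h] at this
    simp only [add_zero, mul_zero, zero_mul] at this
    exact hx (le_antisymm this (hf0 x))
  refine ⟨fun x => (hf0 x).lt_of_ne' fun hx => ?_, hν⟩
  -- At a zero of `f` the eigenvalue equation gives `P f = 0`, so the chain stays among the zeros;
  -- one zero would force `f = 0` `ν`-almost everywhere.
  have hY : IsAbsorbing P {x | f x = 0} := by
    refine ⟨hf.1 (measurableSet_singleton 0), fun y hy => ?_⟩
    have h1 := heig y
    rw [mem_ofPred_eq] at hy
    rw [hy, mul_zero, mul_eq_zero, or_iff_right (Real.exp_pos _).ne',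
      integral_eq_zero_iff_of_nonneg hf0 (hf.integrable (S.v4.integrable y))] at h1
    exact h1
  have h2 := IsAbsorbing.nu_compl S hY ⟨x, hx⟩
  have h3 : ∫ y, f y ∂ν = 0 := by
    refine integral_eq_zero_of_ae ?_
    exact h2
  exact hν.ne' h3

end Setup

end MultErgodic

/-! ### Existence of the positive eigenfunction and eigenfunctional. -/

namespace MultErgodic

variable {X : Type*} [MeasurableSpace X]

/-- Bounded sequences of functionals have weak-* limits along a free ultrafilter. -/
lemma exists_ultrafilter_limit {E : Type*} [NormedAddCommGroup E] [NormedSpace ℂ E]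
    (L : ℕ → E →L[ℂ] ℂ) (hL : ∀ n, ‖L n‖ ≤ 1) :
    ∃ ℓ : E →L[ℂ] ℂ, ∀ g, Tendsto (fun n => L n g) (hyperfilter ℕ : Filter ℕ) (𝓝 (ℓ g)) := by
  have hc := WeakDual.isCompact_closedBall (0 : StrongDual ℂ E) 1
  have hu : ∀ n, StrongDual.toWeakDual (L n) ∈
      (WeakDual.toStrongDual : WeakDual ℂ E → StrongDual ℂ E) ⁻¹' Metric.closedBall 0 1 := by
    intro n
    rw [mem_preimage, mem_closedBall_zero_iff]
    exact hL n
  obtain ⟨ℓ, -, hℓ⟩ := hc.ultrafilter_le_nhds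
    ((hyperfilter ℕ).map fun n => StrongDual.toWeakDual (L n)) (by
      rw [le_principal_iff, Ultrafilter.mem_coe, Ultrafilter.mem_map]
      exact univ_mem' hu)
  refine ⟨WeakDual.toStrongDual ℓ, fun g => ?_⟩
  exact ((WeakDual.eval_continuous g).tendsto ℓ).comp hℓ

namespace Setup

variable {P : Kernel X X} [IsMarkovKernel P] {V F : X → ℝ} {π : Measure X} {δ b : ℝ}
    {s : X → ℝ} {ν : Measure X} (S : Setup P V F π δ b s ν)

include S

/-- Existence of the eigenfunction, as a limit of normalised resolvents. -/
lemma exists_eigenfunction [MeasurableSpace.CountablyGenerated X] {a : ℝ}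
    (ha : Real.exp |a| * qrate δ b < S.lam a) :
    ∃ (f : X → ℝ) (hf : VBdd V f) (w c : ℕ → ℝ), (∀ x, 0 < f x) ∧ 0 < ∫ y, f y ∂ν ∧
      (∀ x, Real.exp (a * F x) * ∫ y, f y ∂(P x) = S.lam a * f x) ∧
      (∀ n, S.lam a < w n) ∧ Tendsto w atTop (𝓝 (S.lam a)) ∧ (∀ n, 0 < c n) ∧
      Tendsto c atTop (𝓝 0) ∧
      Tendsto (fun n => (c n : ℂ) • _root_.resolvent (S.op a) (w n : ℂ) (S.real V S.vbdd_V))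
        atTop (𝓝 (S.real f hf)) := by
  have hl := S.lam_pos a
  set w : ℕ → ℝ := fun n => (1 + 1 / ((n : ℝ) + 1)) * S.lam a with hw
  have hlw : ∀ n, S.lam a < w n := S.lt_scale a
  have hw0 : ∀ n, 0 < w n := fun n => hl.trans (hlw n)
  have hwlim : Tendsto w atTop (𝓝 (S.lam a)) := S.tendsto_scale _
  set H : ℕ → S.E := fun n => _root_.resolvent (S.op a) (w n : ℂ) (S.real V S.vbdd_V) with hH
  have hHn : ∀ n : ℕ, ((n : ℝ) + 1) / (2 * S.lam a) ≤ ‖H n‖ := S.norm_resolvent_V_ge a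
  have hH0 : ∀ n, 0 < ‖H n‖ := fun n => lt_of_lt_of_le (by positivity) (hHn n)
  set c : ℕ → ℝ := fun n => ‖H n‖⁻¹ with hc
  have hc0 : ∀ n, 0 < c n := fun n => inv_pos.2 (hH0 n)
  have hclim : Tendsto c atTop (𝓝 0) := by
    refine squeeze_zero (fun n => (hc0 n).le)
      (fun n => inv_anti₀ (by positivity) (hHn n)) ?_
    have h := (tendsto_one_div_add_atTop_nhds_zero_nat (𝕜 := ℝ)).mul_const (2 * S.lam a)
    rw [zero_mul] at h
    refine h.congr fun n => ?_
    rw [inv_div]; ring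
  set g : ℕ → S.E := fun n => (c n : ℂ) • H n with hg
  have hgn : ∀ n, ‖g n‖ = 1 := fun n => by
    rw [hg, norm_smul, Complex.norm_real, Real.norm_of_nonneg (hc0 n).le]
    exact inv_mul_cancel₀ (hH0 n).ne'
  have heq : ∀ n, (w n : ℂ) • H n - S.op a (H n) = S.real V S.vbdd_V := fun n =>
    S.smul_sub_op_resolvent (by rw [Complex.norm_real, Real.norm_of_nonneg (hw0 n).le]
                                exact hlw n) _
  -- The residual is `(λ - w n) g n + c n V`, and both terms vanish because `w n → λ` and the norms
  -- of the resolvents blow up.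
  have happ : Tendsto (fun n => (S.lam a : ℂ) • g n - S.op a (g n)) atTop (𝓝 0) := by
    have h1 : ∀ n, (S.lam a : ℂ) • g n - S.op a (g n) =
        ((S.lam a - w n : ℝ) : ℂ) • g n + (c n : ℂ) • S.real V S.vbdd_V := by
      intro n
      rw [← heq n, hg]
      simp only [map_smul, smul_sub, smul_smul, Complex.ofReal_sub, sub_mul, sub_smul]
      rw [mul_comm (c n : ℂ) (w n)]
      abel
    simp_rw [h1]
    have h2 : Tendsto (fun n => ((S.lam a - w n : ℝ) : ℂ) • g n) atTop (𝓝 0) := by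
      rw [tendsto_zero_iff_norm_tendsto_zero]
      have h3 := (tendsto_const_nhds (x := S.lam a)).sub hwlim
      rw [sub_self] at h3
      refine (tendsto_norm_zero.comp h3).congr fun n => ?_
      rw [norm_smul, hgn, mul_one, Complex.norm_real]; rfl
    have h4 : Tendsto (fun n => (c n : ℂ) • S.real V S.vbdd_V) atTop (𝓝 0) := by
      have h5 := ((Complex.continuous_ofReal.tendsto 0).comp hclim).smul_const
        (S.real V S.vbdd_V)
      rw [Complex.ofReal_zero, zero_smul] at h5
      exact h5
    simpa using h2.add h4
  obtain ⟨φ, hφ, g₀, hg₀, he⟩ := S.exists_subseq_tendsto (α := a) (z := S.lam a)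
    (by rwa [Complex.norm_real, Real.norm_of_nonneg hl.le, Complex.ofReal_re])
    (fun n => (hgn n).le) happ
  have hgx : ∀ n x, g n x = ((c n * S.posRes a (w n) V x : ℝ) : ℂ) := by
    intro n x
    rw [hg, LV.smul_apply, hH, (S.hasSum_posRes (hlw n) S.vbdd_V x).2, Complex.ofReal_mul]
  have hev : ∀ x, Tendsto (fun n => g (φ n) x) atTop (𝓝 (g₀ x)) := fun x =>
    ((LV.eval (hV := S.one_le_V) x).continuous.tendsto g₀).comp hg₀
  have him : ∀ x, (g₀ x).im = 0 := fun x => by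
    refine tendsto_nhds_unique ((Complex.continuous_im.tendsto _).comp (hev x)) ?_
    refine tendsto_const_nhds.congr fun n => ?_
    rw [Function.comp_apply, hgx, Complex.ofReal_im]
  have hre : ∀ x, 0 ≤ (g₀ x).re := fun x => by
    refine ge_of_tendsto' ((Complex.continuous_re.tendsto _).comp (hev x)) fun n => ?_
    rw [Function.comp_apply, hgx, Complex.ofReal_re]
    exact mul_nonneg (hc0 _).le (S.posRes_nonneg (hlw _) (fun y => (S.V_pos y).le) x)
  have hf : VBdd V (fun x => (g₀ x).re) := g₀.vbdd.re
  have hfg : S.real _ hf = g₀ := LV.ext fun x => by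
    rw [S.real_apply]
    exact Complex.ext (by simp) (by simp [him x])
  have heig : ∀ x, Real.exp (a * F x) * ∫ y, (g₀ y).re ∂(P x) = S.lam a * (g₀ x).re := by
    intro x
    have h1 : S.op a g₀ x = ((S.lam a : ℂ) • g₀) x := by rw [he]
    rw [← hfg, S.op_real_apply, LV.smul_apply, S.real_apply, ← Complex.ofReal_mul,
      Complex.ofReal_inj] at h1
    exact h1
  have hn1 : ‖g₀‖ = 1 := by
    refine tendsto_nhds_unique ((continuous_norm.tendsto _).comp hg₀) ?_
    refine tendsto_const_nhds.congr fun n => ?_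
    simp only [Function.comp_apply, hgn]
  have hne : ∃ x, (g₀ x).re ≠ 0 := by
    by_contra! h
    have : g₀ = 0 := LV.ext fun x => Complex.ext (by simpa using h x) (by simpa using him x)
    rw [this, norm_zero] at hn1
    exact zero_ne_one hn1
  obtain ⟨hp, hν⟩ := S.pos_of_eigen ha hf hre hne heig
  refine ⟨_, hf, w ∘ φ, c ∘ φ, hp, hν, heig, fun n => hlw _, hwlim.comp hφ.tendsto_atTop,
    fun n => hc0 _, hclim.comp hφ.tendsto_atTop, ?_⟩
  rw [hfg]
  exact hg₀

lemma nuL_real {g : X → ℝ} (hg : VBdd V g) : S.nuL (S.real g hg) = ((∫ y, g y ∂ν : ℝ) : ℂ) := by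
  rw [nuL_apply]
  exact integral_ofReal

lemma resolvent_real {a w : ℝ} (hw : S.lam a < w) {g : X → ℝ} (hg : VBdd V g) :
    _root_.resolvent (S.op a) (w : ℂ) (S.real g hg) =
      S.real (S.posRes a w g) (S.vbdd_posRes hw hg) :=
  LV.ext fun x => (S.hasSum_posRes hw hg x).2

/-- The functional is a weak-* limit of `L_n g = ν((w_n - P̂_a)⁻¹ g) / m_n`, with `m_n` chosen so
that `L_n V = 1`. Positivity gives `‖L_n‖ ≤ 1`. Since `c_n → 0` while `c_n m_n → ν(f) > 0`, also
`1/m_n → 0`, and this makes the limit an exact eigenfunctional. -/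
theorem exists_perron [MeasurableSpace.CountablyGenerated X] {a : ℝ}
    (ha : Real.exp |a| * qrate δ b < S.lam a) : ∃ f ℓ, S.Perron a f ℓ := by
  obtain ⟨f, hf, w, c, hpos, hν, heig, hlw, hwlim, hc0, hclim, hlim⟩ := S.exists_eigenfunction ha
  have hl := S.lam_pos a
  have hw0 : ∀ n, 0 < w n := fun n => hl.trans (hlw n)
  set H : ℕ → X → ℝ := fun n => S.posRes a (w n) V with hH
  have hHv : ∀ n, VBdd V (H n) := fun n => S.vbdd_posRes (hlw n) S.vbdd_V
  have hHn : ∀ n, _root_.resolvent (S.op a) (w n : ℂ) (S.real V S.vbdd_V) = S.real (H n) (hHv n) :=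
    fun n => S.resolvent_real (hlw n) S.vbdd_V
  set m : ℕ → ℝ := fun n => ∫ y, H n y ∂ν with hm
  have hH0 : ∀ n x, 0 ≤ H n x := fun n => S.posRes_nonneg (hlw n) fun y => (S.V_pos y).le
  have hm0 : ∀ n, 0 ≤ m n := fun n => integral_nonneg (hH0 n)
  have hcm : Tendsto (fun n => c n * m n) atTop (𝓝 (∫ y, f y ∂ν)) := by
    have h1 := (S.nuL.continuous.tendsto _).comp hlim
    rw [S.nuL_real] at h1
    have h2 := (Complex.continuous_re.tendsto _).comp h1
    rw [Complex.ofReal_re] at h2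
    refine h2.congr fun n => ?_
    simp only [Function.comp_apply, map_smul, hHn, S.nuL_real, smul_eq_mul]
    rw [← Complex.ofReal_mul, Complex.ofReal_re]
  have hminv : Tendsto (fun n => (m n)⁻¹) atTop (𝓝 0) := by
    have h1 := hclim.div hcm hν.ne'
    rw [zero_div] at h1
    refine h1.congr fun n => ?_
    rw [Pi.div_apply, div_mul_eq_div_div, div_self (hc0 n).ne', one_div]
  have hmpos : ∀ᶠ n in atTop, 0 < m n := by
    filter_upwards [hcm.eventually_const_lt hν] with n hn
    exact (pos_iff_pos_of_mul_pos hn).1 (hc0 n)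
  set L : ℕ → S.E →L[ℂ] ℂ := fun n =>
    (((m n)⁻¹ : ℝ) : ℂ) • S.nuL.comp (_root_.resolvent (S.op a) (w n : ℂ)) with hL
  have hLreal : ∀ n (g : X → ℝ) (hg : VBdd V g),
      L n (S.real g hg) = (((m n)⁻¹ * ∫ y, S.posRes a (w n) g y ∂ν : ℝ) : ℂ) := by
    intro n g hg
    rw [hL]
    simp only [_root_.smul_apply, ContinuousLinearMap.comp_apply, smul_eq_mul]
    rw [S.resolvent_real (hlw n) hg, S.nuL_real, ← Complex.ofReal_mul]
  have hL1 : ∀ n, ‖L n‖ ≤ 1 := by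
    intro n
    refine ContinuousLinearMap.opNorm_le_bound _ zero_le_one fun g => ?_
    have h1 : ‖S.nuL (_root_.resolvent (S.op a) (w n : ℂ) g)‖ ≤ ‖g‖ * m n := by
      rw [nuL_apply]
      refine (norm_integral_le_of_norm_le
        (((hHv n).integrable S.integrable_nu).const_mul ‖g‖) (ae_of_all _ fun x => ?_)).trans
        (le_of_eq (integral_const_mul _ _))
      have h2 := S.norm_resolvent_apply_le (α := a) (w := w n)
        (by rw [Complex.norm_real, Real.norm_of_nonneg (hw0 n).le]; exact hlw n) g x
      rwa [Complex.norm_real, Real.norm_of_nonneg (hw0 n).le] at h2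
    rw [hL]
    simp only [_root_.smul_apply, ContinuousLinearMap.comp_apply]
    rw [norm_smul, Complex.norm_real, Real.norm_of_nonneg (inv_nonneg.2 (hm0 n)), one_mul]
    refine (mul_le_mul_of_nonneg_left h1 (inv_nonneg.2 (hm0 n))).trans ?_
    rcases (hm0 n).eq_or_lt with h0 | h0
    · rw [← h0]; simp
    · rw [mul_comm, mul_assoc, mul_inv_cancel₀ h0.ne', mul_one]
  obtain ⟨ℓ, hℓ⟩ := exists_ultrafilter_limit L hL1
  have hle : (hyperfilter ℕ : Filter ℕ) ≤ atTop := by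
    rw [← Nat.cofinite_eq_atTop]; exact hyperfilter_le_cofinite
  refine ⟨f, ℓ, ha, hf, hpos, heig, fun g => ?_, fun g hg => ?_, fun g hg h0 => ?_, ?_⟩
  · have h1 : ∀ n, L n (S.op a g) = w n * L n g - (((m n)⁻¹ : ℝ) : ℂ) * S.nuL g := by
      intro n
      have h2 := S.resolvent_smul_sub_op (α := a) (w := w n)
        (by rw [Complex.norm_real, Real.norm_of_nonneg (hw0 n).le]; exact hlw n) g
      have h3 : L n ((w n : ℂ) • g - S.op a g) = (((m n)⁻¹ : ℝ) : ℂ) * S.nuL g := by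
        rw [hL]
        simp only [_root_.smul_apply, ContinuousLinearMap.comp_apply, smul_eq_mul]
        rw [h2]
      rw [map_sub, map_smul, smul_eq_mul] at h3
      rw [← h3]; ring
    have h2 := ((((Complex.continuous_ofReal.tendsto _).comp hwlim).mono_left hle).mul (hℓ g)).sub
      ((((Complex.continuous_ofReal.tendsto _).comp hminv).mono_left hle).mul_const (S.nuL g))
    rw [Complex.ofReal_zero, zero_mul, sub_zero] at h2
    refine tendsto_nhds_unique (hℓ _) (h2.congr fun n => ?_)
    rw [h1]; rfl
  · refine tendsto_nhds_unique ((Complex.continuous_im.tendsto _).comp (hℓ _)) ?_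
    refine tendsto_const_nhds.congr fun n => ?_
    rw [Function.comp_apply, hLreal, Complex.ofReal_im]
  · refine ge_of_tendsto' ((Complex.continuous_re.tendsto _).comp (hℓ _)) fun n => ?_
    rw [Function.comp_apply, hLreal, Complex.ofReal_re]
    exact mul_nonneg (inv_nonneg.2 (hm0 n)) (integral_nonneg (S.posRes_nonneg (hlw n) h0))
  · refine tendsto_nhds_unique (hℓ _) (tendsto_const_nhds.congr' ?_)
    filter_upwards [hle hmpos] with n hn
    rw [hLreal]
    have : (m n)⁻¹ * ∫ y, S.posRes a (w n) V y ∂ν = 1 := inv_mul_cancel₀ (ne_of_gt hn)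
    rw [this, Complex.ofReal_one]

end Setup

end MultErgodic

/-! ### Faithfulness of the eigenfunctional and rigidity of subsolutions. -/

namespace MultErgodic

variable {X : Type*} [MeasurableSpace X]

lemma IsAbsorbing.inter {P : Kernel X X} {Y Z : Set X} (hY : IsAbsorbing P Y)
    (hZ : IsAbsorbing P Z) : IsAbsorbing P (Y ∩ Z) := by
  refine ⟨hY.1.inter hZ.1, fun x hx => ?_⟩
  rw [compl_inter]
  exact measure_union_null (hY.2 x hx.1) (hZ.2 x hx.2)

lemma measure_inter_compl_eq_zero {μ : Measure X} {Y Z : Set X} (hY : μ Yᶜ = 0) (hZ : μ Zᶜ = 0) :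
    μ (Y ∩ Z)ᶜ = 0 := by
  rw [compl_inter]
  exact measure_union_null hY hZ

namespace Setup

variable {P : Kernel X X} [IsMarkovKernel P] {V F : X → ℝ} {π : Measure X} {δ b : ℝ}
    {s : X → ℝ} {ν : Measure X} (S : Setup P V F π δ b s ν)

include S

lemma real_sub {g h : X → ℝ} (hg : VBdd V g) (hh : VBdd V h) :
    S.real _ (hg.sub hh) = S.real g hg - S.real h hh := LV.ext fun x => by simp

lemma real_const_mul (c : ℝ) {g : X → ℝ} (hg : VBdd V g) :
    S.real _ (hg.const_mul c) = (c : ℂ) • S.real g hg :=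
  LV.ext fun x => by rw [LV.smul_apply]; simp

/-- `R g = (e - 1) (e - P)⁻¹ g`. -/
lemma res_eq_resolvent {g : X → ℝ} (hg : VBdd V g) :
    S.real _ (S.vbdd_res hg) = ((Real.exp 1 - 1 : ℝ) : ℂ) •
      _root_.resolvent (S.op 0) ((Real.exp 1 : ℝ) : ℂ) (S.real g hg) := by
  have he : S.lam (0 : ℂ).re < ‖((Real.exp 1 : ℝ) : ℂ)‖ := by
    rw [Complex.norm_real, Real.norm_of_nonneg (Real.exp_pos 1).le, Complex.zero_re, S.lam_zero]
    exact Real.one_lt_exp_iff.2 one_pos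
  rw [← map_smul, ← S.resolvent_smul_sub_op he (S.real _ (S.vbdd_res hg))]
  congr 1
  refine LV.ext fun x => ?_
  have h1 := S.exp_mul_res' hg x
  have h2 : S.op 0 (S.real _ (S.vbdd_res hg)) x =
      ((∫ y, ∫ z, g z ∂(resKernel P y) ∂(P x) : ℝ) : ℂ) := by
    have := S.op_real_apply 0 (S.vbdd_res hg) x
    rw [Complex.ofReal_zero] at this
    rw [this, zero_mul, Real.exp_zero, one_mul]
  rw [LV.sub_apply, h2, LV.smul_apply, LV.smul_apply, S.real_apply, S.real_apply,
    ← Complex.ofReal_mul, ← Complex.ofReal_mul, h1]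
  push_cast
  ring

/-- An eigenfunction outside the essential spectral radius is determined by its values
`ν`-a.e. -/
lemma eq_zero_of_ae_nu {α z : ℂ} (hz : Real.exp |α.re| * qrate δ b < ‖z‖) {g : S.E}
    (hg : S.op α g = z • g) (h0 : ∫ y, ‖g y‖ ∂ν = 0) : g = 0 := by
  obtain ⟨C, -, hC⟩ := S.apriori hz
  refine LV.ext fun x => ?_
  have h1 := hC (fun y => ‖g y‖) g.vbdd.norm (fun y => norm_nonneg _) 0 le_rfl (fun y => ?_) x
  · rw [h0] at h1
    simpa using h1
  · have h2 := S.norm_op_apply_le α g y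
    rw [hg, LV.smul_apply, norm_mul] at h2
    simpa using h2

/-- The zeros in an absorbing set of a function which is a nonnegative eigenfunction there. -/
lemma isAbsorbing_inter_zero {a r : ℝ} {Z : Set X} (hZ : IsAbsorbing P Z) {u : X → ℝ}
    (hu : VBdd V u) (hu0 : ∀ x ∈ Z, 0 ≤ u x)
    (heig : ∀ x ∈ Z, Real.exp (a * F x) * ∫ y, u y ∂(P x) = r * u x) :
    IsAbsorbing P (Z ∩ {x | u x = 0}) := by
  refine ⟨hZ.1.inter (hu.1 (measurableSet_singleton 0)), fun x hx => ?_⟩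
  rw [compl_inter]
  refine measure_union_null (hZ.2 x hx.1) ?_
  have h1 := heig x hx.1
  have hx2 : u x = 0 := hx.2
  have hnn : 0 ≤ᵐ[P x] u := by
    have : ∀ᵐ y ∂(P x), y ∈ Z := hZ.2 x hx.1
    filter_upwards [this] with y hy using hu0 y hy
  rw [hx2, mul_zero, mul_eq_zero, or_iff_right (Real.exp_pos _).ne',
    integral_eq_zero_iff_of_nonneg_ae hnn (hu.integrable (S.v4.integrable x))] at h1
  exact h1

namespace Perron

variable {S} {a : ℝ} {f : X → ℝ} {ℓ : S.E →L[ℂ] ℂ} (H : S.Perron a f ℓ)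

include H

lemma eq_re {g : X → ℝ} (hg : VBdd V g) : ℓ (S.real g hg) = ((ℓ (S.real g hg)).re : ℂ) :=
  Complex.ext rfl (by rw [H.real_im g hg, Complex.ofReal_im])

lemma mono {g h : X → ℝ} (hg : VBdd V g) (hh : VBdd V h) (hgh : ∀ x, g x ≤ h x) :
    (ℓ (S.real g hg)).re ≤ (ℓ (S.real h hh)).re := by
  have h1 := H.real_nonneg _ (hh.sub hg) fun x => sub_nonneg.2 (hgh x)
  rw [S.real_sub hh hg, map_sub, Complex.sub_re] at h1
  linarith

lemma const_mul_re (c : ℝ) {g : X → ℝ} (hg : VBdd V g) :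
    (ℓ (S.real _ (hg.const_mul c))).re = c * (ℓ (S.real g hg)).re := by
  rw [S.real_const_mul, map_smul, smul_eq_mul, Complex.re_ofReal_mul]

lemma op_re {g : X → ℝ} (hg : VBdd V g) :
    (ℓ (S.real _ (S.vbdd_real a hg))).re = S.lam a * (ℓ (S.real g hg)).re := by
  rw [← S.op_real, H.dual, Complex.re_ofReal_mul]

/-- `ℓ` is an eigenfunctional of `P̂_a`, but drift and minorization concern `P`; replacing `e^{aF}`
by `e^{±|a|}` passes from one to the other at the cost of a constant. -/
lemma P_re_le {g : X → ℝ} (hg : VBdd V g) (h0 : ∀ x, 0 ≤ g x) :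
    (ℓ (S.real _ (S.vbdd_P hg))).re ≤ Real.exp |a| * (S.lam a * (ℓ (S.real g hg)).re) := by
  rw [← H.op_re hg, ← H.const_mul_re]
  refine H.mono _ _ fun x => ?_
  have h1 : 0 ≤ ∫ y, g y ∂(P x) := integral_nonneg h0
  have h2 := mul_le_mul_of_nonneg_left (exp_neg_abs_le (a := a) (S.F_mem x))
    (Real.exp_pos |a|).le
  rw [← Real.exp_add, add_neg_cancel, Real.exp_zero] at h2
  rw [← mul_assoc]
  exact le_mul_of_one_le_left h1 h2

lemma lam_mul_le_P_re {g : X → ℝ} (hg : VBdd V g) (h0 : ∀ x, 0 ≤ g x) :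
    S.lam a * (ℓ (S.real g hg)).re ≤ Real.exp |a| * (ℓ (S.real _ (S.vbdd_P hg))).re := by
  rw [← H.op_re hg, ← H.const_mul_re]
  refine H.mono _ _ fun x => ?_
  exact mul_le_mul_of_nonneg_right (exp_mul_le_exp_abs (S.F_mem x)) (integral_nonneg h0)

lemma pow_eq_zero {g : X → ℝ} (hg : VBdd V g) (h0 : ∀ x, 0 ≤ g x) (h : ℓ (S.real g hg) = 0)
    (n : ℕ) : ℓ ((S.op 0 ^ n) (S.real g hg)) = 0 := by
  induction n generalizing g with
  | zero => simpa using h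
  | succ n ih =>
    have h1 : S.op 0 (S.real g hg) = S.real _ (S.vbdd_P hg) := LV.ext fun x => by
      have := S.op_real_apply 0 hg x
      rw [Complex.ofReal_zero] at this
      rw [this, zero_mul, Real.exp_zero, one_mul, S.real_apply]
    rw [pow_succ, mul_apply_eq_comp, h1]
    refine ih (S.vbdd_P hg) (fun x => integral_nonneg h0) ?_
    rw [H.eq_re]
    have h2 := H.P_re_le hg h0
    rw [h, Complex.zero_re, mul_zero, mul_zero] at h2
    rw [le_antisymm h2 (H.real_nonneg _ _ fun x => integral_nonneg h0), Complex.ofReal_zero]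

/-- `ℓ` is only a functional, not a measure, so it cannot be exchanged with `∑ Pⁿ g` by monotone
convergence. The series for `R` converges in operator norm because `P` has spectral radius `1 < e`.
-/
lemma res_eq_zero {g : X → ℝ} (hg : VBdd V g) (h0 : ∀ x, 0 ≤ g x) (h : ℓ (S.real g hg) = 0) :
    ℓ (S.real _ (S.vbdd_res hg)) = 0 := by
  have he : sr (S.op 0) < ‖((Real.exp 1 : ℝ) : ℂ)‖ := by
    refine (S.sr_op_le_lam 0).trans_lt ?_
    rw [Complex.norm_real, Real.norm_of_nonneg (Real.exp_pos 1).le, Complex.zero_re, S.lam_zero]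
    exact Real.one_lt_exp_iff.2 one_pos
  rw [S.res_eq_resolvent hg, map_smul]
  have h1 := ℓ.hasSum ((ContinuousLinearMap.apply ℂ S.E (S.real g hg)).hasSum
    (hasSum_resolvent he))
  have h2 : ∀ k : ℕ, ℓ ((ContinuousLinearMap.apply ℂ S.E (S.real g hg))
      ((((Real.exp 1 : ℝ) : ℂ)⁻¹) ^ (k + 1) • S.op 0 ^ k)) = 0 := fun k => by
    rw [map_smul, map_smul, ContinuousLinearMap.apply_apply, H.pow_eq_zero hg h0 h, smul_zero]
  simp only [h2] at h1
  rw [ContinuousLinearMap.apply_apply] at h1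
  rw [h1.unique hasSum_zero, smul_zero]

/-- If `ℓ(s) = 0`, the drift of `W` loses its correction term and gives `(e-1+η) ℓ(RW) ≤ (e-1)
ℓ(W)`. With `e RW = (e-1) W + P(RW)` this becomes `ℓ(P(RW)) ≤ q ℓ(RW)`, while `λ ℓ(RW) ≤ e^{|a|}
ℓ(P(RW))`; together they contradict `e^{|a|} q < λ`. -/
lemma s_pos : 0 < (ℓ (S.real s S.vbdd_s)).re := by
  refine (H.real_nonneg _ _ fun x => (S.v4.s_pos x).le).lt_of_ne' fun hs => ?_
  have he := exp_one_sub_one_pos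
  have hη := S.etaRate_pos
  obtain ⟨c, hc, hcW⟩ := S.exists_V_le_W
  have hW := S.vbdd_W
  have hRW := S.vbdd_res hW
  have hW0 : ∀ x, 0 ≤ Wfun V s δ b x := fun x => (S.W_pos x).le
  have hRW0 : ∀ x, 0 ≤ ∫ y, Wfun V s δ b y ∂(resKernel P x) := fun x => integral_nonneg hW0
  set ℓW := (ℓ (S.real _ hW)).re with hℓW
  set ℓG := (ℓ (S.real _ hRW)).re with hℓG
  have h1 : 0 < ℓW := by
    have := H.mono (S.vbdd_V.const_mul c) hW hcW
    rw [H.const_mul_re _ S.vbdd_V, H.apply_V, Complex.one_re, mul_one] at this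
    exact hc.trans_le this
  have h2 : ℓG ≤ (Real.exp 1 - 1) / (Real.exp 1 - 1 + etaRate δ b) * ℓW := by
    have h3 := H.mono (hRW.sub (S.vbdd_s.const_mul (∫ y, Wfun V s δ b y ∂ν)))
      (hW.const_mul ((Real.exp 1 - 1) / (Real.exp 1 - 1 + etaRate δ b)))
      (fun x => by rw [mul_comm _ (s x)]; exact S.res_W_sub_le x)
    rwa [S.real_sub hRW (S.vbdd_s.const_mul _), map_sub, Complex.sub_re,
      H.const_mul_re _ S.vbdd_s, H.const_mul_re _ hW, hs, mul_zero,
      sub_zero] at h3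
  have h3 : Real.exp 1 * ℓG = (Real.exp 1 - 1) * ℓW + (ℓ (S.real _ (S.vbdd_P hRW))).re := by
    have h4 : S.real _ (hRW.const_mul (Real.exp 1)) =
        S.real _ (hW.const_mul (Real.exp 1 - 1)) + S.real _ (S.vbdd_P hRW) :=
      LV.ext fun x => by
        rw [LV.add_apply, S.real_apply, S.real_apply, S.real_apply, ← Complex.ofReal_add,
          S.exp_mul_res' hW x]
    have h5 := congrArg (fun g => (ℓ g).re) h4
    simp only [map_add, Complex.add_re] at h5
    rwa [H.const_mul_re _ hRW, H.const_mul_re _ hW] at h5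
  have h4 := H.lam_mul_le_P_re hRW hRW0
  have h5 : 0 < Real.exp 1 - 1 + etaRate δ b := by positivity
  have h6 : (Real.exp 1 - 1 + etaRate δ b) * ℓG ≤ (Real.exp 1 - 1) * ℓW := by
    rw [div_mul_eq_mul_div, le_div_iff₀ h5] at h2
    linarith
  have hG0 : 0 ≤ (ℓ (S.real _ (S.vbdd_P hRW))).re :=
    H.real_nonneg _ _ fun x => integral_nonneg hRW0
  have hG : 0 < ℓG := by
    have : 0 < Real.exp 1 * ℓG := by
      rw [h3]; exact add_pos_of_pos_of_nonneg (mul_pos he h1) hG0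
    exact (pos_iff_pos_of_mul_pos this).1 (Real.exp_pos 1)
  have h7 : (ℓ (S.real _ (S.vbdd_P hRW))).re ≤ qrate δ b * ℓG := by
    have := mul_le_mul_of_nonneg_right (one_sub_etaRate_le (δ := δ) (b := b)) hG.le
    linarith
  have h8 : S.lam a * ℓG ≤ Real.exp |a| * qrate δ b * ℓG := by
    rw [mul_assoc]
    exact h4.trans (mul_le_mul_of_nonneg_left h7 (Real.exp_pos _).le)
  exact not_lt.2 (le_of_mul_le_mul_right h8 hG) H.gap

/-- `R g ≥ ν(g) s`, the functional `ℓ` vanishes on `R g`, and `ℓ(s) > 0`. So `ℓ` detects every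
nonnegative function that is not `ν`-null. -/
lemma nu_eq_zero {g : X → ℝ} (hg : VBdd V g) (h0 : ∀ x, 0 ≤ g x) (h : ℓ (S.real g hg) = 0) :
    ∫ y, g y ∂ν = 0 := by
  have h1 := H.mono (S.vbdd_s.const_mul (∫ y, g y ∂ν)) (S.vbdd_res hg)
    (fun x => by rw [mul_comm]; exact S.s_mul_nu_le_res hg h0 x)
  rw [H.const_mul_re _ S.vbdd_s, H.res_eq_zero hg h0 h, Complex.zero_re] at h1
  have h2 := H.s_pos
  exact le_antisymm (nonpos_of_mul_nonpos_left h1 h2) (integral_nonneg h0)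

lemma nu_f_pos : 0 < ∫ y, f y ∂ν := by
  have := S.v4.nu_prob
  rw [integral_pos_iff_support_of_nonneg (fun x => (H.pos x).le) (H.vbdd.integrable S.integrable_nu)]
  have : Function.support f = univ := eq_univ_of_forall fun x => (H.pos x).ne'
  rw [this]
  simp

lemma f_pos : 0 < (ℓ (S.real f H.vbdd)).re := by
  refine (H.real_nonneg _ _ fun x => (H.pos x).le).lt_of_ne' fun h => ?_
  exact H.nu_f_pos.ne' (H.nu_eq_zero H.vbdd (fun x => (H.pos x).le)
    (by rw [H.eq_re, h, Complex.ofReal_zero]))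

/-- A nonnegative subsolution is a solution on an absorbing set. -/
lemma exists_absorbing_of_subsolution {w : X → ℝ} (hw : VBdd V w)
    (h : ∀ x, S.lam a * w x ≤ Real.exp (a * F x) * ∫ y, w y ∂(P x)) :
    ∃ Y, IsAbsorbing P Y ∧ ν Yᶜ = 0 ∧
      ∀ x ∈ Y, Real.exp (a * F x) * ∫ y, w y ∂(P x) = S.lam a * w x := by
  have hv := (S.vbdd_real a hw).sub (hw.const_mul (S.lam a))
  set v : X → ℝ := fun x => Real.exp (a * F x) * ∫ y, w y ∂(P x) - S.lam a * w x with hvd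
  have hv0 : ∀ x, 0 ≤ v x := fun x => sub_nonneg.2 (h x)
  -- The nonnegative defect `v` is killed by `ℓ`, hence so is `R v`, hence `R v = 0` `ν`-almost
  -- everywhere: from `ν`-almost every point the chain never meets `{v ≠ 0}`, and the points with
  -- this property form an absorbing set.
  have hℓ : ℓ (S.real v hv) = 0 := by
    rw [H.eq_re, S.real_sub (S.vbdd_real a hw) (hw.const_mul _), map_sub, Complex.sub_re,
      H.op_re hw, H.const_mul_re _ hw, sub_self,
      Complex.ofReal_zero]
  have hA : MeasurableSet {x | v x ≠ 0} := (hv.1 (measurableSet_singleton 0)).compl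
  have h1 := H.nu_eq_zero (S.vbdd_res hv) (fun x => integral_nonneg hv0)
    (H.res_eq_zero hv hv0 hℓ)
  rw [integral_eq_zero_iff_of_nonneg (fun x => integral_nonneg hv0)
    ((S.vbdd_res hv).integrable S.integrable_nu)] at h1
  refine ⟨_, isAbsorbing_res_zero (P := P) hA, ?_, fun x hx => ?_⟩
  · change ∀ᵐ x ∂ν, resKernel P x {x | v x ≠ 0} = 0
    filter_upwards [h1] with x hx
    have hx' : ∫ y, v y ∂(resKernel P x) = 0 := hx
    rw [integral_eq_zero_iff_of_nonneg hv0 (hv.integrable (S.integrable_res x))] at hx'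
    exact hx'
  · have h2 := (res_zero_iff_aux hA hx).1
    have h3 : v x = 0 := by simpa using h2
    exact sub_eq_zero.1 h3

end Perron

end Setup

end MultErgodic

/-! ### Eigenvalues on the spectral circle. -/

namespace MultErgodic

variable {X : Type*} [MeasurableSpace X]

/-- Equality in the triangle inequality for integrals. -/
lemma ae_eq_of_integral_eq_norm {μ : Measure X} {g : X → ℂ} (hg : Integrable g μ) {ζ : ℂ}
    (hζ : ‖ζ‖ = 1) (h : ∫ y, g y ∂μ = ζ * ((∫ y, ‖g y‖ ∂μ : ℝ) : ℂ)) :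
    ∀ᵐ y ∂μ, g y = ζ * (‖g y‖ : ℂ) := by
  set k : ℂ := (starRingEnd ℂ) ζ with hk
  have hkζ : k * ζ = 1 := by
    rw [hk, mul_comm, Complex.mul_conj, Complex.normSq_eq_norm_sq, hζ]; simp
  have hkn : ‖k‖ = 1 := by rw [hk, RCLike.norm_conj, hζ]
  have hkre : Integrable (fun y => (k * g y).re) μ := (hg.const_mul k).re
  have hle : ∀ y, (k * g y).re ≤ ‖g y‖ := fun y =>
    (Complex.re_le_norm _).trans (by rw [norm_mul, hkn, one_mul])
  have h1 : ∫ y, (k * g y).re ∂μ = ∫ y, ‖g y‖ ∂μ := by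
    have h2 : ∫ y, k * g y ∂μ = ((∫ y, ‖g y‖ ∂μ : ℝ) : ℂ) := by
      rw [integral_const_mul, h, ← mul_assoc, hkζ, one_mul]
    have h3 := integral_re (hg.const_mul k)
    rw [RCLike.re_eq_complex_re] at h3
    rw [h3, h2, Complex.ofReal_re]
  have h2 : ∀ᵐ y ∂μ, (k * g y).re = ‖g y‖ := by
    have h3 : ∫ y, (‖g y‖ - (k * g y).re) ∂μ = 0 := by
      rw [integral_sub hg.norm hkre, sub_eq_zero]
      exact h1.symm
    rw [integral_eq_zero_iff_of_nonneg (fun y => sub_nonneg.2 (hle y))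
      (hg.norm.sub hkre)] at h3
    filter_upwards [h3] with y hy
    have : ‖g y‖ - (k * g y).re = 0 := hy
    linarith
  filter_upwards [h2] with y hy
  have hn : ‖k * g y‖ = (k * g y).re := by rw [norm_mul, hkn, one_mul, hy]
  have h3 : k * g y = ((k * g y).re : ℂ) := by
    have h4 := Complex.re_eq_norm.1 hn.symm
    rw [Complex.nonneg_iff] at h4
    exact Complex.ext rfl (by rw [Complex.ofReal_im]; exact h4.2.symm)
  rw [← hy, ← h3, ← mul_assoc, mul_comm ζ k, hkζ, one_mul]

namespace Setup

variable {P : Kernel X X} [IsMarkovKernel P] {V F : X → ℝ} {π : Measure X} {δ b : ℝ}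
    {s : X → ℝ} {ν : Measure X} (S : Setup P V F π δ b s ν)

include S

lemma nonempty_of_nu_compl {Y : Set X} (h : ν Yᶜ = 0) : Y.Nonempty := by
  have := S.v4.nu_prob
  by_contra hne
  rw [not_nonempty_iff_eq_empty] at hne
  rw [hne, compl_empty, measure_univ] at h
  exact one_ne_zero h

namespace Perron

variable {S} {f : X → ℝ} {ℓ : S.E →L[ℂ] ℂ} {α z : ℂ} (H : S.Perron α.re f ℓ)

include H

/-- The modulus of an eigenfunction for an eigenvalue on the spectral circle. -/
lemma exists_modulus_eq (hz : ‖z‖ = S.lam α.re) {g : S.E} (hg0 : g ≠ 0) (hg : S.op α g = z • g) :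
    ∃ c, 0 < c ∧ ∃ Y, IsAbsorbing P Y ∧ ν Yᶜ = 0 ∧ ∀ x ∈ Y, ‖g x‖ = c * f x := by
  have hl := S.lam_pos α.re
  have hgν : 0 < ∫ y, ‖g y‖ ∂ν := by
    refine (integral_nonneg fun y => norm_nonneg _).lt_of_ne' fun h => ?_
    exact hg0 (S.eq_zero_of_ae_nu (by rw [hz]; exact H.gap) hg h)
  have hgi := g.vbdd.norm.integrable S.integrable_nu
  have hfi := H.vbdd.integrable S.integrable_nu
  -- With this `c` the functions `c f` and `|g|` have the same `ν`-integral, so neither can exceed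
  -- the other `ν`-almost everywhere.
  set c := (∫ y, ‖g y‖ ∂ν) / ∫ y, f y ∂ν with hc
  have hc0 : 0 < c := div_pos hgν H.nu_f_pos
  have hcν : ∫ y, (c * f y - ‖g y‖) ∂ν = 0 := by
    rw [integral_sub (hfi.const_mul c) hgi, integral_const_mul, hc,
      div_mul_cancel₀ _ H.nu_f_pos.ne', sub_self]
  have hsub : ∀ x, S.lam α.re * ‖g x‖ ≤ Real.exp (α.re * F x) * ∫ y, ‖g y‖ ∂(P x) := by
    intro x
    have h1 := S.norm_op_apply_le α g x
    rwa [hg, LV.smul_apply, norm_mul, hz] at h1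
  have hcf := H.vbdd.const_mul c
  have hu := hcf.sub g.vbdd.norm
  -- The positive part of the subsolution `|g| - c f` is again a subsolution, so it is a solution on
  -- an absorbing set and its zeros there are absorbing. If there were none, `|g| > c f` would hold
  -- `ν`-almost everywhere. On the zeros `c f - |g|` is a nonnegative solution of zero `ν`-integral.
  have hw : VBdd V fun x => max (‖g x‖ - c * f x) 0 :=
    (g.vbdd.norm.sub hcf).norm.of_le ((g.vbdd.norm.sub hcf).1.max measurable_const) fun x => by
      rw [Real.norm_of_nonneg (le_max_right _ _), Real.norm_eq_abs]
      exact max_le (le_abs_self _) (abs_nonneg _)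
  have hueig : ∀ x, Real.exp (α.re * F x) * ∫ y, (c * f y - ‖g y‖) ∂(P x) =
      S.lam α.re * (c * f x) - Real.exp (α.re * F x) * ∫ y, ‖g y‖ ∂(P x) := by
    intro x
    have hi := S.v4.integrable x
    rw [integral_sub (hcf.integrable hi) (g.vbdd.norm.integrable hi), integral_const_mul, mul_sub,
      mul_left_comm, H.eig]
    ring
  obtain ⟨Y₁, hY₁, hν₁, he₁⟩ := H.exists_absorbing_of_subsolution g.vbdd.norm hsub
  obtain ⟨Y₂, hY₂, hν₂, he₂⟩ := H.exists_absorbing_of_subsolution hw fun x => by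
    rw [mul_max_of_nonneg _ _ hl.le, mul_zero]
    have hi := S.v4.integrable x
    have hE := (Real.exp_pos (α.re * F x)).le
    refine max_le ?_ (mul_nonneg hE (integral_nonneg fun y => le_max_right _ _))
    have h1 : ∫ y, -(c * f y - ‖g y‖) ∂(P x) ≤ ∫ y, max (‖g y‖ - c * f y) 0 ∂(P x) :=
      integral_mono (hu.integrable hi).neg (hw.integrable hi) fun y => by
        dsimp only
        rw [neg_sub]
        exact le_max_left _ _
    have h2 := mul_le_mul_of_nonneg_left h1 hE
    rw [integral_neg, mul_neg, hueig] at h2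
    linarith [hsub x]
  have hY := hY₁.inter hY₂
  have hνY := measure_inter_compl_eq_zero hν₁ hν₂
  have hZ := S.isAbsorbing_inter_zero hY hw (fun x _ => le_max_right _ _) fun x hx => he₂ x hx.2
  have hne : ((Y₁ ∩ Y₂) ∩ {x | max (‖g x‖ - c * f x) 0 = 0}).Nonempty := by
    by_contra hempty
    rw [not_nonempty_iff_eq_empty, eq_empty_iff_forall_notMem] at hempty
    have hpos : ∀ᵐ x ∂ν, c * f x - ‖g x‖ < 0 := by
      have : ∀ᵐ x ∂ν, x ∈ Y₁ ∩ Y₂ := hνY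
      filter_upwards [this] with x hx
      by_contra! h
      exact hempty x ⟨hx, max_eq_right (by linarith)⟩
    have h0 : (fun x => -(c * f x - ‖g x‖)) =ᵐ[ν] 0 := by
      rw [← integral_eq_zero_iff_of_nonneg_ae (hpos.mono fun x hx => (neg_pos.2 hx).le)
        (hu.integrable S.integrable_nu).neg, integral_neg, hcν, neg_zero]
    have := S.v4.nu_prob
    obtain ⟨x, hx1, hx2⟩ := (hpos.and h0).exists
    exact hx1.ne (neg_eq_zero.1 hx2)
  have hνZ := IsAbsorbing.nu_compl S hZ hne
  have hnn : ∀ x ∈ (Y₁ ∩ Y₂) ∩ {x | max (‖g x‖ - c * f x) 0 = 0}, 0 ≤ c * f x - ‖g x‖ := by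
    intro x hx
    have := max_eq_right_iff.1 hx.2
    linarith
  refine ⟨c, hc0, _, S.isAbsorbing_inter_zero (a := α.re) (r := S.lam α.re) hZ hu hnn
    fun x hx => ?_, measure_inter_compl_eq_zero hνZ ?_, fun x hx => (sub_eq_zero.1 hx.2).symm⟩
  · rw [hueig, he₁ x hx.1.1]; ring
  · rw [integral_eq_zero_iff_of_nonneg_ae (by
      have : ∀ᵐ x ∂ν, x ∈ (Y₁ ∩ Y₂) ∩ {x | max (‖g x‖ - c * f x) 0 = 0} := hνZ
      filter_upwards [this] with x hx using hnn x hx) (hu.integrable S.integrable_nu)] at hcν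
    exact hcν

/-- The phase of an eigenfunction for an eigenvalue on the spectral circle. -/
lemma exists_phase (hz : ‖z‖ = S.lam α.re) {g : S.E} (hg0 : g ≠ 0) (hg : S.op α g = z • g) :
    ∃ c, 0 < c ∧ ∃ Y, IsAbsorbing P Y ∧ ν Yᶜ = 0 ∧ (∀ x ∈ Y, ‖g x‖ = c * f x) ∧
      ∀ x ∈ Y, ∀ᵐ y ∂(P x), y ∈ Y ∧ g y / ‖g y‖ =
        z / S.lam α.re * Complex.exp (-(α.im * F x * Complex.I)) * (g x / ‖g x‖) := by
  obtain ⟨c, hc, Y, hY, hν, hgf⟩ := H.exists_modulus_eq hz hg0 hg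
  refine ⟨c, hc, Y, hY, hν, hgf, fun x hx => ?_⟩
  have hl := S.lam_pos α.re
  have hi := S.v4.integrable x
  have hae : ∀ᵐ y ∂(P x), y ∈ Y := hY.2 x hx
  have hgx : 0 < ‖g x‖ := by rw [hgf x hx]; exact mul_pos hc (H.pos x)
  -- The eigenvalue equation for `g` divided by the one for `|g| = c f` gives `P g (x) = ζ P|g| (x)`
  -- with `|ζ| = 1`: equality in the triangle inequality, so `g` has constant phase `ζ` under `P(x,
  -- ·)`.
  set ζ : ℂ := z / S.lam α.re * Complex.exp (-(α.im * F x * Complex.I)) * (g x / ‖g x‖) with hζ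
  have hζ1 : ‖ζ‖ = 1 := by
    have h1 : ‖Complex.exp (-(α.im * F x * Complex.I))‖ = 1 := by
      have : -(α.im * F x * Complex.I) = ((-(α.im * F x) : ℝ) : ℂ) * Complex.I := by
        push_cast; ring
      rw [this, Complex.norm_exp_ofReal_mul_I]
    rw [hζ, norm_mul, norm_mul, norm_div, norm_div, hz, h1, Complex.norm_real, Complex.norm_real,
      Real.norm_of_nonneg hl.le, Real.norm_of_nonneg hgx.le, div_self hl.ne', div_self hgx.ne',
      one_mul, one_mul]
  have h1 : ∫ y, ‖g y‖ ∂(P x) = Real.exp (-(α.re * F x)) * (S.lam α.re * ‖g x‖) := by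
    have h2 : ∫ y, ‖g y‖ ∂(P x) = ∫ y, c * f y ∂(P x) :=
      integral_congr_ae (hae.mono fun y hy => hgf y hy)
    rw [h2, integral_const_mul, hgf x hx, mul_left_comm (S.lam α.re), ← H.eig x,
      mul_left_comm (Real.exp _) c, ← mul_assoc (Real.exp _), ← Real.exp_add, neg_add_cancel,
      Real.exp_zero, one_mul]
  have h2 : ∫ y, g y ∂(P x) = ζ * ((∫ y, ‖g y‖ ∂(P x) : ℝ) : ℂ) := by
    have h3 : Complex.exp (α * F x) * ∫ y, g y ∂(P x) = z * g x := by
      rw [← S.op_apply, hg, LV.smul_apply]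
    have h4 : ∫ y, g y ∂(P x) = Complex.exp (-(α * F x)) * (z * g x) := by
      rw [← h3, ← mul_assoc, ← Complex.exp_add, neg_add_cancel, Complex.exp_zero, one_mul]
    have h5 : Complex.exp (-(α * F x)) = Complex.exp (-(α.im * F x * Complex.I)) *
        ((Real.exp (-(α.re * F x)) : ℝ) : ℂ) := by
      rw [Complex.ofReal_exp, ← Complex.exp_add]
      congr 1
      conv_lhs => rw [← Complex.re_add_im α]
      push_cast
      ring
    have hl' : (S.lam α.re : ℂ) ≠ 0 := by exact_mod_cast hl.ne'
    have hg' : (‖g x‖ : ℂ) ≠ 0 := by exact_mod_cast hgx.ne'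
    rw [h4, h5, h1, hζ]
    push_cast
    field_simp
  filter_upwards [hae, ae_eq_of_integral_eq_norm (g.vbdd.integrable hi) hζ1 h2] with y hy h3
  refine ⟨hy, ?_⟩
  have hgy : (‖g y‖ : ℂ) ≠ 0 := by
    rw [hgf y hy]
    exact_mod_cast (mul_pos hc (H.pos y)).ne'
  conv_lhs => rw [h3]
  have h4 : ‖ζ * (‖g y‖ : ℂ)‖ = ‖g y‖ := by
    rw [norm_mul, hζ1, one_mul, Complex.norm_real, norm_norm]
  rw [h4, mul_div_assoc, div_self hgy, mul_one]

end Perron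

/-- Aperiodicity excludes nontrivial unimodular eigenvalues of `P`. -/
lemma unimodular_eq_one {Y : Set X} (hY : IsAbsorbing P Y) (hν : ν Yᶜ = 0) {u : X → ℂ}
    (hu : Measurable u) {ζ : ℂ} (hu1 : ∀ x ∈ Y, ‖u x‖ = 1)
    (h : ∀ x ∈ Y, ∀ᵐ y ∂(P x), u y = ζ * u x) :
    ζ = 1 ∧ ∃ k : ℂ, ∀ x ∈ Y, u x = k := by
  have hprob := S.v4.nu_prob
  have hn : ∀ n x, x ∈ Y → ∀ᵐ y ∂((P ^ n) x), u y = ζ ^ n * u x := by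
    intro n
    induction n with
    | zero =>
      intro x _
      change ∀ᵐ y ∂(Kernel.id x), _
      rw [Kernel.id_apply, ae_dirac_iff (measurableSet_eq_fun hu measurable_const)]
      simp
    | succ n ih =>
      intro x hx
      rw [Kernel.pow_add, pow_one, Kernel.comp_apply]
      have hms : MeasurableSet {y | u y = ζ ^ (n + 1) * u x} :=
        measurableSet_eq_fun hu measurable_const
      rw [ae_iff, ← compl_ofPred, Measure.bind_apply hms.compl (P ^ n).measurable.aemeasurable,
        lintegral_eq_zero_iff ((P ^ n).measurable_coe hms.compl)]
      have hae : ∀ᵐ y ∂(P x), y ∈ Y := hY.2 x hx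
      filter_upwards [hae, h x hx] with y hy hxy
      have := ih y hy
      rw [hxy, ← mul_assoc, ← pow_succ] at this
      exact this
  have hmap : (ν.map u) univ ≠ 0 := by
    rw [Measure.map_apply hu MeasurableSet.univ, preimage_univ, measure_univ]; exact one_ne_zero
  -- `k` lies in the support of the law of `u` under `ν`. By aperiodicity `Pⁿ(x, ·)` charges each
  -- `{u ∈ ball k ε}` for all large `n`, whereas `u = ζⁿ u(x)` almost surely there; so `ζⁿ u(x) →
  -- k`, which forces `ζ = 1` and then `u(x) = k`.
  obtain ⟨k, -, hk⟩ := exists_mem_forall_mem_nhdsWithin_pos_measure hmap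
  rw [nhdsWithin_univ] at hk
  have hlim : ∀ x ∈ Y, Tendsto (fun n => ζ ^ n * u x) atTop (𝓝 k) := by
    intro x hx
    rw [Metric.tendsto_nhds]
    intro ε hε
    have h1 := hk _ (Metric.ball_mem_nhds k hε)
    rw [Measure.map_apply hu Metric.isOpen_ball.measurableSet] at h1
    filter_upwards [S.aperiodic _ (hu Metric.isOpen_ball.measurableSet) h1 x] with n hpos
    have h2 : ∃ᵐ y ∂((P ^ n) x), u y ∈ Metric.ball k ε := by
      rw [frequently_ae_iff]
      exact hpos.ne'
    obtain ⟨y, hy1, hy2⟩ := (h2.and_eventually (hn n x hx)).exists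
    rw [hy2] at hy1
    exact hy1
  obtain ⟨x₀, hx₀⟩ := S.nonempty_of_nu_compl hν
  have hζ1 : ‖ζ‖ = 1 := by
    have hae : ∀ᵐ y ∂(P x₀), y ∈ Y := hY.2 x₀ hx₀
    obtain ⟨y, hy1, hy2⟩ := (hae.and (h x₀ hx₀)).exists
    have := congrArg norm hy2
    rw [norm_mul, hu1 y hy1, hu1 x₀ hx₀, mul_one] at this
    exact this.symm
  have hk1 : ‖k‖ = 1 := by
    refine tendsto_nhds_unique (hlim x₀ hx₀).norm (tendsto_const_nhds.congr fun n => ?_)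
    rw [norm_mul, norm_pow, hζ1, one_pow, one_mul, hu1 x₀ hx₀]
  have hζ : ζ = 1 := by
    have h1 := (hlim x₀ hx₀).comp (tendsto_add_atTop_nat 1)
    have h2 := (hlim x₀ hx₀).const_mul ζ
    have h3 : ζ * k = k := tendsto_nhds_unique h2 (h1.congr fun n => by
      simp only [Function.comp_apply, pow_succ]; ring)
    have hk0 : k ≠ 0 := norm_ne_zero_iff.1 (by rw [hk1]; exact one_ne_zero)
    exact mul_right_cancel₀ hk0 (by rw [h3, one_mul])
  refine ⟨hζ, k, fun x hx => tendsto_nhds_unique ?_ (hlim x hx)⟩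
  simp [hζ]

namespace Perron

variable {S} {a : ℝ} {f : X → ℝ} {ℓ : S.E →L[ℂ] ℂ} (H : S.Perron a f ℓ)

include H

lemma op_f : S.op a (S.real f H.vbdd) = (S.lam a : ℂ) • S.real f H.vbdd := LV.ext fun x => by
  rw [S.op_real_apply, H.eig, LV.smul_apply, S.real_apply, Complex.ofReal_mul]

/-- `λ_a` is the only eigenvalue of `P̂_a` on the spectral circle, and it is simple. -/
lemma eigenvalue_unique {z : ℂ} (hz : ‖z‖ = S.lam a) {g : S.E} (hg0 : g ≠ 0)
    (hg : S.op a g = z • g) : z = S.lam a ∧ ∃ k : ℂ, g = k • S.real f H.vbdd := by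
  have hl := S.lam_pos a
  have hl' : (S.lam a : ℂ) ≠ 0 := by exact_mod_cast hl.ne'
  obtain ⟨c, hc, Y, hY, hν, hgf, hph⟩ := Perron.exists_phase (α := (a : ℂ)) (by simpa using H)
    (by simpa using hz) hg0 hg
  simp only [Complex.ofReal_im, Complex.ofReal_zero, zero_mul, neg_zero, Complex.exp_zero, mul_one,
    Complex.ofReal_re] at hph
  have hgx : ∀ x ∈ Y, (‖g x‖ : ℂ) ≠ 0 := fun x hx => by
    rw [hgf x hx]
    exact_mod_cast (mul_pos hc (H.pos x)).ne'
  obtain ⟨h1, k, hk⟩ := S.unimodular_eq_one hY hν (u := fun x => g x / ‖g x‖)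
    (g.vbdd.1.div (Complex.measurable_ofReal.comp g.vbdd.1.norm))
    (fun x hx => by
      rw [norm_div, Complex.norm_real, norm_norm]
      exact div_self (by simpa using hgx x hx))
    (fun x hx => (hph x hx).mono fun y hy => hy.2)
  have hzl : z = S.lam a := by rwa [div_eq_one_iff_eq hl'] at h1
  refine ⟨hzl, k * c, ?_⟩
  rw [← sub_eq_zero]
  refine S.eq_zero_of_ae_nu (α := a) (z := S.lam a) ?_ ?_ ?_
  · rw [Complex.norm_real, Real.norm_of_nonneg hl.le, Complex.ofReal_re]; exact H.gap
  · rw [map_sub, map_smul, hg, H.op_f, hzl, smul_sub, smul_comm]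
  · refine integral_eq_zero_of_ae ?_
    have : ∀ᵐ x ∂ν, x ∈ Y := hν
    filter_upwards [this] with x hx
    have h2 := hk x hx
    rw [div_eq_iff (hgx x hx), hgf x hx] at h2
    rw [LV.sub_apply, LV.smul_apply, S.real_apply, h2]
    simp [mul_assoc]

end Perron

end Setup

end MultErgodic

/-! ### Spectral projection, spectral gap and the principal eigenvalue. -/

namespace MultErgodic

variable {X : Type*} [MeasurableSpace X]

namespace Setup

variable {P : Kernel X X} [IsMarkovKernel P] {V F : X → ℝ} {π : Measure X} {δ b : ℝ}
    {s : X → ℝ} {ν : Measure X} (S : Setup P V F π δ b s ν)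

/-- The spectral projection `g ↦ (ℓ g / ℓ f) f`. -/
def specProj (f : X → ℝ) (hf : VBdd V f) (ℓ : S.E →L[ℂ] ℂ) : S.E →L[ℂ] S.E :=
  ((ℓ (S.real f hf))⁻¹ • ℓ).smulRight (S.real f hf)

include S

lemma specProj_apply (f : X → ℝ) (hf : VBdd V f) (ℓ : S.E →L[ℂ] ℂ) (g : S.E) :
    S.specProj f hf ℓ g = ((ℓ (S.real f hf))⁻¹ * ℓ g) • S.real f hf := rfl

lemma hasBoundedInverse_of_isUnit {α z : ℂ} (h : IsUnit (algebraMap ℂ (S.E →L[ℂ] S.E) z - S.op α)) :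
    HasBoundedInverse P V F α z := by
  obtain ⟨u, hu⟩ := h
  set B : S.E →L[ℂ] S.E := ↑(u⁻¹) with hB
  have h1 : ∀ g : S.E, z • B g - S.op α (B g) = g := fun g => by
    have := congrArg (fun T : S.E →L[ℂ] S.E => T g) u.mul_inv
    rw [hu] at this
    simpa [Algebra.algebraMap_eq_smul_one] using this
  have h2 : ∀ g : S.E, B (z • g - S.op α g) = g := fun g => by
    have := congrArg (fun T : S.E →L[ℂ] S.E => T g) u.inv_mul
    rw [hu] at this
    simpa [Algebra.algebraMap_eq_smul_one] using this
  refine ⟨‖B‖, fun k hk => ?_⟩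
  rw [memLV_iff S.one_le_V] at hk
  set K : S.E := LV.mk S.one_le_V k hk with hK
  refine ⟨B K, ⟨(memLV_iff S.one_le_V).2 (B K).vbdd, fun x => ?_⟩, ?_, fun g' hg' he => ?_⟩
  · have := congrArg (LV.eval (hV := S.one_le_V) x) (h1 K)
    exact this
  · rw [← LV.norm_eq]
    refine (B.le_opNorm K).trans (le_of_eq ?_)
    rw [LV.norm_eq K]
    rfl
  · rw [memLV_iff S.one_le_V] at hg'
    set G : S.E := LV.mk S.one_le_V g' hg' with hG
    have h3 : z • G - S.op α G = K := LV.ext fun x => he x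
    rw [← h3, h2]
    rfl

namespace Perron

variable {S} {a : ℝ} {f : X → ℝ} {ℓ : S.E →L[ℂ] ℂ} (H : S.Perron a f ℓ)

include H

lemma ℓ_f_ne_zero : ℓ (S.real f H.vbdd) ≠ 0 := by
  intro h
  have := H.f_pos
  rw [h, Complex.zero_re] at this
  exact lt_irrefl _ this

lemma real_f_ne_zero : S.real f H.vbdd ≠ 0 := fun h =>
  H.ℓ_f_ne_zero (by rw [h, map_zero])

lemma lam_ne_zero : (S.lam a : ℂ) ≠ 0 := by exact_mod_cast (S.lam_pos a).ne'

lemma op_mul_proj : S.op a * S.specProj f H.vbdd ℓ = (S.lam a : ℂ) • S.specProj f H.vbdd ℓ := by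
  ext1 g
  rw [mul_apply_eq_comp, specProj_apply, map_smul, H.op_f, _root_.smul_apply, specProj_apply,
    smul_comm]

lemma proj_mul_op : S.specProj f H.vbdd ℓ * S.op a = (S.lam a : ℂ) • S.specProj f H.vbdd ℓ := by
  ext1 g
  rw [mul_apply_eq_comp, specProj_apply, H.dual, _root_.smul_apply, specProj_apply, smul_smul]
  congr 1
  ring

lemma proj_mul_proj :
    S.specProj f H.vbdd ℓ * S.specProj f H.vbdd ℓ = S.specProj f H.vbdd ℓ := by
  ext1 g
  rw [mul_apply_eq_comp, specProj_apply, specProj_apply, map_smul, smul_eq_mul]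
  congr 1
  have := H.ℓ_f_ne_zero
  field_simp

/-- The part of `P̂_a` complementary to the Perron eigenvector. -/
def rest (H : S.Perron a f ℓ) : S.E →L[ℂ] S.E := S.op a - (S.lam a : ℂ) • S.specProj f H.vbdd ℓ

lemma rest_mul_proj : H.rest * S.specProj f H.vbdd ℓ = 0 := by
  rw [rest, sub_mul, H.op_mul_proj, smul_mul_assoc, H.proj_mul_proj, sub_self]

lemma proj_mul_rest : S.specProj f H.vbdd ℓ * H.rest = 0 := by
  rw [rest, mul_sub, H.proj_mul_op, mul_smul_comm, H.proj_mul_proj, sub_self]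

lemma op_eq : S.op a = H.rest + (S.lam a : ℂ) • S.specProj f H.vbdd ℓ := by
  rw [rest, sub_add_cancel]

lemma op_pow (n : ℕ) : S.op a ^ (n + 1) =
    H.rest ^ (n + 1) + (S.lam a : ℂ) ^ (n + 1) • S.specProj f H.vbdd ℓ := by
  induction n with
  | zero => simpa using H.op_eq
  | succ n ih =>
    rw [pow_succ', ih, mul_add, mul_smul_comm, H.op_mul_proj, smul_smul, ← pow_succ]
    congr 1
    conv_lhs => rw [H.op_eq]
    rw [add_mul, ← pow_succ', pow_succ' H.rest n, smul_mul_assoc, ← mul_assoc, H.proj_mul_rest,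
      zero_mul, smul_zero, add_zero]

/-- The spectral gap. -/
theorem sr_rest_lt [MeasurableSpace.CountablyGenerated X] : sr H.rest < S.lam a := by
  by_contra! hcon
  have hl := S.lam_pos a
  obtain ⟨z, hz, hzn⟩ := exists_mem_spectrum_norm_eq_sr H.rest
  have hz0 : z ≠ 0 := norm_ne_zero_iff.1 (by rw [hzn]; exact (hl.trans_le hcon).ne')
  obtain ⟨g, hg1, hg⟩ := exists_approx_eigenvector hz hz0 hzn
  rw [← tendsto_zero_iff_norm_tendsto_zero] at hg
  -- As `ℓ` vanishes on the range of `rest`, it tends to zero along the `g n`, which are therefore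
  -- approximate eigenvectors of `P̂_a` too. Their limit is an eigenvector on the spectral circle
  -- with `ℓ = 0`, but such eigenvectors are multiples of `f`.
  have hℓrest : ∀ g, ℓ (H.rest g) = 0 := fun g => by
    have h1 := H.ℓ_f_ne_zero
    rw [rest, _root_.sub_apply, map_sub, H.dual, _root_.smul_apply, specProj_apply, map_smul,
      map_smul, smul_eq_mul, smul_eq_mul]
    field_simp
    ring
  have hℓg : Tendsto (fun n => ℓ (g n)) atTop (𝓝 0) := by
    have h1 := (ℓ.continuous.tendsto 0).comp hg
    have h2 := h1.const_mul z⁻¹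
    rw [map_zero, mul_zero] at h2
    refine h2.congr fun n => ?_
    rw [Function.comp_apply, map_sub, hℓrest, sub_zero, map_smul, smul_eq_mul,
      inv_mul_cancel_left₀ hz0]
  have happ : Tendsto (fun n => z • g n - S.op a (g n)) atTop (𝓝 0) := by
    have h1 : Tendsto (fun n => (S.lam a : ℂ) • S.specProj f H.vbdd ℓ (g n)) atTop (𝓝 0) := by
      have h2 := ((hℓg.const_mul (ℓ (S.real f H.vbdd))⁻¹).smul_const (S.real f H.vbdd)).const_smul
        (S.lam a : ℂ)
      rw [mul_zero, zero_smul, smul_zero] at h2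
      exact h2
    have h2 := hg.sub h1
    rw [sub_zero] at h2
    refine h2.congr fun n => ?_
    rw [H.op_eq, _root_.add_apply, _root_.smul_apply]
    abel
  obtain ⟨φ, hφ, g₀, hg₀, he⟩ := S.exists_subseq_tendsto (α := a) (z := z)
    (by rw [hzn, Complex.ofReal_re]; exact H.gap.trans_le hcon) (fun n => (hg1 n).le) happ
  have hn1 : ‖g₀‖ = 1 := by
    refine tendsto_nhds_unique ((continuous_norm.tendsto _).comp hg₀) ?_
    refine tendsto_const_nhds.congr fun n => ?_
    simp only [Function.comp_apply, hg1]
  have hg0 : g₀ ≠ 0 := norm_ne_zero_iff.1 (by rw [hn1]; exact one_ne_zero)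
  have hℓ0 : ℓ g₀ = 0 :=
    tendsto_nhds_unique ((ℓ.continuous.tendsto _).comp hg₀) (hℓg.comp hφ.tendsto_atTop)
  have hzs : z ∈ spectrum ℂ (S.op a) := by
    intro hu
    obtain ⟨u, hu⟩ := hu
    have h1 := congrArg (fun T : S.E →L[ℂ] S.E => T g₀) u.inv_mul
    rw [hu] at h1
    simp only [mul_apply_eq_comp, _root_.sub_apply, Algebra.algebraMap_eq_smul_one,
      _root_.smul_apply, one_apply_eq_self, he, sub_self, map_zero] at h1
    exact hg0 h1.symm
  have hzl : ‖z‖ = S.lam a := le_antisymm (norm_le_sr hzs) (by rwa [hzn])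
  obtain ⟨-, k, hk⟩ := H.eigenvalue_unique hzl hg0 he
  rw [hk, map_smul, smul_eq_mul, mul_eq_zero, or_iff_left H.ℓ_f_ne_zero] at hℓ0
  rw [hℓ0, zero_smul] at hk
  exact hg0 hk

lemma isUnit_of_lt [MeasurableSpace.CountablyGenerated X] {z : ℂ} (hz0 : z ≠ 0)
    (hz : sr H.rest < ‖z‖) (hzl : z ≠ S.lam a) :
    IsUnit (algebraMap ℂ (S.E →L[ℂ] S.E) z - S.op a) := by
  obtain ⟨u, hu⟩ := isUnit_of_sr_lt hz
  set B : S.E →L[ℂ] S.E := ↑(u⁻¹) with hB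
  set Q := S.specProj f H.vbdd ℓ with hQ
  -- On the range of `Q` the inverse must act as `(z - λ)⁻¹`, whereas `B` acts as `z⁻¹`; `c` is the
  -- difference.
  set c : ℂ := S.lam a / (z * (z - S.lam a)) with hc
  have h1 : (algebraMap ℂ (S.E →L[ℂ] S.E) z - H.rest) * B = 1 := by rw [← hu]; exact u.mul_inv
  have h2 : B * (algebraMap ℂ (S.E →L[ℂ] S.E) z - H.rest) = 1 := by rw [← hu]; exact u.inv_mul
  have h3 : B * Q = z⁻¹ • Q := by
    have : (algebraMap ℂ (S.E →L[ℂ] S.E) z - H.rest) * Q = z • Q := by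
      rw [sub_mul, H.rest_mul_proj, sub_zero, Algebra.algebraMap_eq_smul_one, smul_mul_assoc,
        one_mul]
    have h4 := congrArg (fun T => z⁻¹ • (B * T)) this
    rw [← mul_assoc, h2, one_mul, mul_smul_comm, smul_smul, inv_mul_cancel₀ hz0, one_smul] at h4
    exact h4.symm
  have h4 : Q * B = z⁻¹ • Q := by
    have : Q * (algebraMap ℂ (S.E →L[ℂ] S.E) z - H.rest) = z • Q := by
      rw [mul_sub, H.proj_mul_rest, sub_zero, Algebra.algebraMap_eq_smul_one, mul_smul_comm,
        mul_one]
    have h4 := congrArg (fun T => z⁻¹ • (T * B)) this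
    rw [mul_assoc, h1, mul_one, smul_mul_assoc, smul_smul, inv_mul_cancel₀ hz0, one_smul] at h4
    exact h4.symm
  have hzl' : z - S.lam a ≠ 0 := sub_ne_zero.2 hzl
  have hcoef : c * (z - S.lam a) - S.lam a * z⁻¹ = 0 := by
    rw [hc]; field_simp; ring
  have hdec : algebraMap ℂ (S.E →L[ℂ] S.E) z - S.op a =
      (algebraMap ℂ (S.E →L[ℂ] S.E) z - H.rest) - (S.lam a : ℂ) • Q := by
    rw [H.op_eq]; abel
  have hR : (algebraMap ℂ (S.E →L[ℂ] S.E) z - S.op a) * (B + c • Q) = 1 := by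
    have h5 : (algebraMap ℂ (S.E →L[ℂ] S.E) z - S.op a) * Q = (z - S.lam a) • Q := by
      rw [sub_mul, H.op_mul_proj, Algebra.algebraMap_eq_smul_one, smul_mul_assoc, one_mul, sub_smul]
    rw [mul_add, mul_smul_comm, h5, hdec, sub_mul, h1, smul_mul_assoc, h4, smul_smul, smul_smul]
    rw [sub_add_eq_add_sub, add_sub_assoc, ← sub_smul, hcoef, zero_smul, add_zero]
  have hL : (B + c • Q) * (algebraMap ℂ (S.E →L[ℂ] S.E) z - S.op a) = 1 := by
    have h5 : Q * (algebraMap ℂ (S.E →L[ℂ] S.E) z - S.op a) = (z - S.lam a) • Q := by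
      rw [mul_sub, H.proj_mul_op, Algebra.algebraMap_eq_smul_one, mul_smul_comm, mul_one, sub_smul]
    rw [add_mul, smul_mul_assoc, h5, hdec, mul_sub, h2, mul_smul_comm, h3, smul_smul, smul_smul]
    rw [sub_add_eq_add_sub, add_sub_assoc, ← sub_smul, hcoef, zero_smul, add_zero]
  exact ⟨⟨_, _, hR, hL⟩, rfl⟩

theorem isPrincipalEigenvalue [MeasurableSpace.CountablyGenerated X] :
    IsPrincipalEigenvalue P V F (a : ℂ) (S.lam a : ℂ) := by
  have hl := S.lam_pos a
  have hln : ‖(S.lam a : ℂ)‖ = S.lam a := by rw [Complex.norm_real, Real.norm_of_nonneg hl.le]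
  have htil : ∀ x, tilted P F a (S.real f H.vbdd) x = S.lam a * S.real f H.vbdd x := fun x =>
    congrArg (LV.eval (hV := S.one_le_V) x) H.op_f
  have hmem : (S.lam a : ℂ) ∈ spec P V F a := by
    refine ⟨H.lam_ne_zero, fun ⟨C, hC⟩ => ?_⟩
    obtain ⟨g, -, -, hu⟩ := hC 0 ((memLV_iff S.one_le_V).2 (0 : S.E).vbdd)
    have h1 := hu (S.real f H.vbdd) ((memLV_iff S.one_le_V).2 (S.real f H.vbdd).vbdd)
      fun x => by rw [htil, sub_self]; rfl
    have h2 := hu (0 : S.E) ((memLV_iff S.one_le_V).2 (0 : S.E).vbdd)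
      fun x => by
        have := congrArg (LV.eval (hV := S.one_le_V) x) (map_zero (S.op a))
        rw [LV.zero_apply, mul_zero, zero_sub]
        have h3 : tilted P F a (0 : S.E) x = 0 := this
        rw [h3]; simp
    exact H.real_f_ne_zero (Subtype.ext (h1.trans h2.symm))
  refine ⟨⟨S.real f H.vbdd, (memLV_iff S.one_le_V).2 (S.real f H.vbdd).vbdd, fun h => ?_, htil⟩,
    hmem, fun z hz => ?_, ?_⟩
  · exact H.real_f_ne_zero (Subtype.ext h)
  · rw [hln]
    refine norm_le_sr (T := S.op a) fun hu => ?_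
    exact hz.2 (S.hasBoundedInverse_of_isUnit hu)
  · have hgap := H.sr_rest_lt
    refine ⟨(S.lam a - sr H.rest) / 2, by linarith, ?_⟩
    refine subset_antisymm (fun z hz => ?_) (fun z hz => ?_)
    · by_contra hne
      refine hz.1.2 (S.hasBoundedInverse_of_isUnit (H.isUnit_of_lt hz.1.1 ?_ hne))
      have : ‖(S.lam a : ℂ)‖ - (S.lam a - sr H.rest) / 2 ≤ ‖z‖ := hz.2
      rw [hln] at this
      linarith
    · rw [mem_singleton_iff.1 hz]
      refine ⟨hmem, ?_⟩
      change ‖(S.lam a : ℂ)‖ - (S.lam a - sr H.rest) / 2 ≤ ‖(S.lam a : ℂ)‖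
      linarith

/-- Growth at the exact rate `λ_aⁿ`, without the loss in the spectral radius formula. For `λ_a = 1`
it is power boundedness, which the variance argument needs. -/
lemma exists_norm_pow_le [MeasurableSpace.CountablyGenerated X] :
    ∃ B : ℝ, ∀ n, ‖S.op a ^ n‖ ≤ B * S.lam a ^ n := by
  have hl := S.lam_pos a
  obtain ⟨C, hC, hb⟩ := exists_pow_norm_le H.sr_rest_lt
  set Q := S.specProj f H.vbdd ℓ with hQ
  refine ⟨max ‖(1 : S.E →L[ℂ] S.E)‖ (C + ‖Q‖), fun n => ?_⟩
  rcases n with _ | n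
  · simp
  · rw [H.op_pow]
    refine (norm_add_le _ _).trans ?_
    rw [norm_smul, norm_pow (S.lam a : ℂ), Complex.norm_real, Real.norm_of_nonneg hl.le]
    calc _ ≤ C * S.lam a ^ (n + 1) + S.lam a ^ (n + 1) * ‖Q‖ := by gcongr; exact hb _
      _ = (C + ‖Q‖) * S.lam a ^ (n + 1) := by ring
      _ ≤ _ := by gcongr; exact le_max_right _ _

/-- `λ^{-n} P̂_aⁿ 1` converges to a positive limit. -/
lemma exists_lower_bound [MeasurableSpace.CountablyGenerated X] (x : X) :
    ∃ c : ℝ, 0 < c ∧ ∀ᶠ n : ℕ in atTop, c * S.lam a ^ n ≤ S.pexp a n (fun _ => 1) x := by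
  have hl := S.lam_pos a
  obtain ⟨ρ, hρ1, hρ2⟩ := exists_between H.sr_rest_lt
  have hρ0 : 0 ≤ ρ := (sr_nonneg _).trans hρ1.le
  obtain ⟨C, hC, hb⟩ := exists_pow_norm_le hρ1
  set e := S.real _ S.vbdd_one with he
  have h1 : 0 < (ℓ e).re := by
    refine (H.real_nonneg _ S.vbdd_one fun x => zero_le_one).lt_of_ne' fun h => ?_
    have := S.v4.nu_prob
    have h2 := H.nu_eq_zero S.vbdd_one (fun x => zero_le_one)
      (by rw [H.eq_re, h, Complex.ofReal_zero])
    simp at h2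
  set p := (ℓ (S.real f H.vbdd)).re with hp
  have hp0 : 0 < p := H.f_pos
  set d := p⁻¹ * (ℓ e).re * f x with hd
  have hd0 : 0 < d := by have := H.pos x; positivity
  refine ⟨d / 2, by positivity, ?_⟩
  have hlim : Tendsto (fun n : ℕ => C * V x * (ρ / S.lam a) ^ n) atTop (𝓝 0) := by
    have := (tendsto_pow_atTop_nhds_zero_of_lt_one (by positivity)
      ((div_lt_one hl).2 hρ2)).const_mul (C * V x)
    rwa [mul_zero] at this
  filter_upwards [hlim.eventually_lt_const (half_pos hd0), eventually_ge_atTop 1] with n hn hn1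
  obtain ⟨m, rfl⟩ : ∃ m, n = m + 1 := ⟨n - 1, by omega⟩
  have h3 := S.op_pow_real a (m + 1) S.vbdd_one x
  rw [H.op_pow, _root_.add_apply, LV.add_apply, _root_.smul_apply, LV.smul_apply, specProj_apply,
    LV.smul_apply, S.real_apply] at h3
  have h4 : (S.lam a : ℂ) ^ (m + 1) * ((ℓ (S.real f H.vbdd))⁻¹ * ℓ e * (f x : ℂ)) =
      ((S.lam a ^ (m + 1) * d : ℝ) : ℂ) := by
    rw [H.eq_re S.vbdd_one, H.eq_re H.vbdd, hd]
    push_cast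
    rfl
  rw [h4] at h3
  have h5 : ‖(H.rest ^ (m + 1)) e x‖ ≤ C * ρ ^ (m + 1) * V x := by
    refine ((H.rest ^ (m + 1)) e).norm_apply_le x |>.trans ?_
    refine mul_le_mul_of_nonneg_right ?_ (S.V_pos x).le
    refine ((H.rest ^ (m + 1)).le_opNorm e).trans ?_
    exact (mul_le_of_le_one_right (norm_nonneg _) S.norm_real_one).trans (hb _)
  have h6 := congrArg Complex.re h3
  rw [Complex.add_re, Complex.ofReal_re, Complex.ofReal_re] at h6
  have h7 := (abs_le.1 (Complex.abs_re_le_norm ((H.rest ^ (m + 1)) e x))).1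
  have h8 : C * ρ ^ (m + 1) * V x ≤ d / 2 * S.lam a ^ (m + 1) := by
    have h9 := mul_le_mul_of_nonneg_right hn.le (pow_pos hl (m + 1)).le
    rw [div_pow] at h9
    have h10 : C * V x * (ρ ^ (m + 1) / S.lam a ^ (m + 1)) * S.lam a ^ (m + 1) =
        C * ρ ^ (m + 1) * V x := by
      field_simp
    linarith
  linarith

end Perron

end Setup

end MultErgodic

/-! ### The inequality `e^{|a|} q < λ_a` in the strip. -/

namespace MultErgodic

variable {X : Type*} [MeasurableSpace X]

lemma sq_le_two_mul_exp_add_exp_neg (x : ℝ) : x ^ 2 ≤ 2 * (Real.exp x + Real.exp (-x)) := by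
  rcases le_total 0 x with h | h
  · have h1 := Real.quadratic_le_exp_of_nonneg h
    have h2 := Real.exp_pos (-x)
    linarith
  · have h1 := Real.quadratic_le_exp_of_nonneg (neg_nonneg.2 h)
    have h2 := Real.exp_pos x
    have h3 : (-x) ^ 2 = x ^ 2 := neg_sq x
    linarith

namespace Setup

variable {P : Kernel X X} [IsMarkovKernel P] {V F : X → ℝ} {π : Measure X} {δ b : ℝ}
    {s : X → ℝ} {ν : Measure X} (S : Setup P V F π δ b s ν)

include S

lemma qrate_lt_one : qrate δ b < 1 :=
  max_lt (by linarith [S.etaRate_pos]) one_pos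

/-- Equality in `(P √f)² ≤ P f`. -/
lemma sqrt_integral {f : X → ℝ} (hf : VBdd V f) (hsf : VBdd V fun x => √(f x))
    (hpos : ∀ x, 0 < f x) (x : X) {m : ℝ} (hm : 0 < m) (hm2 : ∫ y, f y ∂(P x) = m ^ 2) :
    ∫ y, √(f y) ∂(P x) ≤ m ∧ (m ≤ ∫ y, √(f y) ∂(P x) → ∀ᵐ y ∂(P x), f y = m ^ 2) := by
  have hi := S.v4.integrable x
  have hq : (fun y => (√(f y) - m) ^ 2) = fun y => f y - (2 * m) * √(f y) + m ^ 2 := by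
    ext y
    have := Real.sq_sqrt (hpos y).le
    ring_nf
    rw [this]
    ring
  have hi1 : Integrable (fun y => f y - (2 * m) * √(f y)) (P x) :=
    (hf.integrable hi).sub ((hsf.integrable hi).const_mul _)
  have hint : Integrable (fun y => (√(f y) - m) ^ 2) (P x) := by
    rw [hq]
    exact hi1.add (integrable_const _)
  have hval : ∫ y, (√(f y) - m) ^ 2 ∂(P x) = 2 * m * (m - ∫ y, √(f y) ∂(P x)) := by
    rw [hq, integral_add hi1 (integrable_const _), integral_sub (hf.integrable hi) ((hsf.integrable hi).const_mul _),
      integral_const_mul, hm2, integral_const, probReal_univ, one_smul]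
    ring
  have hnn : 0 ≤ ∫ y, (√(f y) - m) ^ 2 ∂(P x) := integral_nonneg fun y => sq_nonneg _
  refine ⟨?_, fun h => ?_⟩
  · rw [hval] at hnn
    have := nonneg_of_mul_nonneg_right hnn (by positivity)
    linarith
  · have h0 : ∫ y, (√(f y) - m) ^ 2 ∂(P x) = 0 := by
      refine le_antisymm ?_ hnn
      rw [hval]
      exact mul_nonpos_of_nonneg_of_nonpos (by positivity) (by linarith)
    rw [integral_eq_zero_iff_of_nonneg (fun y => sq_nonneg _) hint] at h0
    filter_upwards [h0] with y hy
    have h1 : (√(f y) - m) ^ 2 = 0 := hy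
    have h2 : √(f y) = m := by
      rw [sq_eq_zero_iff, sub_eq_zero] at h1; exact h1
    rw [← h2, Real.sq_sqrt (hpos y).le]

/-- If `λ_t = 1` then `e^{tF}` is a multiplicative coboundary on an absorbing set. -/
lemma exists_coboundary [MeasurableSpace.CountablyGenerated X] {t : ℝ}
    (hq : Real.exp |t| * qrate δ b < 1) (hlam : S.lam t = 1) {f : X → ℝ} {ℓ : S.E →L[ℂ] ℂ}
    (H : S.Perron t f ℓ) :
    ∃ Y, IsAbsorbing P Y ∧ ν Yᶜ = 0 ∧
      ∀ x ∈ Y, ∀ᵐ y ∂(P x), f y = Real.exp (-(t * F x)) * f x := by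
  -- By Jensen `√f` is a supersolution for `P̂_{t/2}` with constant `1`; the functional `ℓ₂` then
  -- gives `λ_{t/2} ≤ 1`, hence equality. Rigidity applied to `-√f` yields equality in Jensen on an
  -- absorbing set, so `f` is `P(x, ·)`-almost surely constant there.
  have hq2 : Real.exp |t / 2| * qrate δ b < S.lam (t / 2) := by
    refine lt_of_le_of_lt ?_ (hq.trans_le (S.one_le_lam _))
    refine mul_le_mul_of_nonneg_right (Real.exp_le_exp.2 ?_) qrate_nonneg
    rw [abs_div, abs_two]
    linarith [abs_nonneg t]
  obtain ⟨f₂, ℓ₂, H₂⟩ := S.exists_perron hq2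
  have hsf : VBdd V fun x => √(f x) := by
    refine (H.vbdd.add S.vbdd_one).of_le H.vbdd.1.sqrt fun x => ?_
    rw [Real.norm_of_nonneg (Real.sqrt_nonneg _), Real.sqrt_le_left (by linarith [H.pos x])]
    nlinarith [H.pos x]
  set m : X → ℝ := fun x => Real.exp (-(t / 2 * F x)) * √(f x) with hm
  have hm0 : ∀ x, 0 < m x := fun x => mul_pos (Real.exp_pos _) (Real.sqrt_pos.2 (H.pos x))
  have hm2 : ∀ x, m x ^ 2 = Real.exp (-(t * F x)) * f x := fun x => by
    rw [hm]
    dsimp only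
    rw [mul_pow, Real.sq_sqrt (H.pos x).le, ← Real.exp_nat_mul]
    congr 2
    push_cast; ring
  have hPf : ∀ x, ∫ y, f y ∂(P x) = m x ^ 2 := fun x => by
    have h1 := H.eig x
    rw [hlam, one_mul] at h1
    rw [hm2, ← h1, ← mul_assoc, ← Real.exp_add, neg_add_cancel, Real.exp_zero, one_mul]
  have hem : ∀ x, Real.exp (t / 2 * F x) * m x = √(f x) := fun x => by
    rw [hm]
    dsimp only
    rw [← mul_assoc, ← Real.exp_add, add_neg_cancel, Real.exp_zero, one_mul]
  have hsup : ∀ x, Real.exp (t / 2 * F x) * ∫ y, √(f y) ∂(P x) ≤ √(f x) := fun x => by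
    rw [← hem]
    exact mul_le_mul_of_nonneg_left (S.sqrt_integral H.vbdd hsf H.pos x (hm0 x) (hPf x)).1
      (Real.exp_pos _).le
  have hℓ : 0 < (ℓ₂ (S.real _ hsf)).re := by
    refine (H₂.real_nonneg _ _ fun x => Real.sqrt_nonneg _).lt_of_ne' fun h => ?_
    have h1 := H₂.nu_eq_zero hsf (fun x => Real.sqrt_nonneg _)
      (by rw [H₂.eq_re, h, Complex.ofReal_zero])
    rw [integral_eq_zero_iff_of_nonneg (fun x => Real.sqrt_nonneg _)
      (hsf.integrable S.integrable_nu)] at h1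
    have := S.v4.nu_prob
    obtain ⟨x, hx⟩ := h1.exists
    exact (Real.sqrt_pos.2 (H.pos x)).ne' hx
  have hlam2 : S.lam (t / 2) = 1 := by
    refine le_antisymm ?_ (S.one_le_lam _)
    have h1 := H₂.mono (S.vbdd_real (t / 2) hsf) hsf hsup
    rw [H₂.op_re hsf] at h1
    exact le_of_mul_le_mul_right (by rwa [one_mul]) hℓ
  obtain ⟨Y, hY, hν, he⟩ := H₂.exists_absorbing_of_subsolution hsf.neg fun x => by
    rw [hlam2, one_mul, integral_neg, mul_neg, neg_le_neg_iff]
    exact hsup x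
  refine ⟨Y, hY, hν, fun x hx => ?_⟩
  have h1 := he x hx
  rw [hlam2, one_mul, integral_neg, mul_neg, neg_inj, ← hem x] at h1
  have h2 := mul_left_cancel₀ (Real.exp_pos _).ne' h1
  rw [← hm2]
  exact (S.sqrt_integral H.vbdd hsf H.pos x (hm0 x) (hPf x)).2 h2.ge

/-- Telescoping along a path which starts in `Y` and never leaves it. It expresses `e^{-tS_n}`
through the end points, so its expectation is governed by `P` alone. -/
lemma exp_partialSum_mul_ae {Y : Set X} (hY : IsAbsorbing P Y) {f : X → ℝ} (hf : Measurable f)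
    {t : ℝ} (h : ∀ x ∈ Y, ∀ᵐ y ∂(P x), f y = Real.exp (-(t * F x)) * f x) {x : X} (hx : x ∈ Y)
    (n : ℕ) : ∀ᵐ φ ∂(pathLaw P x), φ n ∈ Y ∧ f (φ n) = Real.exp (-(t * partialSum F n φ)) * f x := by
  induction n with
  | zero =>
    have h1 := pathLaw_zero_ae P x hf
    have h2 := pathLaw_zero_ae P x (u := Y.indicator fun _ => (1 : ℝ))
      (measurable_const.indicator hY.1)
    filter_upwards [h1, h2] with φ h3 h4
    refine ⟨?_, by simp [partialSum, h3]⟩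
    rw [indicator_of_mem hx] at h4
    exact mem_of_indicator_ne_zero (by rw [h4]; exact one_ne_zero)
  | succ n ih =>
    set A : Set (X × X) := {p | p.1 ∈ Y → p.2 ∈ Y ∧ f p.2 = Real.exp (-(t * F p.1)) * f p.1}
      with hAd
    have hA : MeasurableSet A := by
      have h1 : MeasurableSet {p : X × X | p.1 ∈ Y} := measurable_fst hY.1
      have h2 : MeasurableSet {p : X × X | p.2 ∈ Y} := measurable_snd hY.1
      have h3 : MeasurableSet {p : X × X | f p.2 = Real.exp (-(t * F p.1)) * f p.1} :=
        measurableSet_eq_fun (hf.comp measurable_snd)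
          ((Real.measurable_exp.comp ((S.F_meas.comp measurable_fst).const_mul t).neg).mul
            (hf.comp measurable_fst))
      exact h1.imp (h2.inter h3)
    have h1 := pathLaw_ae_succ P x n hA fun y => by
      by_cases hy : y ∈ Y
      · have h2 : ∀ᵐ z ∂(P y), z ∈ Y := hY.2 y hy
        filter_upwards [h2, h y hy] with z h3 h4 using fun _ => ⟨h3, h4⟩
      · exact ae_of_all _ fun z hy' => absurd hy' hy
    filter_upwards [ih, h1] with φ h2 h3
    obtain ⟨h4, h5⟩ := h3 h2.1
    refine ⟨h4, ?_⟩
    dsimp only at h5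
    rw [h5, h2.2, ← mul_assoc, ← Real.exp_add, partialSum_succ]
    congr 2
    ring

/-- `λ_t > 1` for small `t ≠ 0`, because the asymptotic variance is positive. -/
lemma one_lt_lam_of_small [MeasurableSpace.CountablyGenerated X]
    (hvar : ∃ v, 0 < v ∧ HasAsymptoticVariance P F v) {t : ℝ} (ht : t ≠ 0)
    (hq : Real.exp |t| * qrate δ b < 1) : 1 < S.lam t := by
  refine (S.one_le_lam t).lt_of_ne' fun hlam => ?_
  obtain ⟨f, ℓ, H⟩ := S.exists_perron (hq.trans_le (S.one_le_lam t))
  obtain ⟨f₀, ℓ₀, H₀⟩ := S.exists_perron (a := 0) (by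
    rw [abs_zero, Real.exp_zero, one_mul, S.lam_zero]; exact S.qrate_lt_one)
  obtain ⟨Y, hY, hν, he⟩ := S.exists_coboundary hq hlam H
  obtain ⟨x, hx⟩ := S.nonempty_of_nu_compl hν
  obtain ⟨B, hB⟩ := H.exists_norm_pow_le
  obtain ⟨B₀, hB₀⟩ := H₀.exists_norm_pow_le
  simp only [hlam, one_pow, mul_one] at hB
  simp only [S.lam_zero, one_pow, mul_one] at hB₀
  have hVx := S.V_pos x
  have hfx := H.pos x
  -- Both exponential moments stay bounded: `e^{tS_n}` because `P̂_t` is power bounded, and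
  -- `e^{-tS_n} = f(Φ(n))/f(x)` because `P` is. Since `y² ≤ 2(e^y + e^{-y})`, the variances are
  -- bounded and the asymptotic variance would be zero.
  set K : ℝ := 2 * (B * V x + B₀ * ‖S.real f H.vbdd‖ * V x / f x) / t ^ 2 with hK
  have hbound : ∀ n, Var[partialSum F n; pathLaw P x] ≤ K := by
    intro n
    refine (variance_le_expectation_sq
      (measurable_partialSum S.F_meas n).aestronglyMeasurable).trans ?_
    have h1 := S.integrable_pexp t n n S.vbdd_V x
    have h2 := (S.integrable_pexp 0 n n H.vbdd x).div_const (f x)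
    rw [hK, le_div_iff₀ (by positivity), mul_comm, ← integral_const_mul]
    calc ∫ φ, t ^ 2 * (partialSum F n ^ 2) φ ∂(pathLaw P x)
        ≤ ∫ φ, 2 * (Real.exp (t * partialSum F n φ) * V (φ n) +
            Real.exp (0 * partialSum F n φ) * f (φ n) / f x) ∂(pathLaw P x) := by
          refine integral_mono_of_nonneg (ae_of_all _ fun φ => ?_) ((h1.add h2).const_mul 2) ?_
          · exact mul_nonneg (sq_nonneg _) (sq_nonneg _)
          · filter_upwards [S.exp_partialSum_mul_ae hY H.vbdd.1 he hx n] with φ hφ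
            have h3 := sq_le_two_mul_exp_add_exp_neg (t * partialSum F n φ)
            rw [hφ.2, zero_mul, Real.exp_zero, one_mul, mul_div_assoc, div_self hfx.ne', mul_one]
            have h4 : Real.exp (t * partialSum F n φ) ≤ Real.exp (t * partialSum F n φ) * V (φ n) :=
              le_mul_of_one_le_right (Real.exp_pos _).le (S.one_le_V _)
            have h5 : t ^ 2 * (partialSum F n ^ 2) φ = (t * partialSum F n φ) ^ 2 := by
              rw [Pi.pow_apply]; ring
            rw [h5]
            linarith
      _ = 2 * (S.pexp t n V x + S.pexp 0 n f x / f x) := by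
          rw [integral_const_mul, integral_add h1 h2, integral_div]; rfl
      _ ≤ _ := by
          have h3 : S.pexp t n V x ≤ B * V x :=
            (S.pexp_V_le_norm t n x).trans (mul_le_mul_of_nonneg_right (hB n) hVx.le)
          have h4 : S.pexp 0 n f x ≤ B₀ * ‖S.real f H.vbdd‖ * V x := by
            refine (S.pexp_le_norm 0 n H.vbdd x).trans ?_
            gcongr
            exact hB₀ n
          gcongr
  obtain ⟨v, hv, hasv⟩ := hvar
  have hlim := (hasv x).2
  have hlim0 : Tendsto (fun n : ℕ => K / (n : ℝ)) atTop (𝓝 0) := tendsto_const_div_atTop_nhds_zero_nat K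
  have := le_of_tendsto_of_tendsto' hlim hlim0 fun n =>
    div_le_div_of_nonneg_right (hbound n) n.cast_nonneg
  linarith

/-- With `μ = λ_{a/2}`, Cauchy–Schwarz gives `E_x[e^{aS_n}] ≥ E_x[e^{aS_n/2}]² ≥ c² μ^{2n}` for
large `n`. If `λ_a ≤ 1 < μ`, the left side would be at most `C μⁿ V(x)`. -/
lemma one_lt_lam_of_half [MeasurableSpace.CountablyGenerated X] {a : ℝ}
    (hq : Real.exp |a / 2| * qrate δ b < 1) (h : 1 < S.lam (a / 2)) : 1 < S.lam a := by
  by_contra! hcon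
  set μ := S.lam (a / 2) with hμ
  obtain ⟨f, ℓ, H⟩ := S.exists_perron (hq.trans h)
  obtain ⟨x⟩ := S.nonempty
  obtain ⟨c, hc, hlow⟩ := H.exists_lower_bound x
  obtain ⟨C, hC, hb⟩ := exists_pow_norm_le (hcon.trans_lt h)
  have hlim := (tendsto_pow_atTop_atTop_of_one_lt h).eventually_gt_atTop (C * V x / c ^ 2)
  obtain ⟨n, h1, h2⟩ := (hlow.and hlim).exists
  have hμ0 : 0 < μ ^ n := pow_pos (one_pos.trans h) n
  have hjen : S.pexp (a / 2) n (fun _ => 1) x ^ 2 ≤ S.pexp a n (fun _ => 1) x := by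
    set p := S.pexp (a / 2) n (fun _ => 1) x with hp
    have hi1 := S.integrable_pexp (a / 2) n n S.vbdd_one x
    have hi2 := S.integrable_pexp a n n S.vbdd_one x
    have h3 : ∫ φ, (2 * p * (Real.exp (a / 2 * partialSum F n φ) * 1) - p ^ 2) ∂(pathLaw P x) ≤
        S.pexp a n (fun _ => 1) x := by
      refine integral_mono ((hi1.const_mul _).sub (integrable_const _)) hi2 fun φ => ?_
      have h4 : Real.exp (a * partialSum F n φ) = Real.exp (a / 2 * partialSum F n φ) ^ 2 := by
        rw [← Real.exp_nat_mul]; congr 1; push_cast; ring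
      dsimp only
      rw [h4]
      nlinarith [sq_nonneg (Real.exp (a / 2 * partialSum F n φ) - p)]
    rw [integral_sub (hi1.const_mul _) (integrable_const _), integral_const_mul, integral_const,
      probReal_univ, one_smul] at h3
    have h5 : ∫ φ, Real.exp (a / 2 * partialSum F n φ) * 1 ∂(pathLaw P x) = p := rfl
    rw [h5] at h3
    linarith
  have h3 : (c * μ ^ n) ^ 2 ≤ C * μ ^ n * V x := by
    calc (c * μ ^ n) ^ 2 ≤ S.pexp (a / 2) n (fun _ => 1) x ^ 2 :=
          pow_le_pow_left₀ (by positivity) h1 2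
      _ ≤ S.pexp a n (fun _ => 1) x := hjen
      _ ≤ S.pexp a n V x := S.pexp_mono a n S.vbdd_one S.vbdd_V S.one_le_V x
      _ ≤ ‖S.op a ^ n‖ * V x := S.pexp_V_le_norm a n x
      _ ≤ C * μ ^ n * V x := mul_le_mul_of_nonneg_right (hb n) (S.V_pos x).le
  rw [div_lt_iff₀ (by positivity)] at h2
  have h4 : μ ^ n * (C * V x) < μ ^ n * (μ ^ n * c ^ 2) := mul_lt_mul_of_pos_left h2 hμ0
  nlinarith

/-- In the strip `λ_a` exceeds the essential spectral radius. -/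
lemma gap_of_inStrip [MeasurableSpace.CountablyGenerated X]
    (hvar : ∃ v, 0 < v ∧ HasAsymptoticVariance P F v) {a : ℝ} (ha : InStrip δ b a) :
    Real.exp |a| * qrate δ b < S.lam a := by
  have hq0 : 0 ≤ qrate δ b := qrate_nonneg
  -- The two conditions defining the strip match the two cases of `η = min(δ, ā)`: the second is the
  -- claim for `η = δ`, and for `η = ā` the first gives `1 - η ≤ 1 - |a| ≤ e^{-|a|}`.
  have hle : Real.exp |a| * qrate δ b ≤ 1 := by
    have hE := (Real.exp_pos |a|).le
    unfold qrate
    rw [mul_max_of_nonneg _ _ hE, mul_zero]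
    refine max_le ?_ zero_le_one
    rcases min_choice δ (abar δ b) with h | h
    · unfold etaRate
      rw [h]
      exact ha.2
    · have h1 : |a| ≤ etaRate δ b := by
        unfold etaRate
        rw [h]
        exact ha.abs_le
      have h2 : 1 - etaRate δ b ≤ Real.exp (-|a|) := by
        linarith [Real.add_one_le_exp (-|a|)]
      calc Real.exp |a| * (1 - etaRate δ b) ≤ Real.exp |a| * Real.exp (-|a|) :=
            mul_le_mul_of_nonneg_left h2 hE
        _ = 1 := by rw [← Real.exp_add, add_neg_cancel, Real.exp_zero]
  rcases hle.lt_or_eq with h | h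
  · exact h.trans_le (S.one_le_lam a)
  -- In the boundary case `e^{|a|} q = 1` the bound `λ_a ≥ 1` is not enough; the parameter `a/2`
  -- satisfies the strict inequality, and `λ_{a/2} > 1` carries over to `a`.
  · rw [h]
    have ha0 : a ≠ 0 := by
      rintro rfl
      rw [abs_zero, Real.exp_zero, one_mul] at h
      exact S.qrate_lt_one.ne h
    have hq1 : 0 < qrate δ b := hq0.lt_of_ne fun h0 => by
      rw [← h0, mul_zero] at h
      exact zero_ne_one h
    have hhalf : Real.exp |a / 2| * qrate δ b < 1 := by
      rw [← h]
      refine mul_lt_mul_of_pos_right (Real.exp_lt_exp.2 ?_) hq1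
      rw [abs_div, abs_two]
      linarith [abs_pos.2 ha0]
    exact S.one_lt_lam_of_half hhalf
      (S.one_lt_lam_of_small hvar (div_ne_zero ha0 two_ne_zero) hhalf)

end Setup

end MultErgodic

/-! ### Almost-lattice decompositions from eigenvalues on the spectral circle. -/

namespace MultErgodic

variable {X : Type*} [MeasurableSpace X]

/-- A function with values in a coset of `h₀ ℤ` which is not constant has a span. -/
lemma exists_span {G : X → ℝ} {h₀ : ℝ} (hG : IsLatticeConstant G h₀) (hne : ∃ x y, G x ≠ G y) :
    ∃ h, h₀ ≤ h ∧ IsLatticeWithSpan G h := by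
  obtain ⟨x, y, hxy⟩ := hne
  set Δ := |G x - G y| with hΔ
  have hΔ0 : 0 < Δ := abs_pos.2 (sub_ne_zero.2 hxy)
  -- A nonzero difference `Δ` of two values is an integer multiple of every lattice constant, so the
  -- constants are among the `Δ/n` and the least admissible `n` gives the largest.
  have key : ∀ h, IsLatticeConstant G h → ∃ n : ℕ, 0 < n ∧ h = Δ / n := by
    rintro h ⟨hh, d, -, -, hd⟩
    obtain ⟨k, hk⟩ := hd x
    obtain ⟨l, hl⟩ := hd y
    have h1 : G x - G y = ((k - l : ℤ) : ℝ) * h := by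
      rw [div_eq_iff hh.ne'] at hk hl
      push_cast
      linarith
    have hkl : k - l ≠ 0 := by
      intro h0
      rw [h0, Int.cast_zero, zero_mul, sub_eq_zero] at h1
      exact hxy h1
    refine ⟨(k - l).natAbs, Int.natAbs_pos.2 hkl, ?_⟩
    have h2 : ((k - l).natAbs : ℝ) = |((k - l : ℤ) : ℝ)| := by
      rw [Nat.cast_natAbs, Int.cast_abs]
    rw [hΔ, h1, abs_mul, abs_of_pos hh, h2, mul_div_cancel_left₀]
    exact (abs_pos.2 (by exact_mod_cast hkl)).ne'
  obtain ⟨n₀, hn₀, he₀⟩ := key h₀ hG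
  classical
  have hex : ∃ n : ℕ, 0 < n ∧ IsLatticeConstant G (Δ / n) := ⟨n₀, hn₀, he₀ ▸ hG⟩
  have hmax : ∀ h, IsLatticeConstant G h → h ≤ Δ / (Nat.find hex : ℕ) := by
    intro h hh
    obtain ⟨n, hn, rfl⟩ := key h hh
    have h1 : Nat.find hex ≤ n := Nat.find_min' hex ⟨hn, hh⟩
    have h2 : (0 : ℝ) < Nat.find hex := by exact_mod_cast (Nat.find_spec hex).1
    exact div_le_div_of_nonneg_left hΔ0.le h2 (by exact_mod_cast h1)
  exact ⟨_, hmax h₀ hG, (Nat.find_spec hex).2, hmax⟩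

/-- Values in `c + h ℤ` make `h` a lattice constant. -/
lemma isLatticeConstant_of_coset {G : X → ℝ} {h c : ℝ} (hh : 0 < h)
    (hG : ∀ x, ∃ k : ℤ, G x = c + k * h) : IsLatticeConstant G h := by
  refine ⟨hh, c - ⌊c / h⌋ * h, ?_, ?_, fun x => ?_⟩
  · have := Int.floor_le (c / h)
    rw [le_div_iff₀ hh] at this
    linarith
  · have := Int.lt_floor_add_one (c / h)
    rw [div_lt_iff₀ hh] at this
    linarith
  · obtain ⟨k, hk⟩ := hG x
    refine ⟨k + ⌊c / h⌋, ?_⟩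
    rw [div_eq_iff hh.ne', hk]
    push_cast
    ring

/-- The number of visits to `B` before time `n`. -/
def visits (B : Set X) (n : ℕ) (φ : ℕ → X) : ℝ :=
  partialSum (B.indicator fun _ => (1 : ℝ)) n φ

/-- A visit at time `n` raises the square of the count by at most `2n + 1`. This bounds the second
moment by one-time probabilities, without correlations. -/
lemma visits_sq_le (B : Set X) (n : ℕ) (φ : ℕ → X) :
    visits B n φ ^ 2 ≤ ∑ i ∈ Finset.range n, (2 * i + 1) * B.indicator (fun _ => (1 : ℝ)) (φ i) := by
  have hb : ∀ x, B.indicator (fun _ => (1 : ℝ)) x ∈ Icc (0 : ℝ) 1 := fun x =>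
    ⟨indicator_nonneg (fun _ _ => zero_le_one) x, indicator_le_self' (fun _ _ => zero_le_one) x⟩
  have hn : ∀ n, visits B n φ ≤ n := fun n =>
    (le_abs_self _).trans
      (abs_partialSum_le (fun x => ⟨by linarith [(hb x).1], (hb x).2⟩) n φ)
  induction n with
  | zero => simp [visits, partialSum]
  | succ n ih =>
    rw [Finset.sum_range_succ, visits, partialSum_succ]
    change (visits B n φ + _) ^ 2 ≤ _
    obtain ⟨h0, h1⟩ := hb (φ n)
    set i := B.indicator (fun _ => (1 : ℝ)) (φ n) with hi
    have h2 := mul_le_mul_of_nonneg_right (hn n) h0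
    have h3 : i * i ≤ i := mul_le_of_le_one_left h0 h1
    nlinarith

namespace Setup

variable {P : Kernel X X} [IsMarkovKernel P] {V F : X → ℝ} {π : Measure X} {δ b : ℝ}
    {s : X → ℝ} {ν : Measure X} (S : Setup P V F π δ b s ν)

include S

/-- The number of visits to the complement of an absorbing set has bounded second moments. -/
lemma exists_visits_sq_le {Y : Set X} (hY : IsAbsorbing P Y) (hν : ν Yᶜ = 0) (x : X) :
    ∃ D : ℝ, ∀ n, Integrable (fun φ => visits Yᶜ n φ ^ 2) (pathLaw P x) ∧
      ∫ φ, visits Yᶜ n φ ^ 2 ∂(pathLaw P x) ≤ D := by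
  obtain ⟨C, hC, hb⟩ := S.pow_V_compl_le
  have hq0 : 0 ≤ qrate δ b := qrate_nonneg
  have hq1 := S.qrate_lt_one
  have hsum : Summable fun i : ℕ => (2 * (i : ℝ) + 1) * (C * qrate δ b ^ i * V x) := by
    have h1 := summable_pow_mul_geometric_of_norm_lt_one 1
      (show ‖qrate δ b‖ < 1 by rwa [Real.norm_of_nonneg hq0])
    have h2 := summable_geometric_of_lt_one hq0 hq1
    refine ((h1.mul_left (2 * C * V x)).add (h2.mul_left (C * V x))).congr fun i => ?_
    rw [pow_one]; ring
  set ι : X → ℝ := Yᶜ.indicator fun _ => (1 : ℝ) with hι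
  have hιm : Measurable ι := measurable_const.indicator hY.1.compl
  have hιv : VBdd V ι := S.vbdd_one.indicator hY.1.compl S.one_le_V
  have hi : ∀ i, Integrable (fun φ : ℕ → X => ι (φ i)) (pathLaw P x) := fun i => by
    have := S.integrable_pexp 0 0 i hιv x
    simpa using this
  have hsi : ∀ n, Integrable (fun φ : ℕ → X => ∑ i ∈ Finset.range n, (2 * (i : ℝ) + 1) * ι (φ i))
      (pathLaw P x) := fun n => integrable_finsetSum _ fun i _ => (hi i).const_mul _
  have hint : ∀ n, Integrable (fun φ => visits Yᶜ n φ ^ 2) (pathLaw P x) := fun n =>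
    (hsi n).mono' ((measurable_partialSum hιm n).pow_const 2).aestronglyMeasurable
      (ae_of_all _ fun φ => by
        rw [Real.norm_of_nonneg (sq_nonneg _)]
        exact visits_sq_le _ n φ)
  refine ⟨∑' i : ℕ, (2 * (i : ℝ) + 1) * (C * qrate δ b ^ i * V x), fun n => ⟨hint n, ?_⟩⟩
  calc ∫ φ, visits Yᶜ n φ ^ 2 ∂(pathLaw P x)
      ≤ ∫ φ, ∑ i ∈ Finset.range n, (2 * (i : ℝ) + 1) * ι (φ i) ∂(pathLaw P x) :=
        integral_mono (hint n) (hsi n) fun φ => visits_sq_le _ n φ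
    _ = ∑ i ∈ Finset.range n, (2 * (i : ℝ) + 1) * ∫ y, ι y ∂((P ^ i) x) := by
        rw [integral_finsetSum _ fun i _ => (hi i).const_mul _]
        refine Finset.sum_congr rfl fun i _ => ?_
        rw [integral_const_mul, S.integral_pathLaw_eval hιm.stronglyMeasurable]
    _ ≤ ∑ i ∈ Finset.range n, (2 * (i : ℝ) + 1) * (C * qrate δ b ^ i * V x) := by
        refine Finset.sum_le_sum fun i _ => mul_le_mul_of_nonneg_left ?_ (by positivity)
        refine le_trans ?_ (hb Y hY hν i x)
        rw [← integral_indicator hY.1.compl]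
        refine integral_mono (hιv.integrable (S.integrable_pow i x))
          ((S.integrable_pow i x).indicator hY.1.compl) fun y => ?_
        exact indicator_le_indicator (S.one_le_V y)
    _ ≤ _ := hsum.sum_le_tsum _ fun i _ => by have := S.V_pos x; positivity

/-- A bounded function which is a coboundary on an absorbing set has zero asymptotic variance. -/
lemma hasAsymptoticVariance_zero_of_coboundary {Y : Set X} (hY : IsAbsorbing P Y) (hν : ν Yᶜ = 0)
    {G τ : X → ℝ} (hG : Measurable G) (hτ : Measurable τ) {K M : ℝ} (hGK : ∀ x, |G x| ≤ K)
    (hτM : ∀ x, |τ x| ≤ M) (h : ∀ x ∈ Y, ∀ᵐ y ∂(P x), G x = τ x - τ y) :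
    HasAsymptoticVariance P G 0 := by
  have hmeas := fun n => measurable_partialSum hG n
  intro x
  have hK : 0 ≤ K := (abs_nonneg _).trans (hGK x)
  have hM : 0 ≤ M := (abs_nonneg _).trans (hτM x)
  have habs : ∀ n φ, |partialSum G n φ| ≤ n * K := fun n φ => by
    unfold partialSum
    refine (Finset.abs_sum_le_sum_abs _ _).trans ?_
    refine (Finset.sum_le_sum fun i _ => hGK _).trans ?_
    simp
  refine ⟨fun n => MemLp.of_bound (hmeas n).aestronglyMeasurable (n * K)
    (ae_of_all _ fun φ => by rw [Real.norm_eq_abs]; exact habs n φ), ?_⟩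
  obtain ⟨D, hD⟩ := S.exists_visits_sq_le hY hν x
  -- The asymptotic variance must vanish for every initial state, also outside `Y`. The sum
  -- telescopes except for an error of at most `K + 2M` at each visit to `Yᶜ`.
  have hpath : ∀ n, ∀ᵐ φ ∂(pathLaw P x),
      |partialSum G n φ - (τ (φ 0) - τ (φ n))| ≤ (K + 2 * M) * visits Yᶜ n φ := by
    intro n
    induction n with
    | zero => exact ae_of_all _ fun φ => by simp [partialSum, visits]
    | succ n ih =>
      set A : Set (X × X) := {p | |G p.1 - (τ p.1 - τ p.2)| ≤
        (K + 2 * M) * Yᶜ.indicator (fun _ => (1 : ℝ)) p.1} with hAd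
      have hA : MeasurableSet A := measurableSet_le
        (((hG.comp measurable_fst).sub ((hτ.comp measurable_fst).sub
          (hτ.comp measurable_snd))).norm)
        (((measurable_const.indicator hY.1.compl).comp measurable_fst).const_mul _)
      have h1 := pathLaw_ae_succ P x n hA fun y => by
        by_cases hy : y ∈ Y
        · filter_upwards [h y hy] with z hz
          change |G y - (τ y - τ z)| ≤ _
          rw [hz, sub_self, abs_zero]
          exact mul_nonneg (by positivity) (indicator_nonneg (fun _ _ => zero_le_one) _)
        · refine ae_of_all _ fun z => ?_
          change |G y - (τ y - τ z)| ≤ _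
          rw [indicator_of_mem (show y ∈ Yᶜ from hy), mul_one]
          have h2 := abs_sub (G y) (τ y - τ z)
          have h3 := abs_sub (τ y) (τ z)
          linarith [hGK y, hτM y, hτM z]
      filter_upwards [ih, h1] with φ h2 h3
      rw [partialSum_succ, visits, partialSum_succ]
      change _ ≤ (K + 2 * M) * (visits Yᶜ n φ + _)
      rw [mul_add]
      refine le_trans (le_of_eq_of_le ?_ (abs_add_le _ _)) (add_le_add h2 h3)
      congr 1
      ring
  set E : ℝ := 2 * ((2 * M) ^ 2 + (K + 2 * M) ^ 2 * D) with hE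
  have hvar : ∀ n, Var[partialSum G n; pathLaw P x] ≤ E := by
    intro n
    refine (variance_le_expectation_sq (hmeas n).aestronglyMeasurable).trans ?_
    obtain ⟨hi, hle⟩ := hD n
    calc ∫ φ, (partialSum G n ^ 2) φ ∂(pathLaw P x)
        ≤ ∫ φ, 2 * ((2 * M) ^ 2 + (K + 2 * M) ^ 2 * visits Yᶜ n φ ^ 2) ∂(pathLaw P x) := by
          refine integral_mono_of_nonneg (ae_of_all _ fun φ => sq_nonneg _)
            (((integrable_const _).add (hi.const_mul _)).const_mul _) ?_
          filter_upwards [hpath n] with φ hφ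
          rw [Pi.pow_apply]
          have h1 : |partialSum G n φ| ≤ 2 * M + (K + 2 * M) * visits Yᶜ n φ := by
            have h2 := abs_sub (τ (φ 0)) (τ (φ n))
            have h3 := abs_add_le (partialSum G n φ - (τ (φ 0) - τ (φ n))) (τ (φ 0) - τ (φ n))
            rw [sub_add_cancel] at h3
            linarith [hτM (φ 0), hτM (φ n)]
          have h2 := pow_le_pow_left₀ (abs_nonneg _) h1 2
          rw [sq_abs] at h2
          nlinarith [sq_nonneg (2 * M - (K + 2 * M) * visits Yᶜ n φ)]
      _ = 2 * ((2 * M) ^ 2 + (K + 2 * M) ^ 2 * ∫ φ, visits Yᶜ n φ ^ 2 ∂(pathLaw P x)) := by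
          rw [integral_const_mul, integral_add (integrable_const _) (hi.const_mul _),
            integral_const_mul, integral_const, probReal_univ, one_smul]
      _ ≤ E := by
          rw [hE]
          have := mul_le_mul_of_nonneg_left hle (sq_nonneg (K + 2 * M))
          linarith
  refine squeeze_zero (fun n => div_nonneg (variance_nonneg _ _) n.cast_nonneg)
    (fun n => div_le_div_of_nonneg_right (hvar n) n.cast_nonneg)
    (tendsto_const_div_atTop_nhds_zero_nat E)

/-- An eigenvalue on the spectral circle for `α = a + iω`, `ω ≠ 0`, makes `F` almost-lattice with
span at least `2π/|ω|`. -/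
theorem Perron.exists_decomposition (hvar : ∃ v, 0 < v ∧ HasAsymptoticVariance P F v)
    {f : X → ℝ} {ℓ : S.E →L[ℂ] ℂ} {α z : ℂ} (H : S.Perron α.re f ℓ) (hω : α.im ≠ 0)
    (hz : ‖z‖ = S.lam α.re) {g : S.E} (hg0 : g ≠ 0) (hg : S.op α g = z • g) :
    ∃ h, 2 * Real.pi / |α.im| ≤ h ∧ HasAlmostLatticeDecomposition P V F h := by
  obtain ⟨c, hc, Y, hY, hν, hgf, hph⟩ := H.exists_phase hz hg0 hg
  have hl := S.lam_pos α.re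
  set ω := α.im with hωd
  set ζ : ℂ := z / S.lam α.re with hζ
  have hζ1 : ‖ζ‖ = 1 := by
    rw [hζ, norm_div, hz, Complex.norm_real, Real.norm_of_nonneg hl.le, div_self hl.ne']
  set u : X → ℂ := fun x => g x / ‖g x‖ with hu
  have hum : Measurable u := g.vbdd.1.div (Complex.measurable_ofReal.comp g.vbdd.1.norm)
  have hu1 : ∀ x ∈ Y, ‖u x‖ = 1 := fun x hx => by
    rw [hu, norm_div, Complex.norm_real, norm_norm]
    refine div_self ?_
    rw [hgf x hx]
    exact (mul_pos hc (H.pos x)).ne'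
  -- `v x` is the almost sure value of `u` at the state following `x ∈ Y`, so `τ(Φ(0)) - τ(Φ(1))` is
  -- a function of `Φ(0)` alone.
  set v : X → ℂ := fun x => ζ * Complex.exp (-(ω * F x * Complex.I)) * u x with hv
  have hvm : Measurable v := by
    refine (measurable_const.mul (Complex.measurable_exp.comp ?_)).mul hum
    exact (((Complex.measurable_ofReal.comp S.F_meas).const_mul (ω : ℂ)).mul_const _).neg
  set τ : X → ℝ := fun x => (u x).arg / ω with hτ
  have hτm : Measurable τ := (Complex.measurable_arg.comp hum).div_const ω
  have hτM : ∀ x, |τ x| ≤ Real.pi / |ω| := fun x => by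
    rw [hτ, abs_div]
    exact div_le_div_of_nonneg_right (Complex.abs_arg_le_pi _) (abs_nonneg _)
  classical
  -- On `Y` this is the coboundary of `τ = arg u / ω`. Off `Y` the asymptotic variance does not see
  -- `G`, and its value is chosen only to keep `F - G` in the coset `arg ζ / ω + (2π/|ω|) ℤ` at
  -- every point, as the lattice property demands.
  set G : X → ℝ := Y.piecewise (fun x => ((u x).arg - (v x).arg) / ω) fun x => F x - ζ.arg / ω
    with hG
  have hGm : Measurable G := by
    refine Measurable.piecewise hY.1 ?_ (S.F_meas.sub_const _)
    exact ((Complex.measurable_arg.comp hum).sub (Complex.measurable_arg.comp hvm)).div_const ω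
  have hGK : ∀ x, |G x| ≤ 1 + 2 * (Real.pi / |ω|) := fun x => by
    have hpi : 0 ≤ Real.pi / |ω| := div_nonneg Real.pi_pos.le (abs_nonneg _)
    by_cases hx : x ∈ Y
    · rw [hG, piecewise_eq_of_mem _ _ _ hx, abs_div]
      have h1 := abs_sub (u x).arg (v x).arg
      have hu2 := Complex.abs_arg_le_pi (u x)
      have hv2 := Complex.abs_arg_le_pi (v x)
      have h2 : |(u x).arg - (v x).arg| / |ω| ≤ (2 * Real.pi) / |ω| :=
        div_le_div_of_nonneg_right (by linarith) (abs_nonneg _)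
      rw [mul_div_assoc] at h2
      linarith
    · rw [hG, piecewise_eq_of_notMem _ _ _ hx]
      have h1 := abs_sub (F x) (ζ.arg / ω)
      have h2 : |F x| ≤ 1 := abs_le.2 (S.F_mem x)
      have h3 : |ζ.arg / ω| ≤ Real.pi / |ω| := by
        rw [abs_div]
        exact div_le_div_of_nonneg_right (Complex.abs_arg_le_pi _) (abs_nonneg _)
      linarith
  have hcob : ∀ x ∈ Y, ∀ᵐ y ∂(P x), G x = τ x - τ y := by
    intro x hx
    filter_upwards [hph x hx] with y hy
    rw [hG, piecewise_eq_of_mem _ _ _ hx, hτ, sub_div]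
    have : u y = v x := hy.2
    dsimp only
    rw [this]
  have hzero := S.hasAsymptoticVariance_zero_of_coboundary hY hν hGm hτm hGK hτM hcob
  have hcoset : ∀ x, ∃ k : ℤ, F x - G x = ζ.arg / ω + k * (2 * Real.pi / |ω|) := by
    intro x
    by_cases hx : x ∈ Y
    · have hexp : ∀ w : ℂ, ‖w‖ = 1 → Complex.exp (w.arg * Complex.I) = w := fun w hw => by
        have := Complex.norm_mul_exp_arg_mul_I w
        rwa [hw, Complex.ofReal_one, one_mul] at this
      have hv1 : ‖v x‖ = 1 := by
        have : -(ω * F x * Complex.I) = ((-(ω * F x) : ℝ) : ℂ) * Complex.I := by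
          push_cast; ring
        rw [hv, norm_mul, norm_mul, hζ1, this, Complex.norm_exp_ofReal_mul_I, hu1 x hx, one_mul,
          one_mul]
      have h1 : Complex.exp ((v x).arg * Complex.I) =
          Complex.exp ((ζ.arg - ω * F x + (u x).arg) * Complex.I) := by
        rw [hexp _ hv1]
        have : (ζ.arg - ω * F x + (u x).arg) * Complex.I = ζ.arg * Complex.I +
            -(ω * F x * Complex.I) + (u x).arg * Complex.I := by ring
        rw [this, Complex.exp_add, Complex.exp_add, hexp _ hζ1, hexp _ (hu1 x hx)]
      obtain ⟨n, hn⟩ := Complex.exp_eq_exp_iff_exists_int.1 h1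
      have h2 : (v x).arg = ζ.arg - ω * F x + (u x).arg + n * (2 * Real.pi) := by
        have h3 : (((v x).arg : ℝ) : ℂ) * Complex.I =
            ((ζ.arg - ω * F x + (u x).arg + n * (2 * Real.pi) : ℝ) : ℂ) * Complex.I := by
          rw [hn]; push_cast; ring
        exact_mod_cast mul_right_cancel₀ Complex.I_ne_zero h3
      have h4 : F x - G x = ζ.arg / ω + n * (2 * Real.pi / ω) := by
        rw [hG, piecewise_eq_of_mem _ _ _ hx, h2]
        field_simp
        ring
      rcases abs_choice ω with h5 | h5
      · exact ⟨n, by rw [h4, h5]⟩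
      · refine ⟨-n, ?_⟩
        rw [h4, h5]
        push_cast
        rw [div_neg]
        ring
    · refine ⟨0, ?_⟩
      rw [hG, piecewise_eq_of_notMem _ _ _ hx]
      simp
  have hlat : IsLatticeConstant (fun x => F x - G x) (2 * Real.pi / |ω|) :=
    isLatticeConstant_of_coset (div_pos (by positivity) (abs_pos.2 hω)) hcoset
  -- A constant function has no largest lattice constant. Here constancy would give `F` the
  -- variances of `G`, contrary to `σ² > 0`.
  have hnc : ∃ x y, F x - G x ≠ F y - G y := by
    by_contra! hconst
    obtain ⟨x⟩ := S.nonempty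
    obtain ⟨r, hr, hvr⟩ := hvar
    have h1 : ∀ n, Var[partialSum F n; pathLaw P x] = Var[partialSum G n; pathLaw P x] := by
      intro n
      have h2 : partialSum F n = fun φ => partialSum G n φ + n * (F x - G x) := by
        ext φ
        unfold partialSum
        have h3 : ∀ i, F (φ i) = G (φ i) + (F x - G x) := fun i => by
          rw [hconst x (φ i)]; ring
        rw [Finset.sum_congr rfl fun i _ => h3 i, Finset.sum_add_distrib, Finset.sum_const,
          Finset.card_range, nsmul_eq_mul]
      rw [h2, variance_add_const (measurable_partialSum hGm n).aestronglyMeasurable]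
    have h2 := (hvr x).2
    simp_rw [h1] at h2
    exact hr.ne (tendsto_nhds_unique (hzero x).2 h2)
  obtain ⟨h, hh, hspan⟩ := exists_span hlat hnc
  refine ⟨h, hh, G, fun x => F x - G x, fun x => by ring, hspan, hGm,
    ⟨1 + 2 * (Real.pi / |ω|), fun x => (hGK x).trans ?_⟩, hzero⟩
  exact le_mul_of_one_le_right ((abs_nonneg _).trans (hGK x)) (S.one_le_V x)

end Setup

end MultErgodic

/-! ### Continuity in the parameter and uniform exponential bounds. -/

namespace MultErgodic

variable {X : Type*} [MeasurableSpace X]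

lemma isCompact_inStrip (δ b : ℝ) : IsCompact {a | InStrip δ b a} := by
  refine Metric.isCompact_of_isClosed_isBounded ?_ ?_
  · refine IsClosed.inter ?_ ?_
    · exact isClosed_le continuous_abs continuous_const
    · exact isClosed_le ((Real.continuous_exp.comp continuous_abs).mul continuous_const)
        continuous_const
  · refine (Metric.isBounded_closedBall (x := (0 : ℝ)) (r := abar δ b)).subset fun a ha => ?_
    rw [mem_closedBall_zero_iff, Real.norm_eq_abs]
    exact InStrip.abs_le ha

lemma isCompact_abs_mem_Icc (l u : ℝ) : IsCompact {ω : ℝ | l ≤ |ω| ∧ |ω| ≤ u} := by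
  refine Metric.isCompact_of_isClosed_isBounded ?_ ?_
  · exact IsClosed.inter (isClosed_le continuous_const continuous_abs)
      (isClosed_le continuous_abs continuous_const)
  · refine (Metric.isBounded_closedBall (x := (0 : ℝ)) (r := u)).subset fun ω hω => ?_
    rw [mem_closedBall_zero_iff, Real.norm_eq_abs]
    exact hω.2

namespace Setup

variable {P : Kernel X X} [IsMarkovKernel P] {V F : X → ℝ} {π : Measure X} {δ b : ℝ}
    {s : X → ℝ} {ν : Measure X} (S : Setup P V F π δ b s ν)

include S

lemma norm_op_sub_le {α β : ℂ} (h : ‖α - β‖ ≤ 1) :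
    ‖S.op α - S.op β‖ ≤ Real.exp |β.re| * (2 * ‖α - β‖) * (1 + b) := by
  have hb := S.b_pos
  refine ContinuousLinearMap.opNorm_le_bound _ (by positivity) fun g => ?_
  refine LV.norm_le (by positivity) fun x => ?_
  rw [_root_.sub_apply, LV.sub_apply, S.op_apply, S.op_apply, ← sub_mul, norm_mul]
  have hF : |F x| ≤ 1 := abs_le.2 (S.F_mem x)
  have h1 : ‖Complex.exp (α * F x) - Complex.exp (β * F x)‖ ≤
      Real.exp |β.re| * (2 * ‖α - β‖) := by
    have h2 : Complex.exp (α * F x) - Complex.exp (β * F x) =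
        Complex.exp (β * F x) * (Complex.exp ((α - β) * F x) - 1) := by
      rw [mul_sub, ← Complex.exp_add, mul_one]
      congr 2
      ring
    have h3 : ‖(α - β) * F x‖ ≤ ‖α - β‖ := by
      rw [norm_mul, Complex.norm_real, Real.norm_eq_abs]
      exact mul_le_of_le_one_right (norm_nonneg _) hF
    rw [h2, norm_mul]
    refine mul_le_mul (norm_exp_le (S.F_mem x)) ?_ (norm_nonneg _) (Real.exp_pos _).le
    refine (Complex.norm_exp_sub_one_le (h3.trans h)).trans ?_
    linarith
  have h4 : ‖∫ y, g y ∂(P x)‖ ≤ (1 + b) * ‖g‖ * V x := by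
    refine (norm_integral_le_of_norm_le ((S.v4.integrable x).const_mul ‖g‖)
      (ae_of_all _ fun y => g.norm_apply_le y)).trans ?_
    rw [integral_const_mul]
    have h5 : ∫ y, V y ∂(P x) ≤ (1 + b) * V x := by
      have := S.PV_le x
      nlinarith [S.one_le_V x]
    calc ‖g‖ * ∫ y, V y ∂(P x) ≤ ‖g‖ * ((1 + b) * V x) :=
          mul_le_mul_of_nonneg_left h5 (norm_nonneg _)
      _ = _ := by ring
  calc _ ≤ (Real.exp |β.re| * (2 * ‖α - β‖)) * ((1 + b) * ‖g‖ * V x) :=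
        mul_le_mul h1 h4 (norm_nonneg _) (by positivity)
    _ = _ := by ring

lemma continuous_op : Continuous S.op := by
  refine continuous_iff_continuousAt.2 fun β => ?_
  rw [ContinuousAt, tendsto_iff_norm_sub_tendsto_zero]
  have h1 : Tendsto (fun α : ℂ => ‖α - β‖) (𝓝 β) (𝓝 0) :=
    tendsto_iff_norm_sub_tendsto_zero.1 tendsto_id
  have h2 : Tendsto (fun α : ℂ => Real.exp |β.re| * (2 * ‖α - β‖) * (1 + b)) (𝓝 β) (𝓝 0) := by
    have := ((h1.const_mul 2).const_mul (Real.exp |β.re|)).mul_const (1 + b)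
    simpa using this
  refine squeeze_zero' (Eventually.of_forall fun α => norm_nonneg _) ?_ h2
  filter_upwards [h1.eventually_lt_const one_pos] with α hα using S.norm_op_sub_le hα.le

/-- Norm continuity of the operators alone would give only upper semicontinuity of the spectral
radius; the two-sided comparison in `lam_le` gives continuity. -/
lemma continuous_lam : Continuous S.lam := by
  refine continuous_iff_continuousAt.2 fun a => ?_
  have h1 : Tendsto (fun a' : ℝ => |a' - a|) (𝓝 a) (𝓝 0) :=
    tendsto_iff_norm_sub_tendsto_zero.1 tendsto_id
  have h2 : Tendsto (fun a' : ℝ => Real.exp |a' - a| * S.lam a) (𝓝 a) (𝓝 (S.lam a)) := by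
    have := ((Real.continuous_exp.tendsto 0).comp h1).mul_const (S.lam a)
    rwa [Real.exp_zero, one_mul] at this
  have h3 : Tendsto (fun a' : ℝ => Real.exp (-|a' - a|) * S.lam a) (𝓝 a) (𝓝 (S.lam a)) := by
    have := ((Real.continuous_exp.tendsto (-0)).comp h1.neg).mul_const (S.lam a)
    rwa [neg_zero, Real.exp_zero, one_mul] at this
  refine tendsto_of_tendsto_of_tendsto_of_le_of_le h3 h2 (fun a' => ?_) fun a' => S.lam_le a a'
  have h4 := mul_le_mul_of_nonneg_left (S.lam_le a' a) (Real.exp_pos (-|a' - a|)).le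
  rwa [← mul_assoc, abs_sub_comm a a', ← Real.exp_add, neg_add_cancel, Real.exp_zero,
    one_mul] at h4

/-- Off the real axis the spectral radius is smaller than `λ_a` unless `F` is almost-lattice. -/
theorem sr_lt_or_decomposition [MeasurableSpace.CountablyGenerated X]
    (hvar : ∃ v, 0 < v ∧ HasAsymptoticVariance P F v) {α : ℂ} (hα : InStrip δ b α.re)
    (hω : α.im ≠ 0) : sr (S.op α) < S.lam α.re ∨
      ∃ h, 2 * Real.pi / |α.im| ≤ h ∧ HasAlmostLatticeDecomposition P V F h := by
  refine or_iff_not_imp_left.2 fun hcon => ?_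
  have hsr : sr (S.op α) = S.lam α.re := le_antisymm (S.sr_op_le_lam α) (not_lt.1 hcon)
  have hgap := S.gap_of_inStrip hvar hα
  obtain ⟨f, ℓ, H⟩ := S.exists_perron hgap
  obtain ⟨z, hz, hzn⟩ := exists_mem_spectrum_norm_eq_sr (S.op α)
  have hzl : ‖z‖ = S.lam α.re := hzn.trans hsr
  have hz0 : z ≠ 0 := norm_ne_zero_iff.1 (by rw [hzl]; exact (S.lam_pos _).ne')
  obtain ⟨g, hg1, hg⟩ := exists_approx_eigenvector hz hz0 hzn
  rw [← tendsto_zero_iff_norm_tendsto_zero] at hg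
  obtain ⟨φ, -, g₀, hg₀, he⟩ := S.exists_subseq_tendsto (by rwa [hzl]) (fun n => (hg1 n).le) hg
  have hn1 : ‖g₀‖ = 1 := by
    refine tendsto_nhds_unique ((continuous_norm.tendsto _).comp hg₀) ?_
    refine tendsto_const_nhds.congr fun n => ?_
    simp only [Function.comp_apply, hg1]
  exact Perron.exists_decomposition S hvar H hω hzl
    (norm_ne_zero_iff.1 (by rw [hn1]; exact one_ne_zero)) he

/-- Uniform exponential bounds on a compact set of parameters. -/
theorem exists_expBound {A Ω : Set ℝ} (hA : IsCompact A) (hΩ : IsCompact Ω)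
    (h : ∀ a ∈ A, ∀ ω ∈ Ω, sr (S.op (a + ω * Complex.I)) < S.lam a) :
    ∃ b₀ B₀ : ℝ, 0 < b₀ ∧ ∀ a ∈ A, ∀ ω ∈ Ω, ∀ (x : X) (n : ℕ),
      ExpBound P V F (fun a => Real.log (S.lam a)) b₀ B₀ a ω x n := by
  -- Dividing by `λ_a` absorbs the factor `e^{-nΛ(a)}`, so `T pⁿ 1` is the expectation to be
  -- bounded; the uniform decay rate `γ` gives `b₀ = -log γ`.
  set T : ℝ × ℝ → S.E →L[ℂ] S.E := fun p =>
    ((S.lam p.1)⁻¹ : ℂ) • S.op (p.1 + p.2 * Complex.I) with hT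
  have hTpow : ∀ p n, T p ^ n = ((S.lam p.1)⁻¹ : ℂ) ^ n • S.op (p.1 + p.2 * Complex.I) ^ n :=
    fun p n => smul_pow _ _ _
  have hTn : ∀ p n, ‖T p ^ n‖ = (S.lam p.1 ^ n)⁻¹ * ‖S.op (p.1 + p.2 * Complex.I) ^ n‖ := by
    intro p n
    rw [hTpow, norm_smul, norm_pow ((S.lam p.1 : ℂ)⁻¹), norm_inv, Complex.norm_real,
      Real.norm_of_nonneg (S.lam_pos _).le, inv_pow]
  have hTc : Continuous T := by
    have h1 : Continuous fun p : ℝ × ℝ => (p.1 : ℂ) + p.2 * Complex.I := by fun_prop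
    refine Continuous.fun_smul (f := fun p : ℝ × ℝ => (S.lam p.1 : ℂ)⁻¹) ?_
      (S.continuous_op.comp h1)
    exact (Complex.continuous_ofReal.comp (S.continuous_lam.comp continuous_fst)).inv₀ fun p =>
      Complex.ofReal_ne_zero.2 (S.lam_pos p.1).ne'
  obtain ⟨B, γ, hγ0, hγ1, hB⟩ := MultErgodic.IsCompact.exists_uniform_pow_norm_le (hA.prod hΩ)
    hTc.continuousOn fun p hp => by
      obtain ⟨n, hn⟩ := exists_pow_norm_lt_one (h p.1 hp.1 p.2 hp.2)
      refine ⟨n, ?_⟩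
      rw [hTn, inv_mul_lt_iff₀ (pow_pos (S.lam_pos _) n), mul_one]
      exact hn
  refine ⟨-Real.log γ, B, neg_pos.2 (Real.log_neg hγ0 hγ1), fun a ha ω hω x n => ?_⟩
  have hl := S.lam_pos a
  have h1 := hB (a, ω) ⟨ha, hω⟩ n
  have hexp : ∀ (c : ℝ), 0 < c → Real.exp (Real.log c * n) = c ^ n := fun c hc => by
    rw [mul_comm, Real.exp_nat_mul, Real.exp_log hc]
  unfold ExpBound
  rw [neg_neg, hexp γ hγ0]
  have h2 : ∫ φ, Complex.exp (((a : ℂ) + ω * Complex.I) * partialSum F n φ -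
      n * Real.log (S.lam a)) ∂(pathLaw P x) = (T (a, ω) ^ n) (S.real _ S.vbdd_one) x := by
    rw [hTpow, _root_.smul_apply, LV.smul_apply, S.op_pow_apply, ← integral_const_mul]
    refine integral_congr_ae (ae_of_all _ fun φ => ?_)
    dsimp only
    rw [S.real_apply, Complex.ofReal_one, mul_one, sub_eq_add_neg, Complex.exp_add, mul_comm]
    congr 1
    rw [← mul_neg, Complex.exp_nat_mul, Complex.exp_neg, ← Complex.ofReal_exp, Real.exp_log hl]
  rw [h2]
  refine (LV.norm_apply_le _ x).trans ?_
  have h3 : ‖(T (a, ω) ^ n) (S.real _ S.vbdd_one)‖ ≤ B * γ ^ n :=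
    (((T (a, ω) ^ n).le_opNorm _).trans
      (mul_le_of_le_one_right (norm_nonneg _) S.norm_real_one)).trans h1
  calc _ ≤ B * γ ^ n * V x := mul_le_mul_of_nonneg_right h3 (S.V_pos x).le
    _ = _ := by ring

end Setup

end MultErgodic

end

/-! ### Assembly of the theorem. -/

theorem mainTheorem2 {X : Type*} [MeasurableSpace X] [MeasurableSpace.CountablyGenerated X]
    (P : Kernel X X) [IsMarkovKernel P] (V F : X → ℝ) (π : Measure X) (δ b : ℝ)
    (hyp : MultErgodic.StandingAssumptions P V F π δ b) :
    ∃ Lam : ℝ → ℝ,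
      (∀ a, MultErgodic.InStrip δ b a →
        MultErgodic.IsPrincipalEigenvalue P V F (a : ℂ) (Real.exp (Lam a) : ℂ)) ∧
      (MultErgodic.StronglyNonLattice P V F →
        ∀ ω₀ ω₁ : ℝ, 0 < ω₀ → ω₀ < ω₁ →
          ∃ b₀ B₀ : ℝ, 0 < b₀ ∧ ∀ a ω : ℝ, MultErgodic.InStrip δ b a →
            ω₀ ≤ |ω| → |ω| ≤ ω₁ → ∀ (x : X) (n : ℕ), 1 ≤ n →
              MultErgodic.ExpBound P V F Lam b₀ B₀ a ω x n) ∧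
      (∀ h : ℝ, MultErgodic.IsAlmostLatticeWithSpan P V F h →
        ∀ ε : ℝ, 0 < ε →
          ∃ b₀ B₀ : ℝ, 0 < b₀ ∧ ∀ a ω : ℝ, MultErgodic.InStrip δ b a →
            ε ≤ |ω| → |ω| ≤ 2 * Real.pi / h - ε → ∀ (x : X) (n : ℕ), 1 ≤ n →
              MultErgodic.ExpBound P V F Lam b₀ B₀ a ω x n) := by
  obtain ⟨s, ν, S⟩ := hyp.exists_setup
  have hvar := hyp.variance_pos
  have hsr : ∀ a ω : ℝ, MultErgodic.InStrip δ b a → ω ≠ 0 →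
      MultErgodic.sr (S.op (a + ω * Complex.I)) < S.lam a ∨
        ∃ h, 2 * Real.pi / |ω| ≤ h ∧ MultErgodic.HasAlmostLatticeDecomposition P V F h := by
    intro a ω ha hω
    have hre : ((a : ℂ) + ω * Complex.I).re = a := by simp
    have him : ((a : ℂ) + ω * Complex.I).im = ω := by simp
    have := S.sr_lt_or_decomposition hvar (α := a + ω * Complex.I) (by rwa [hre]) (by rwa [him])
    rwa [hre, him] at this
  refine ⟨fun a => Real.log (S.lam a), fun a ha => ?_, fun hnl ω₀ ω₁ h₀ _ => ?_,
    fun h hh ε hε => ?_⟩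
  · obtain ⟨f, ℓ, H⟩ := S.exists_perron (S.gap_of_inStrip hvar ha)
    rw [Real.exp_log (S.lam_pos a)]
    exact H.isPrincipalEigenvalue
  · obtain ⟨b₀, B₀, hb, hB⟩ := S.exists_expBound (MultErgodic.isCompact_inStrip δ b)
      (MultErgodic.isCompact_abs_mem_Icc ω₀ ω₁) fun a ha ω hω =>
        (hsr a ω ha (abs_pos.1 (h₀.trans_le hω.1))).resolve_right
          fun ⟨h, _, hd⟩ => hnl ⟨h, hd⟩
    exact ⟨b₀, B₀, hb, fun a ω ha h1 h2 x n _ => hB a ha ω ⟨h1, h2⟩ x n⟩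
  · have hpos : 0 < h := by
      obtain ⟨_, _, _, hspan, _⟩ := hh.1
      exact hspan.1.1
    obtain ⟨b₀, B₀, hb, hB⟩ := S.exists_expBound (MultErgodic.isCompact_inStrip δ b)
      (MultErgodic.isCompact_abs_mem_Icc ε (2 * Real.pi / h - ε)) fun a ha ω hω => by
        have hω0 : 0 < |ω| := hε.trans_le hω.1
        refine (hsr a ω ha (abs_pos.1 hω0)).resolve_right fun ⟨h', hle, hd⟩ => ?_
        -- Maximality of the span `h` bounds every decomposition, while `|ω| ≤ 2π/h - ε` would
        -- require one of span larger than `h`.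
        have h1 : 2 * Real.pi / |ω| ≤ h := hle.trans (hh.2 hd)
        have h2 : |ω| < 2 * Real.pi / h := by linarith [hω.2]
        rw [div_le_iff₀ hω0] at h1
        rw [lt_div_iff₀ hpos] at h2
        linarith
    exact ⟨b₀, B₀, hb, fun a ω ha h1 h2 x n _ => hB a ha ω ⟨h1, h2⟩ x n⟩
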